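/- Let $\mathbb K$ be $\mathbb R$ or $\mathbb C$, and let $\mathcal M$ be a (Hausdorff, second countable, finite-dimensional) smooth manifold. Let $\Omega^k(\mathcal M)$ be the space of smooth $\mathbb K$-valued differential $k$-forms, $\Omega^*(\mathcal M)=\bigoplus_k\Omega^k(\mathcal M)$ and $C^\infty(\mathcal M)=\Omega^0(\mathcal M)$. A \emph{generalized Poisson bracket} is a $\mathbb K$-bilinear map $\{\cdot,\cdot\}$ of degree $0$ on $\Omega^*(\mathcal M)$ which, together with the exterior derivative $d$ and the wedge product, makes $\Omega^*(\mathcal M)$ a differential graded Poisson algebra; that is, for homogeneous $\sigma,\rho,\lambda$, $$\{\sigma,\rho\}=-(-1)^{\deg\sigma\deg\rho}\{\rho,\sigma\},\qquad \{\{\sigma,\rho\},\lambda\}=\{\sigma,\{\rho,\lambda\}\}-(-1)^{\deg\sigma\deg\rho}\{\rho,\{\sigma,\lambda\}\},$$ $$d\{\sigma,\rho\}=\{d\sigma,\rho\}+(-1)^{\deg\sigma}\{\sigma,d\rho\},\qquad \{\sigma,\rho\wedge\lambda\}=\{\sigma,\rho\}\wedge\lambda+(-1)^{\deg\sigma\deg\rho}\rho\wedge\{\sigma,\lambda\}.$$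 A \emph{Poisson structure} is a smooth ($\mathbb K$-valued) bivector field $\pi$ such that $\{f,g\}=\pi(df,dg)$ satisfies the Jacobi identity. It determines $\#\alpha$ by $\beta(\#\alpha)=\pi(\alpha,\beta)$ and the Koszul bracket $[\alpha,\beta]_\pi=\mathcal L_{\#\alpha}\beta-\mathcal L_{\#\beta}\alpha-d(\pi(\alpha,\beta))$ of $1$-forms. A \emph{contravariant connection} is a $\mathbb K$-bilinear map $(\alpha,\beta)\mapsto\mathcal D_\alpha\beta$ on $\Omega^1(\mathcal M)$ with $\mathcal D_{f\alpha}\beta=f\mathcal D_\alpha\beta$ and $\mathcal D_\alpha(f\beta)=f\mathcal D_\alpha\beta+(\#\alpha)(f)\,\beta$; it extends to $2$-forms by $\mathcal D_\alpha(\beta\wedge\gamma)=\mathcal D_\alpha\beta\wedge\gamma+\beta\wedge\mathcal D_\alpha\gamma$. It is \emph{flat} if $\mathcal D_\alpha\mathcal D_\beta-\mathcal D_\beta\mathcal D_\alpha=\mathcal D_{[\alpha,\beta]_\pi}$ and \emph{torsion-free} if $\mathcal D_\alpha\beta-\mathcal D_\beta\alpha=[\alpha,\beta]_\pi$ for all $\alpha,\beta\in\Omega^1(\mathcal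 M)$. Put $\{f,\sigma\}=\mathcal D_{df}\sigma$ for $\sigma$ a $1$- or $2$-form, and let $\{\alpha,\beta\}\in\Omega^2(\mathcal M)$, for $1$-forms $\alpha,\beta$, be the bilinear map determined by $\{f\alpha,\beta\}=f\{\alpha,\beta\}+\alpha\wedge\{f,\beta\}$ and $d\{f,\alpha\}=\{df,\alpha\}+\{f,d\alpha\}$. The \emph{metacurvature} of a flat, torsion-free $\mathcal D$ is the tensor $M$ with $$M(df,\beta,\gamma)=\{f,\{\beta,\gamma\}\}-\{\{f,\beta\},\gamma\}-\{\{f,\gamma\},\beta\}.$$ Theorem. The following structures on $\mathcal M$ are equivalent: 1. a generalized Poisson bracket making $\Omega^*(\mathcal M)$ a differential graded Poisson algebra; 2. a Poisson structure $\pi$ together with a flat, torsion-free contravariant connection $\mathcal D$ with $M=0$. Precisely, there is a bijection between the structures 1 and the structures 2, under which $\{f,g\}=\pi(df,dg)$ and $\{f,\alpha\}=\mathcal D_{df}\alpha$ for all $f,g\in C^\infty(\mathcal M)$ and $\alpha\in\Omega^1(\mathcal M)$; moreover, the bracket maps real forms to real forms if and only if $\pi$ and $\mathcal D$ do. -/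

import Mathlib

open scoped Manifold ContDiff Topology DirectSum

namespace PoissonForms

noncomputable section

section Fibre

variable {𝕂 : Type*} [RCLike 𝕂]

theorem real_smul_alt {V : Type*} [AddCommGroup V] [Module ℝ V] [TopologicalSpace V] {n : ℕ} (r : ℝ)
    (c : V [⋀^Fin n]→L[ℝ] 𝕂) : r • c = (r : 𝕂) • c := by
  ext v
  exact RCLike.real_smul_eq_coe_mul _ _

/-- Pull-back of alternating forms along a linear map. -/
def pullAlt {V W : Type*} [AddCommGroup V] [Module ℝ V] [TopologicalSpace V]
    [AddCommGroup W] [Module ℝ W] [TopologicalSpace W] {k : ℕ} (g : W →L[ℝ] V) :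
    (V [⋀^Fin k]→L[ℝ] 𝕂) →ₗ[𝕂] (W [⋀^Fin k]→L[ℝ] 𝕂) where
  toFun a := a.compContinuousLinearMap g
  map_add' _ _ := rfl
  map_smul' _ _ := rfl

section Wedge

variable {V : Type*} [AddCommGroup V] [Module ℝ V] [TopologicalSpace V]

theorem mul'_summand {k l : ℕ} (a : V [⋀^Fin k]→L[ℝ] 𝕂) (b : V [⋀^Fin l]→L[ℝ] 𝕂)
    (s : Equiv.Perm (Fin k ⊕ Fin l)) (v : Fin k ⊕ Fin l → V) :
    LinearMap.mul' ℝ 𝕂 (AlternatingMap.domCoprod.summand a.toAlternatingMap b.toAlternatingMap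
      (Quotient.mk'' s) v) =
      (((Equiv.Perm.sign s : ℤˣ) : ℤ) : 𝕂) *
        (a (fun i ↦ v (s (Sum.inl i))) * b (fun i ↦ v (s (Sum.inr i)))) := by
  rw [AlternatingMap.domCoprod.summand_mk'']
  rcases Int.units_eq_one_or (Equiv.Perm.sign s) with h | h
  · rw [h, one_smul]
    simp
  · rw [h, Units.neg_smul, one_smul, neg_apply, map_neg]
    simp

/-- The wedge product of `𝕂`-valued alternating forms, i.e. the sum over shuffles
`(a ∧ b)(v₁, …, v_{k+l}) = ∑ sign(s) a(v_{s 1}, …, v_{s k}) b(v_{s (k+1)}, …, v_{s (k+l)})`. -/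
def altWedge {k l : ℕ} (a : V [⋀^Fin k]→L[ℝ] 𝕂) (b : V [⋀^Fin l]→L[ℝ] 𝕂) :
    V [⋀^Fin (k + l)]→L[ℝ] 𝕂 :=
  { ((LinearMap.mul' ℝ 𝕂).compAlternatingMap
      (a.toAlternatingMap.domCoprod b.toAlternatingMap)).domDomCongr finSumFinEquiv with
    cont := by
      change Continuous fun v : Fin (k + l) → V ↦ LinearMap.mul' ℝ 𝕂
        ((∑ s : Equiv.Perm.ModSumCongr (Fin k) (Fin l), AlternatingMap.domCoprod.summand
          a.toAlternatingMap b.toAlternatingMap s) (fun i ↦ v (finSumFinEquiv i)))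
      simp only [sum_apply, map_sum]
      refine continuous_finsetSum _ fun s _ ↦ ?_
      induction s using Quotient.inductionOn' with
      | h s =>
        simp only [mul'_summand]
        refine continuous_const.mul (Continuous.mul ?_ ?_)
        · exact a.cont.comp (continuous_pi fun i ↦ continuous_apply _)
        · exact b.cont.comp (continuous_pi fun i ↦ continuous_apply _) }

theorem altWedge_apply {k l : ℕ} (a : V [⋀^Fin k]→L[ℝ] 𝕂) (b : V [⋀^Fin l]→L[ℝ] 𝕂)
    (v : Fin (k + l) → V) :
    altWedge a b v = ∑ s : Equiv.Perm.ModSumCongr (Fin k) (Fin l), LinearMap.mul' ℝ 𝕂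
      (AlternatingMap.domCoprod.summand a.toAlternatingMap b.toAlternatingMap s
        fun i ↦ v (finSumFinEquiv i)) := by
  change LinearMap.mul' ℝ 𝕂
        ((∑ s : Equiv.Perm.ModSumCongr (Fin k) (Fin l), AlternatingMap.domCoprod.summand
          a.toAlternatingMap b.toAlternatingMap s) (fun i ↦ v (finSumFinEquiv i))) = _
  simp only [sum_apply, map_sum]

theorem altWedge_comp {W : Type*} [AddCommGroup W] [Module ℝ W] [TopologicalSpace W] {k l : ℕ}
    (a : V [⋀^Fin k]→L[ℝ] 𝕂) (b : V [⋀^Fin l]→L[ℝ] 𝕂) (g : W →L[ℝ] V) :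
    (altWedge a b).compContinuousLinearMap g =
      altWedge (a.compContinuousLinearMap g) (b.compContinuousLinearMap g) := by
  ext v
  simp only [ContinuousAlternatingMap.compContinuousLinearMap_apply, altWedge_apply]
  refine Finset.sum_congr rfl fun s _ ↦ ?_
  induction s using Quotient.inductionOn' with
  | h s => rfl

theorem altWedge_add_left {k l : ℕ} (a a' : V [⋀^Fin k]→L[ℝ] 𝕂) (b : V [⋀^Fin l]→L[ℝ] 𝕂) :
    altWedge (a + a') b = altWedge a b + altWedge a' b := by
  ext v
  simp only [ContinuousAlternatingMap.add_apply, altWedge_apply, ← Finset.sum_add_distrib]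
  refine Finset.sum_congr rfl fun s _ ↦ ?_
  induction s using Quotient.inductionOn' with
  | h s => simp only [mul'_summand, ContinuousAlternatingMap.add_apply]; ring

theorem altWedge_add_right {k l : ℕ} (a : V [⋀^Fin k]→L[ℝ] 𝕂) (b b' : V [⋀^Fin l]→L[ℝ] 𝕂) :
    altWedge a (b + b') = altWedge a b + altWedge a b' := by
  ext v
  simp only [ContinuousAlternatingMap.add_apply, altWedge_apply, ← Finset.sum_add_distrib]
  refine Finset.sum_congr rfl fun s _ ↦ ?_
  induction s using Quotient.inductionOn' with
  | h s => simp only [mul'_summand, ContinuousAlternatingMap.add_apply]; ring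

theorem altWedge_smul_left {k l : ℕ} (c : 𝕂) (a : V [⋀^Fin k]→L[ℝ] 𝕂) (b : V [⋀^Fin l]→L[ℝ] 𝕂) :
    altWedge (c • a) b = c • altWedge a b := by
  ext v
  simp only [ContinuousAlternatingMap.smul_apply, altWedge_apply, Finset.smul_sum]
  refine Finset.sum_congr rfl fun s _ ↦ ?_
  induction s using Quotient.inductionOn' with
  | h s => simp only [mul'_summand, ContinuousAlternatingMap.smul_apply, smul_eq_mul]; ring

theorem altWedge_smul_right {k l : ℕ} (c : 𝕂) (a : V [⋀^Fin k]→L[ℝ] 𝕂) (b : V [⋀^Fin l]→L[ℝ] 𝕂) :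
    altWedge a (c • b) = c • altWedge a b := by
  ext v
  simp only [ContinuousAlternatingMap.smul_apply, altWedge_apply, Finset.smul_sum]
  refine Finset.sum_congr rfl fun s _ ↦ ?_
  induction s using Quotient.inductionOn' with
  | h s => simp only [mul'_summand, ContinuousAlternatingMap.smul_apply, smul_eq_mul]; ring

end Wedge

section FiniteDim

variable {E : Type*} [NormedAddCommGroup E] [NormedSpace ℝ E] [FiniteDimensional ℝ E]

instance instFiniteDimensionalAlt (k : ℕ) : FiniteDimensional ℝ (E [⋀^Fin k]→L[ℝ] 𝕂) :=
  haveI : Module.Finite ℝ (MultilinearMap ℝ (fun _ : Fin k ↦ E) 𝕂) :=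
    Module.Finite.multilinearMap
  FiniteDimensional.of_injective
    ({ toFun := fun a ↦ a.toMultilinearMap
       map_add' := fun _ _ ↦ rfl
       map_smul' := fun _ _ ↦ rfl } :
      E [⋀^Fin k]→L[ℝ] 𝕂 →ₗ[ℝ] MultilinearMap ℝ (fun _ : Fin k ↦ E) 𝕂)
    fun a b h ↦ by
      ext v
      exact congrArg (fun m : MultilinearMap ℝ (fun _ : Fin k ↦ E) 𝕂 ↦ m v) h

theorem contDiffOn_bilin {D X Y Z : Type*} [NormedAddCommGroup D] [NormedSpace ℝ D]
    [NormedAddCommGroup X] [NormedSpace ℝ X] [NormedAddCommGroup Y] [NormedSpace ℝ Y]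
    [NormedAddCommGroup Z] [NormedSpace ℝ Z] [FiniteDimensional ℝ X] [FiniteDimensional ℝ Y]
    (B : X →ₗ[ℝ] Y →ₗ[ℝ] Z) {a : D → X} {b : D → Y} {s : Set D}
    (ha : ContDiffOn ℝ ∞ a s) (hb : ContDiffOn ℝ ∞ b s) :
    ContDiffOn ℝ ∞ (fun y ↦ B (a y) (b y)) s :=
  (contDiffOn_const (c := B.toContinuousBilinearMap)).clm_apply ha |>.clm_apply hb

theorem contDiffOn_altWedge {k l : ℕ} {a : E → E [⋀^Fin k]→L[ℝ] 𝕂} {b : E → E [⋀^Fin l]→L[ℝ] 𝕂}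
    {s : Set E} (ha : ContDiffOn ℝ ∞ a s) (hb : ContDiffOn ℝ ∞ b s) :
    ContDiffOn ℝ ∞ (fun y ↦ altWedge (a y) (b y)) s := by
  let B : (E [⋀^Fin k]→L[ℝ] 𝕂) →ₗ[ℝ] (E [⋀^Fin l]→L[ℝ] 𝕂) →ₗ[ℝ] (E [⋀^Fin (k + l)]→L[ℝ] 𝕂) :=
    LinearMap.mk₂ ℝ altWedge altWedge_add_left
      (fun r a b ↦ by simp only [real_smul_alt, altWedge_smul_left]) altWedge_add_right
      (fun r a b ↦ by simp only [real_smul_alt, altWedge_smul_right])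
  exact contDiffOn_bilin B ha hb

end FiniteDim

theorem contDiffOn_bilin_family {D X Y Z : Type*} [NormedAddCommGroup D] [NormedSpace ℝ D]
    [NormedAddCommGroup X] [NormedSpace ℝ X] [NormedAddCommGroup Y] [NormedSpace ℝ Y]
    [NormedAddCommGroup Z] [NormedSpace ℝ Z] [FiniteDimensional ℝ X] [FiniteDimensional ℝ Y]
    (B : D → X →ₗ[ℝ] Y →ₗ[ℝ] Z) {a : D → X} {b : D → Y} {s : Set D}
    (hB : ∀ x y, ContDiffOn ℝ ∞ (fun z ↦ B z x y) s)
    (ha : ContDiffOn ℝ ∞ a s) (hb : ContDiffOn ℝ ∞ b s) :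
    ContDiffOn ℝ ∞ (fun y ↦ B y (a y) (b y)) s := by
  have h : ContDiffOn ℝ ∞ (fun z ↦ (B z).toContinuousBilinearMap) s :=
    contDiffOn_clm_apply.2 fun x ↦ contDiffOn_clm_apply.2 fun y ↦ hB x y
  exact (h.clm_apply ha).clm_apply hb

variable {E : Type*} [NormedAddCommGroup E] [NormedSpace ℝ E]

/-- For a bivector `P` at a point, a covector `ξ` and a `2`-form `w`, the contraction
`ι_{#ξ} w`, where `#ξ` is the vector with `η(#ξ) = P(ξ, η)`; that is,
`(ι_{#ξ} w)(v) = w(#ξ, v) = P(ξ, w(·, v)) = P(w(v, ·), ξ)`. -/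
def contractAt [FiniteDimensional ℝ E]
    (P : (E [⋀^Fin 1]→L[ℝ] 𝕂) →ₗ[𝕂] (E [⋀^Fin 1]→L[ℝ] 𝕂) →ₗ[𝕂] 𝕂)
    (ξ : E [⋀^Fin 1]→L[ℝ] 𝕂) (w : E [⋀^Fin 2]→L[ℝ] 𝕂) : E [⋀^Fin 1]→L[ℝ] 𝕂 :=
  ContinuousAlternatingMap.ofSubsingleton ℝ E 𝕂 (0 : Fin 1) <| LinearMap.toContinuousLinearMap
    { toFun := fun v ↦ P (w.curryLeft v) ξ
      map_add' := fun u v ↦ by simp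
      map_smul' := fun r v ↦ by
        have h : (w.curryLeft (r • v) : E [⋀^Fin 1]→L[ℝ] 𝕂) = (r : 𝕂) • w.curryLeft v := by
          rw [map_smul]
          ext u
          exact RCLike.real_smul_eq_coe_mul _ _
        rw [h, map_smul, LinearMap.smul_apply, RingHom.id_apply]
        exact (RCLike.real_smul_eq_coe_mul _ _).symm }

theorem contractAt_pull [FiniteDimensional ℝ E]
    (P : (E [⋀^Fin 1]→L[ℝ] 𝕂) →ₗ[𝕂] (E [⋀^Fin 1]→L[ℝ] 𝕂) →ₗ[𝕂] 𝕂)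
    (ξ : E [⋀^Fin 1]→L[ℝ] 𝕂) (w : E [⋀^Fin 2]→L[ℝ] 𝕂) (A B : E →L[ℝ] E)
    (h : B ∘L A = ContinuousLinearMap.id ℝ E) :
    (contractAt P (pullAlt B ξ) (pullAlt B w)).compContinuousLinearMap A =
      contractAt (P.compl₁₂ (pullAlt B) (pullAlt B)) ξ w := by
  ext v
  change P ((pullAlt B w).curryLeft (A (v 0))) (pullAlt B ξ) =
    P (pullAlt B (w.curryLeft (v 0))) (pullAlt B ξ)
  congr 2
  ext u
  change w (fun i ↦ B (Matrix.vecCons (A (v 0)) u i)) =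
    w (Matrix.vecCons (v 0) (fun i ↦ B (u i)))
  congr 1
  funext i
  refine Fin.cases ?_ (fun j ↦ rfl) i
  exact DFunLike.congr_fun h (v 0)

end Fibre

section Forms

variable {𝕂 : Type*} [RCLike 𝕂] {E : Type*} [NormedAddCommGroup E] [NormedSpace ℝ E]
  {M : Type*} [TopologicalSpace M] [ChartedSpace E M]

/-- The coordinate representation of a (not necessarily smooth) form in the preferred chart `φ`
at `p`: the pull-back of the form along `φ⁻¹`, to be considered on the target of `φ`. -/
def localRep {k : ℕ} (σ : ∀ x : M, TangentSpace 𝓘(ℝ, E) x [⋀^Fin k]→L[ℝ] 𝕂) (p : M) (y : E) :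
    E [⋀^Fin k]→L[ℝ] 𝕂 :=
  (σ ((extChartAt 𝓘(ℝ, E) p).symm y)).compContinuousLinearMap
    (mfderiv 𝓘(ℝ, E) 𝓘(ℝ, E) (extChartAt 𝓘(ℝ, E) p).symm y)

variable (𝕂 E M) in
/-- The space `Ω^k(M)` of smooth `𝕂`-valued differential `k`-forms on `M`. -/
def Form (k : ℕ) : Submodule 𝕂 (∀ x : M, TangentSpace 𝓘(ℝ, E) x [⋀^Fin k]→L[ℝ] 𝕂) where
  carrier := {σ | ∀ p, ContDiffOn ℝ ∞ (localRep σ p) (extChartAt 𝓘(ℝ, E) p).target}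
  add_mem' ha hb p := (ha p).add (hb p)
  zero_mem' _ := contDiffOn_const (c := 0)
  smul_mem' c _ ha p := (ha p).const_smul c

theorem Form.ext {k : ℕ} {σ τ : Form 𝕂 E M k} (h : ∀ x, σ.1 x = τ.1 x) : σ = τ :=
  Subtype.ext (funext h)

/-- The wedge product of differential forms. -/
def wedge [FiniteDimensional ℝ E] (k l : ℕ) :
    Form 𝕂 E M k →ₗ[𝕂] Form 𝕂 E M l →ₗ[𝕂] Form 𝕂 E M (k + l) :=
  LinearMap.mk₂ 𝕂
    (fun σ τ ↦ ⟨fun x ↦ altWedge (σ.1 x) (τ.1 x), fun p ↦ by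
      refine (contDiffOn_altWedge (σ.2 p) (τ.2 p)).congr fun y _ ↦ ?_
      exact altWedge_comp _ _ _⟩)
    (fun _ _ _ ↦ Form.ext fun _ ↦ altWedge_add_left _ _ _)
    (fun _ _ _ ↦ Form.ext fun _ ↦ altWedge_smul_left _ _ _)
    (fun _ _ _ ↦ Form.ext fun _ ↦ altWedge_add_right _ _ _)
    (fun _ _ _ ↦ Form.ext fun _ ↦ altWedge_smul_right _ _ _)

theorem isOpen_target (p : M) : IsOpen (extChartAt 𝓘(ℝ, E) p).target :=
  isOpen_extChartAt_target p

theorem mfderiv_chart_comp_symm [IsManifold 𝓘(ℝ, E) ∞ M] {p : M} {y : E}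
    (hy : y ∈ (extChartAt 𝓘(ℝ, E) p).target) :
    (mfderiv 𝓘(ℝ, E) 𝓘(ℝ, E) (extChartAt 𝓘(ℝ, E) p) ((extChartAt 𝓘(ℝ, E) p).symm y)) ∘L
      (mfderiv 𝓘(ℝ, E) 𝓘(ℝ, E) (extChartAt 𝓘(ℝ, E) p).symm y) = ContinuousLinearMap.id ℝ _ := by
  have := mfderiv_extChartAt_comp_mfderivWithin_extChartAt_symm (I := 𝓘(ℝ, E)) hy
  simpa [mfderivWithin_univ] using this

/-- A form is recovered from its representative in a chart. -/
theorem localRep_comp_mfderiv [IsManifold 𝓘(ℝ, E) ∞ M] {k : ℕ}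
    (σ : ∀ x : M, TangentSpace 𝓘(ℝ, E) x [⋀^Fin k]→L[ℝ] 𝕂) {p m : M}
    (hm : m ∈ (extChartAt 𝓘(ℝ, E) p).source) :
    (localRep σ p (extChartAt 𝓘(ℝ, E) p m)).compContinuousLinearMap
      (mfderiv 𝓘(ℝ, E) 𝓘(ℝ, E) (extChartAt 𝓘(ℝ, E) p) m) = σ m := by
  have key := mfderivWithin_extChartAt_symm_comp_mfderiv_extChartAt' (I := 𝓘(ℝ, E)) hm
  simp only [modelWithCornersSelf_coe, Set.range_id, mfderivWithin_univ] at key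
  let σ' : M → E [⋀^Fin k]→L[ℝ] 𝕂 := σ
  have h : σ' ((extChartAt 𝓘(ℝ, E) p).symm (extChartAt 𝓘(ℝ, E) p m)) = σ' m :=
    congrArg σ' ((extChartAt 𝓘(ℝ, E) p).left_inv hm)
  ext v
  refine (congrArg (fun a : E [⋀^Fin k]→L[ℝ] 𝕂 ↦ a (fun i ↦
    mfderiv 𝓘(ℝ, E) 𝓘(ℝ, E) (extChartAt 𝓘(ℝ, E) p).symm (extChartAt 𝓘(ℝ, E) p m)
      (mfderiv 𝓘(ℝ, E) 𝓘(ℝ, E) (extChartAt 𝓘(ℝ, E) p) m (v i)))) h).trans ?_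
  refine congrArg (σ m) (funext fun i ↦ ?_)
  exact DFunLike.congr_fun key (v i)

/-- The exterior derivative at `x`, computed in the preferred chart at `x`. -/
def extDerivAt {k : ℕ} (σ : ∀ x : M, TangentSpace 𝓘(ℝ, E) x [⋀^Fin k]→L[ℝ] 𝕂) (x : M) :
    TangentSpace 𝓘(ℝ, E) x [⋀^Fin (k + 1)]→L[ℝ] 𝕂 :=
  (extDeriv (localRep σ x) (extChartAt 𝓘(ℝ, E) x x)).compContinuousLinearMap
    (mfderiv 𝓘(ℝ, E) 𝓘(ℝ, E) (extChartAt 𝓘(ℝ, E) x) x)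

theorem Form.differentiableAt {k : ℕ} (σ : Form 𝕂 E M k) {p : M} {y : E}
    (hy : y ∈ (extChartAt 𝓘(ℝ, E) p).target) : DifferentiableAt ℝ (localRep σ.1 p) y :=
  ((σ.2 p).contDiffAt ((isOpen_target p).mem_nhds hy)).differentiableAt (by simp)

theorem mdiff_symm [IsManifold 𝓘(ℝ, E) ∞ M] {p : M} {z : E}
    (hz : z ∈ (extChartAt 𝓘(ℝ, E) p).target) :
    MDifferentiableAt 𝓘(ℝ, E) 𝓘(ℝ, E) (extChartAt 𝓘(ℝ, E) p).symm z :=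
  ((contMDiffOn_extChartAt_symm (n := ∞) p).contMDiffAt
    ((isOpen_target p).mem_nhds hz)).mdifferentiableAt (by simp)

/-- In any chart the exterior derivative of a form is represented by the exterior derivative of
its representative. -/
theorem localRep_extDerivAt [IsManifold 𝓘(ℝ, E) ∞ M] {k : ℕ} (σ : Form 𝕂 E M k) {p : M} {y : E}
    (hy : y ∈ (extChartAt 𝓘(ℝ, E) p).target) :
    localRep (extDerivAt σ.1) p y = extDeriv (localRep σ.1 p) y := by
  set x := (extChartAt 𝓘(ℝ, E) p).symm y with hx
  set t : E → E := fun z ↦ extChartAt 𝓘(ℝ, E) x ((extChartAt 𝓘(ℝ, E) p).symm z) with ht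
  have hsymm : MDifferentiableAt 𝓘(ℝ, E) 𝓘(ℝ, E) (extChartAt 𝓘(ℝ, E) p).symm y := mdiff_symm hy
  have hcont : ContinuousAt (extChartAt 𝓘(ℝ, E) p).symm y := hsymm.continuousAt
  have hsrc : ∀ᶠ z in 𝓝 y, z ∈ (extChartAt 𝓘(ℝ, E) p).target ∧
      (extChartAt 𝓘(ℝ, E) p).symm z ∈ (extChartAt 𝓘(ℝ, E) x).source :=
    ((isOpen_target p).eventually_mem hy).and
      (hcont.eventually (extChartAt_source_mem_nhds (I := 𝓘(ℝ, E)) x))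
  have hfd : ∀ z, z ∈ (extChartAt 𝓘(ℝ, E) p).target →
      (extChartAt 𝓘(ℝ, E) p).symm z ∈ (extChartAt 𝓘(ℝ, E) x).source →
      fderiv ℝ t z = (mfderiv 𝓘(ℝ, E) 𝓘(ℝ, E) (extChartAt 𝓘(ℝ, E) x)
        ((extChartAt 𝓘(ℝ, E) p).symm z)) ∘L
        (mfderiv 𝓘(ℝ, E) 𝓘(ℝ, E) (extChartAt 𝓘(ℝ, E) p).symm z) := by
    intro z hz hz'
    rw [← mfderiv_eq_fderiv]
    exact mfderiv_comp z (mdifferentiableAt_extChartAt (by simpa using hz')) (mdiff_symm hz)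
  have hty : ContDiffAt ℝ ∞ t y := by
    have h1 : ContMDiffAt 𝓘(ℝ, E) 𝓘(ℝ, E) ∞ (extChartAt 𝓘(ℝ, E) p).symm y :=
      (contMDiffOn_extChartAt_symm (n := ∞) p).contMDiffAt ((isOpen_target p).mem_nhds hy)
    have h2 : ContMDiffAt 𝓘(ℝ, E) 𝓘(ℝ, E) ∞ (extChartAt 𝓘(ℝ, E) x)
        ((extChartAt 𝓘(ℝ, E) p).symm y) := contMDiffAt_extChartAt
    exact (h2.comp y h1).contDiffAt
  have hev : localRep σ.1 p =ᶠ[𝓝 y]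
      fun z ↦ (localRep σ.1 x (t z)).compContinuousLinearMap (fderiv ℝ t z) := by
    filter_upwards [hsrc] with z hz
    rw [hfd z hz.1 hz.2]
    exact (congrArg (fun a ↦ a.compContinuousLinearMap
      (mfderiv 𝓘(ℝ, E) 𝓘(ℝ, E) (extChartAt 𝓘(ℝ, E) p).symm z))
      (localRep_comp_mfderiv σ.1 hz.2)).symm
  have hd : DifferentiableAt ℝ (localRep σ.1 x) (t y) :=
    Form.differentiableAt σ (mem_extChartAt_target x)
  rw [hev.extDeriv_eq, extDeriv_pullback (r := ∞) hd hty
    (by simpa using WithTop.coe_le_coe.2 (le_top : (2 : ℕ∞) ≤ ⊤)),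
    hfd y hy (mem_extChartAt_source x)]
  rfl

/-- The exterior derivative `d : Ω^k(M) → Ω^{k+1}(M)`. -/
def extD [IsManifold 𝓘(ℝ, E) ∞ M] (k : ℕ) : Form 𝕂 E M k →ₗ[𝕂] Form 𝕂 E M (k + 1) where
  toFun σ := ⟨extDerivAt σ.1, fun p ↦ by
    refine ContDiffOn.congr (f := fun y ↦ extDeriv (localRep σ.1 p) y) ?_
      fun y hy ↦ localRep_extDerivAt σ hy
    have h : ContDiffOn ℝ ∞ (fderiv ℝ (localRep σ.1 p)) (extChartAt 𝓘(ℝ, E) p).target :=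
      (σ.2 p).fderiv_of_isOpen (isOpen_target p) (by simp)
    exact (ContinuousAlternatingMap.alternatizeUncurryFinCLM ℝ E 𝕂).contDiff.comp_contDiffOn h⟩
  map_add' σ τ := Form.ext fun x ↦ by
    change (extDeriv (localRep σ.1 x + localRep τ.1 x) _).compContinuousLinearMap _ = _
    rw [extDeriv_add (Form.differentiableAt σ (mem_extChartAt_target x))
      (Form.differentiableAt τ (mem_extChartAt_target x))]
    rfl
  map_smul' c σ := Form.ext fun x ↦ by
    change (extDeriv (c • localRep σ.1 x) _).compContinuousLinearMap _ = _
    rw [extDeriv, fderiv_const_smul (Form.differentiableAt σ (mem_extChartAt_target x)),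
      ContinuousAlternatingMap.alternatizeUncurryFin_smul]
    rfl

/-- The ring `C^∞(M)` of smooth `𝕂`-valued functions. -/
abbrev SmoothFun (𝕂 E M : Type*) [RCLike 𝕂] [NormedAddCommGroup E] [NormedSpace ℝ E]
    [TopologicalSpace M] [ChartedSpace E M] := C^∞⟮𝓘(ℝ, E), M; 𝓘(ℝ, 𝕂), 𝕂⟯

theorem SmoothFun.contDiffOn [IsManifold 𝓘(ℝ, E) ∞ M] (f : SmoothFun 𝕂 E M) (p : M) :
    ContDiffOn ℝ ∞ (fun y ↦ f ((extChartAt 𝓘(ℝ, E) p).symm y)) (extChartAt 𝓘(ℝ, E) p).target :=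
  (f.contMDiff.comp_contMDiffOn (contMDiffOn_extChartAt_symm p)).contDiffOn

theorem contMDiff_of_charts [IsManifold 𝓘(ℝ, E) ∞ M] {f : M → 𝕂}
    (h : ∀ p, ContDiffOn ℝ ∞ (fun y ↦ f ((extChartAt 𝓘(ℝ, E) p).symm y))
      (extChartAt 𝓘(ℝ, E) p).target) : ContMDiff 𝓘(ℝ, E) 𝓘(ℝ, 𝕂) ∞ f := by
  intro x
  have h1 : ContMDiffAt 𝓘(ℝ, E) 𝓘(ℝ, 𝕂) ∞ (fun y ↦ f ((extChartAt 𝓘(ℝ, E) x).symm y))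
      (extChartAt 𝓘(ℝ, E) x x) :=
    ((h x).contDiffAt ((isOpen_target x).mem_nhds (mem_extChartAt_target x))).contMDiffAt
  refine (h1.comp x contMDiffAt_extChartAt).congr_of_eventuallyEq ?_
  filter_upwards [extChartAt_source_mem_nhds (I := 𝓘(ℝ, E)) x] with z hz
  exact congrArg f ((extChartAt 𝓘(ℝ, E) x).left_inv hz).symm

/-- A smooth function, considered as a differential `0`-form. -/
def ofFun [IsManifold 𝓘(ℝ, E) ∞ M] (f : SmoothFun 𝕂 E M) : Form 𝕂 E M 0 :=
  ⟨fun x ↦ ContinuousAlternatingMap.constOfIsEmpty ℝ _ (Fin 0) (f x), fun p ↦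
    (ContinuousAlternatingMap.constOfIsEmptyLIE ℝ E 𝕂 (Fin 0)).contDiff.comp_contDiffOn
      (SmoothFun.contDiffOn f p)⟩

/-- The differential `df` of a smooth function. -/
def dFun [IsManifold 𝓘(ℝ, E) ∞ M] (f : SmoothFun 𝕂 E M) : Form 𝕂 E M 1 := extD 0 (ofFun f)

/-- The pointwise product of a smooth function and a form. -/
instance instSMulSmoothFun [IsManifold 𝓘(ℝ, E) ∞ M] (k : ℕ) : SMul (SmoothFun 𝕂 E M) (Form 𝕂 E M k) where
  smul f σ := ⟨fun x ↦ f x • σ.1 x, fun p ↦ (SmoothFun.contDiffOn f p).smul (σ.2 p)⟩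

/-- The coordinate representation, in the preferred chart `φ` at `p`, of a family of bilinear forms
on the cotangent spaces: `(ξ, η) ↦ P_{φ⁻¹(y)}(φ^* ξ, φ^* η)` for covectors `ξ`, `η` on `E`. -/
def bivectorRep (P : ∀ x : M, (TangentSpace 𝓘(ℝ, E) x [⋀^Fin 1]→L[ℝ] 𝕂) →ₗ[𝕂]
    (TangentSpace 𝓘(ℝ, E) x [⋀^Fin 1]→L[ℝ] 𝕂) →ₗ[𝕂] 𝕂) (p : M) (y : E) :
    (E [⋀^Fin 1]→L[ℝ] 𝕂) →ₗ[𝕂] (E [⋀^Fin 1]→L[ℝ] 𝕂) →ₗ[𝕂] 𝕂 :=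
  (P ((extChartAt 𝓘(ℝ, E) p).symm y)).compl₁₂
    (pullAlt (mfderiv 𝓘(ℝ, E) 𝓘(ℝ, E) (extChartAt 𝓘(ℝ, E) p) ((extChartAt 𝓘(ℝ, E) p).symm y)))
    (pullAlt (mfderiv 𝓘(ℝ, E) 𝓘(ℝ, E) (extChartAt 𝓘(ℝ, E) p) ((extChartAt 𝓘(ℝ, E) p).symm y)))

variable (𝕂 E M) in
/-- A smooth bivector field, viewed as a family of alternating bilinear forms on the cotangent
spaces whose components in each chart are smooth. -/
structure Bivector where
  toFun : ∀ x : M, (TangentSpace 𝓘(ℝ, E) x [⋀^Fin 1]→L[ℝ] 𝕂) →ₗ[𝕂]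
    (TangentSpace 𝓘(ℝ, E) x [⋀^Fin 1]→L[ℝ] 𝕂) →ₗ[𝕂] 𝕂
  alt : ∀ x ξ, toFun x ξ ξ = 0
  smooth : ∀ (p : M) (ξ η : E [⋀^Fin 1]→L[ℝ] 𝕂),
    ContDiffOn ℝ ∞ (fun y ↦ bivectorRep toFun p y ξ η) (extChartAt 𝓘(ℝ, E) p).target

theorem pull_localRep [IsManifold 𝓘(ℝ, E) ∞ M] {k : ℕ} (σ : Form 𝕂 E M k) {p : M} {y : E}
    (hy : y ∈ (extChartAt 𝓘(ℝ, E) p).target) :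
    pullAlt (V := E) (W := TangentSpace 𝓘(ℝ, E) ((extChartAt 𝓘(ℝ, E) p).symm y))
      (mfderiv 𝓘(ℝ, E) 𝓘(ℝ, E) (extChartAt 𝓘(ℝ, E) p) ((extChartAt 𝓘(ℝ, E) p).symm y))
      (localRep σ.1 p y) = σ.1 ((extChartAt 𝓘(ℝ, E) p).symm y) := by
  have h := localRep_comp_mfderiv σ.1 ((extChartAt 𝓘(ℝ, E) p).map_target hy)
  rwa [(extChartAt 𝓘(ℝ, E) p).right_inv hy] at h

namespace Bivector

theorem contDiffOn_rep [FiniteDimensional ℝ E] (π : Bivector 𝕂 E M) (p : M) {a b : E → E [⋀^Fin 1]→L[ℝ] 𝕂}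
    (ha : ContDiffOn ℝ ∞ a (extChartAt 𝓘(ℝ, E) p).target)
    (hb : ContDiffOn ℝ ∞ b (extChartAt 𝓘(ℝ, E) p).target) :
    ContDiffOn ℝ ∞ (fun y ↦ bivectorRep π.toFun p y (a y) (b y))
      (extChartAt 𝓘(ℝ, E) p).target :=
  contDiffOn_bilin_family (fun y ↦ (bivectorRep π.toFun p y).restrictScalars₁₂ ℝ ℝ)
    (π.smooth p) ha hb

variable [FiniteDimensional ℝ E] [IsManifold 𝓘(ℝ, E) ∞ M]

/-- The smooth function `π(α, β)`. -/
def pair (π : Bivector 𝕂 E M) (α β : Form 𝕂 E M 1) : SmoothFun 𝕂 E M :=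
  ⟨fun x ↦ π.toFun x (α.1 x) (β.1 x), contMDiff_of_charts fun p ↦
    (π.contDiffOn_rep p (α.2 p) (β.2 p)).congr fun y hy ↦ by
      rw [← pull_localRep α hy, ← pull_localRep β hy]
      rfl⟩

/-- The action `(#α)(f) = π(α, df)` of the vector field `#α` on a function. -/
def anchor (π : Bivector 𝕂 E M) (α : Form 𝕂 E M 1) (f : SmoothFun 𝕂 E M) : SmoothFun 𝕂 E M :=
  π.pair α (dFun f)

/-- The bracket `{f, g} = π(df, dg)` of functions. -/
def bracket (π : Bivector 𝕂 E M) (f g : SmoothFun 𝕂 E M) : SmoothFun 𝕂 E M :=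
  π.pair (dFun f) (dFun g)

/-- `π` is a Poisson bivector: the bracket of functions satisfies the Jacobi identity. -/
def IsPoisson (π : Bivector 𝕂 E M) : Prop :=
  ∀ f g h : SmoothFun 𝕂 E M,
    π.bracket (π.bracket f g) h = π.bracket f (π.bracket g h) - π.bracket g (π.bracket f h)

/-- The contraction `ι_{#α} θ` of a `2`-form with the vector field `#α`. -/
def contract (π : Bivector 𝕂 E M) (α : Form 𝕂 E M 1) (θ : Form 𝕂 E M 2) : Form 𝕂 E M 1 :=
  ⟨fun x ↦ contractAt (E := E) (π.toFun x) (α.1 x) (θ.1 x), fun p ↦ by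
    have h : ContDiffOn ℝ ∞ (fun y ↦ contractAt (bivectorRep π.toFun p y) (localRep α.1 p y)
        (localRep θ.1 p y)) (extChartAt 𝓘(ℝ, E) p).target := by
      refine (ContinuousAlternatingMap.ofSubsingletonLIE (𝕜 := ℝ) (E := E) (F := 𝕂)
        (0 : Fin 1)).contDiff.comp_contDiffOn
        (contDiffOn_clm_apply.2 fun v ↦ π.contDiffOn_rep p ?_ (α.2 p))
      exact ((ContinuousAlternatingMap.curryLeftLI (𝕜 := ℝ) (E := E) (F := 𝕂)
        (n := 1)).contDiff.comp_contDiffOn (θ.2 p)).clm_apply contDiffOn_const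
    refine h.congr fun y hy ↦ ?_
    exact (congrArg₂ (fun a w ↦ (contractAt (E := E)
        (π.toFun ((extChartAt 𝓘(ℝ, E) p).symm y)) a w).compContinuousLinearMap
        (mfderiv 𝓘(ℝ, E) 𝓘(ℝ, E) (extChartAt 𝓘(ℝ, E) p).symm y))
      (pull_localRep α hy).symm (pull_localRep θ hy).symm).trans
      (contractAt_pull _ _ _ _ _ (mfderiv_chart_comp_symm hy))⟩

/-- The Koszul bracket of `1`-forms,
`[α, β]_π = L_{#α} β - L_{#β} α - d(π(α, β)) = ι_{#α} dβ - ι_{#β} dα + d(π(α, β))`. -/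
def koszul (π : Bivector 𝕂 E M) (α β : Form 𝕂 E M 1) : Form 𝕂 E M 1 :=
  π.contract α (extD 1 β) - π.contract β (extD 1 α) + dFun (π.pair α β)

end Bivector

section Connection

variable [FiniteDimensional ℝ E] [IsManifold 𝓘(ℝ, E) ∞ M]

/-- A contravariant connection on the bundle of `k`-forms, i.e. a connection with respect to the
cotangent Lie algebroid of the bivector `π`. For `k = 1` this is a contravariant connection on
`T^*M`. -/
structure IsContravariantConnection (π : Bivector 𝕂 E M) {k : ℕ}
    (D : Form 𝕂 E M 1 →ₗ[𝕂] Form 𝕂 E M k →ₗ[𝕂] Form 𝕂 E M k) : Prop where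
  smul_left : ∀ (f : SmoothFun 𝕂 E M) (α : Form 𝕂 E M 1) (σ : Form 𝕂 E M k),
    D (f • α) σ = f • D α σ
  leibniz : ∀ (f : SmoothFun 𝕂 E M) (α : Form 𝕂 E M 1) (σ : Form 𝕂 E M k),
    D α (f • σ) = f • D α σ + π.anchor α f • σ

/-- The curvature `K(α, β)γ = D_α D_β γ - D_β D_α γ - D_{[α, β]_π} γ`. -/
def curvature (π : Bivector 𝕂 E M)
    (D : Form 𝕂 E M 1 →ₗ[𝕂] Form 𝕂 E M 1 →ₗ[𝕂] Form 𝕂 E M 1) (α β γ : Form 𝕂 E M 1) :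
    Form 𝕂 E M 1 :=
  D α (D β γ) - D β (D α γ) - D (π.koszul α β) γ

/-- The torsion `T(α, β) = D_α β - D_β α - [α, β]_π`. -/
def torsion (π : Bivector 𝕂 E M)
    (D : Form 𝕂 E M 1 →ₗ[𝕂] Form 𝕂 E M 1 →ₗ[𝕂] Form 𝕂 E M 1) (α β : Form 𝕂 E M 1) :
    Form 𝕂 E M 1 :=
  D α β - D β α - π.koszul α β

/-- `D₂` is the natural extension of the contravariant connection `D` to `2`-forms, i.e. the unique
contravariant connection on `2`-forms that is compatible with the wedge product. -/
structure IsTwoFormExtension (π : Bivector 𝕂 E M)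
    (D : Form 𝕂 E M 1 →ₗ[𝕂] Form 𝕂 E M 1 →ₗ[𝕂] Form 𝕂 E M 1)
    (D₂ : Form 𝕂 E M 1 →ₗ[𝕂] Form 𝕂 E M 2 →ₗ[𝕂] Form 𝕂 E M 2) : Prop where
  isConnection : IsContravariantConnection π D₂
  map_wedge : ∀ α β γ : Form 𝕂 E M 1,
    D₂ α (wedge 1 1 β γ) = wedge 1 1 (D α β) γ + wedge 1 1 β (D α γ)

/-- `B` is the bracket `{α, β}` of `1`-forms determined by `D`: with `{f, σ} = D_{df} σ` it
satisfies the product identity `{fα, β} = f{α, β} + α ∧ {f, β}` and the Leibniz identity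
`d{f, α} = {df, α} + {f, dα}`. By locality these identities determine `B`
uniquely, and they can always be satisfied. -/
structure IsOneFormBracket (D : Form 𝕂 E M 1 →ₗ[𝕂] Form 𝕂 E M 1 →ₗ[𝕂] Form 𝕂 E M 1)
    (D₂ : Form 𝕂 E M 1 →ₗ[𝕂] Form 𝕂 E M 2 →ₗ[𝕂] Form 𝕂 E M 2)
    (B : Form 𝕂 E M 1 →ₗ[𝕂] Form 𝕂 E M 1 →ₗ[𝕂] Form 𝕂 E M 2) : Prop where
  product : ∀ (f : SmoothFun 𝕂 E M) (α β : Form 𝕂 E M 1),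
    B (f • α) β = f • B α β + wedge 1 1 α (D (dFun f) β)
  leibniz : ∀ (f : SmoothFun 𝕂 E M) (α : Form 𝕂 E M 1),
    extD 1 (D (dFun f) α) = B (dFun f) α + D₂ (dFun f) (extD 1 α)

/-- The trilinear map `m` from `1`-forms to `2`-forms is the metacurvature of the flat,
torsion-free contravariant connection `D`: it is `C^∞(M)`-trilinear and
`m(df, β, γ) = {f, {β, γ}} - {{f, β}, γ} - {{f, γ}, β}`. -/
structure IsMetacurvature (π : Bivector 𝕂 E M)
    (D : Form 𝕂 E M 1 →ₗ[𝕂] Form 𝕂 E M 1 →ₗ[𝕂] Form 𝕂 E M 1)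
    (m : Form 𝕂 E M 1 →ₗ[𝕂] Form 𝕂 E M 1 →ₗ[𝕂] Form 𝕂 E M 1 →ₗ[𝕂] Form 𝕂 E M 2) : Prop where
  smul₁ : ∀ (f : SmoothFun 𝕂 E M) (α β γ : Form 𝕂 E M 1), m (f • α) β γ = f • m α β γ
  smul₂ : ∀ (f : SmoothFun 𝕂 E M) (α β γ : Form 𝕂 E M 1), m α (f • β) γ = f • m α β γ
  smul₃ : ∀ (f : SmoothFun 𝕂 E M) (α β γ : Form 𝕂 E M 1), m α β (f • γ) = f • m α β γ
  apply_dFun : ∀ D₂ B, IsTwoFormExtension π D D₂ → IsOneFormBracket D D₂ B →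
    ∀ (f : SmoothFun 𝕂 E M) (β γ : Form 𝕂 E M 1),
      m (dFun f) β γ = D₂ (dFun f) (B β γ) - B (D (dFun f) β) γ - B (D (dFun f) γ) β

variable (𝕂 E M) in
/-- A Poisson structure on `M` with a flat, torsion-free contravariant connection whose
metacurvature is zero. -/
structure FlatPoissonConnection where
  π : Bivector 𝕂 E M
  D : Form 𝕂 E M 1 →ₗ[𝕂] Form 𝕂 E M 1 →ₗ[𝕂] Form 𝕂 E M 1
  isPoisson : π.IsPoisson
  isConnection : IsContravariantConnection π D
  flat : ∀ α β γ, curvature π D α β γ = 0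
  torsionFree : ∀ α β, torsion π D α β = 0
  metacurvature_eq_zero : IsMetacurvature π D 0

end Connection

end Forms

section DG

open DirectSum

/-- A differential graded Poisson algebra over a field: a graded vector space `Ω` with a
differential `d`, a product `mul` and a bracket `br` on `⨁ k, Ω k`. -/
structure IsDGPoissonAlgebra {R : Type*} [Field R] {Ω : ℕ → Type*} [∀ k, AddCommGroup (Ω k)]
    [∀ k, Module R (Ω k)] (d : (⨁ k, Ω k) →ₗ[R] ⨁ k, Ω k)
    (mul br : (⨁ k, Ω k) →ₗ[R] (⨁ k, Ω k) →ₗ[R] ⨁ k, Ω k) : Prop where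
  d_degree : ∀ k (σ : Ω k), d (lof R ℕ Ω k σ) ∈ LinearMap.range (lof R ℕ Ω (k + 1))
  d_d : ∀ s, d (d s) = 0
  mul_degree : ∀ k l (σ : Ω k) (ρ : Ω l),
    mul (lof R ℕ Ω k σ) (lof R ℕ Ω l ρ) ∈ LinearMap.range (lof R ℕ Ω (k + l))
  mul_assoc : ∀ s r t, mul (mul s r) t = mul s (mul r t)
  mul_comm : ∀ k l (σ : Ω k) (ρ : Ω l), mul (lof R ℕ Ω k σ) (lof R ℕ Ω l ρ) =
    (-1 : R) ^ (k * l) • mul (lof R ℕ Ω l ρ) (lof R ℕ Ω k σ)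
  br_degree : ∀ k l (σ : Ω k) (ρ : Ω l),
    br (lof R ℕ Ω k σ) (lof R ℕ Ω l ρ) ∈ LinearMap.range (lof R ℕ Ω (k + l))
  br_antisymm : ∀ k l (σ : Ω k) (ρ : Ω l), br (lof R ℕ Ω k σ) (lof R ℕ Ω l ρ) =
    -((-1 : R) ^ (k * l) • br (lof R ℕ Ω l ρ) (lof R ℕ Ω k σ))
  br_jacobi : ∀ k l (σ : Ω k) (ρ : Ω l) (t : ⨁ k, Ω k),
    br (br (lof R ℕ Ω k σ) (lof R ℕ Ω l ρ)) t =
      br (lof R ℕ Ω k σ) (br (lof R ℕ Ω l ρ) t) -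
        (-1 : R) ^ (k * l) • br (lof R ℕ Ω l ρ) (br (lof R ℕ Ω k σ) t)
  d_mul : ∀ k (σ : Ω k) (r : ⨁ k, Ω k), d (mul (lof R ℕ Ω k σ) r) =
    mul (d (lof R ℕ Ω k σ)) r + (-1 : R) ^ k • mul (lof R ℕ Ω k σ) (d r)
  d_br : ∀ k (σ : Ω k) (r : ⨁ k, Ω k), d (br (lof R ℕ Ω k σ) r) =
    br (d (lof R ℕ Ω k σ)) r + (-1 : R) ^ k • br (lof R ℕ Ω k σ) (d r)
  br_mul : ∀ k l (σ : Ω k) (ρ : Ω l) (t : ⨁ k, Ω k),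
    br (lof R ℕ Ω k σ) (mul (lof R ℕ Ω l ρ) t) =
      mul (br (lof R ℕ Ω k σ) (lof R ℕ Ω l ρ)) t +
        (-1 : R) ^ (k * l) • mul (lof R ℕ Ω l ρ) (br (lof R ℕ Ω k σ) t)

variable (𝕂 : Type*) [RCLike 𝕂] (E : Type*) [NormedAddCommGroup E] [NormedSpace ℝ E]
  (M : Type*) [TopologicalSpace M] [ChartedSpace E M]

/-- The space `Ω^*(M) = ⨁ k, Ω^k(M)` of differential forms. -/
abbrev Forms := ⨁ k, Form 𝕂 E M k

variable {𝕂 E M}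

/-- A `k`-form, considered as an element of `Ω^*(M)`. -/
abbrev ofForm (k : ℕ) : Form 𝕂 E M k →ₗ[𝕂] Forms 𝕂 E M :=
  lof 𝕂 ℕ (fun k ↦ Form 𝕂 E M k) k

/-- The exterior derivative on `Ω^*(M)`. -/
def dForms [IsManifold 𝓘(ℝ, E) ∞ M] : Forms 𝕂 E M →ₗ[𝕂] Forms 𝕂 E M :=
  toModule 𝕂 ℕ _ fun k ↦ ofForm (k + 1) ∘ₗ extD k

/-- The wedge product on `Ω^*(M)`. -/
def wedgeForms [FiniteDimensional ℝ E] : Forms 𝕂 E M →ₗ[𝕂] Forms 𝕂 E M →ₗ[𝕂] Forms 𝕂 E M :=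
  toModule 𝕂 ℕ _ fun k ↦ LinearMap.flip <|
    toModule 𝕂 ℕ _ fun l ↦ ((wedge k l).compr₂ (ofForm (k + l))).flip

variable (𝕂 E M) in
/-- A generalized Poisson bracket: a bracket making `Ω^*(M)`, with the exterior derivative and
the wedge product, a differential graded Poisson algebra. -/
def GeneralizedPoissonBracket [FiniteDimensional ℝ E] [IsManifold 𝓘(ℝ, E) ∞ M] :=
  {br : Forms 𝕂 E M →ₗ[𝕂] Forms 𝕂 E M →ₗ[𝕂] Forms 𝕂 E M //
    IsDGPoissonAlgebra (R := 𝕂) (Ω := fun k ↦ Form 𝕂 E M k) dForms wedgeForms br}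

/-- A form is real if all its values on (real) tangent vectors are real. -/
def IsRealForm {k : ℕ} (σ : Form 𝕂 E M k) : Prop := ∀ x v, RCLike.im (σ.1 x v) = 0

/-- The bracket preserves real forms. -/
def GeneralizedPoissonBracket.IsReal [FiniteDimensional ℝ E] [IsManifold 𝓘(ℝ, E) ∞ M]
    (b : GeneralizedPoissonBracket 𝕂 E M) : Prop :=
  ∀ s t : Forms 𝕂 E M, (∀ k, IsRealForm (s k)) → (∀ k, IsRealForm (t k)) →
    ∀ k, IsRealForm (b.1 s t k)

/-- The bivector and the connection preserve real forms. -/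
def FlatPoissonConnection.IsReal [FiniteDimensional ℝ E] [IsManifold 𝓘(ℝ, E) ∞ M]
    (c : FlatPoissonConnection 𝕂 E M) : Prop :=
  ∀ α β : Form 𝕂 E M 1, IsRealForm α → IsRealForm β →
    IsRealForm (ofFun (c.π.pair α β)) ∧ IsRealForm (c.D α β)

end DG

end

end PoissonForms

open PoissonForms

set_option linter.unusedSectionVars false

/-! A graded derivation of `Ω^*(M)` is determined by its values on functions and on exact one-forms,
because every form of positive degree is locally a sum of products `dg_i ∧ u_i`
(`exists_local_decomposition`, `IsDer.eq_zero`). For a generalized Poisson bracket and a form `σ` of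
degree `k`, the map `{σ, ·}` is such a derivation. Antisymmetry gives `{σ, f} = -{f, σ}`, and
compatibility with `d` then gives `{σ, df} = -(-1)^k (d{f, σ} - {f, dσ})`. So the operators `{f, ·}`
determine the whole bracket, and they are themselves determined by `{f, g}` and `{f, dg}`, that is,
by `π` and `D`.

From a bracket to a connection: `f ↦ {f, β}` is a derivation on functions with values in forms, so
by Hadamard's lemma it factors through `df` (`exists_tensor_of_derivation`). This produces `π` and
`D`. The identity `d{f, g} = {df, g} + {f, dg}` says that the torsion vanishes on exact forms. The
Jacobi identity for `(f, g, h)`, `(f, g, γ)` and `(f, β, γ)` says that `π` is Poisson, that the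
curvature vanishes on exact forms, and that the metacurvature is zero. Torsion and curvature are
tensorial, so exact forms suffice.

From a connection to a bracket: `D_α` extends to a derivation of all forms, and the two formulas
above prescribe `{σ, ·}` on functions and exact one-forms. A derivation with these values exists
because the data depend tensorially on `df` (`exists_derivation`). Each axiom is then an equality of
derivations, to be tested on `f` and `df`. Vanishing torsion gives `{f, ·} = D_{df}` and hence
antisymmetry. The Jacobi identity is reduced one entry at a time: antisymmetry permutes the entries,
the derivation property replaces an entry by `f` or `df`, and applying `d` replaces a function in
the first entry by its differential. What remains is the Jacobi identity of `π`, flatness, and `M =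
0`.

That forms are a differential graded algebra is also part of the claim. Associativity and graded
commutativity of the wedge product follow by induction on the degree, since a form of positive
degree is determined by its contractions with vectors (`AltAlg.ext_ins`). The statement on real
forms holds because the local decompositions can be made with real data. -/

namespace PoissonForms

noncomputable section

/-! ### The wedge product as a signed sum over all permutations -/

section Shuffles

/-- A signed sum over permutations, sorted by the position of the first argument. -/
theorem sum_perm_cons {𝕂 : Type*} [RCLike 𝕂] {V : Type*} {n : ℕ} (T : (Fin (n + 1) → V) → 𝕂)
    (v : V) (u : Fin n → V) :
    ∑ s : Equiv.Perm (Fin (n + 1)), ((Equiv.Perm.sign s : ℤ) : 𝕂) *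
        T (fun i ↦ (Fin.cons v u : Fin (n + 1) → V) (s i)) =
      ∑ j : Fin (n + 1), ∑ t : Equiv.Perm (Fin n), ((-1) ^ (j : ℕ) : 𝕂) *
        (((Equiv.Perm.sign t : ℤ) : 𝕂) * T (Fin.insertNth j v (fun i ↦ u (t i)))) := by
  rw [← Fintype.sum_prod_type']
  -- The pair `(j, t)` gives the permutation that takes `j` to `0` and the remaining positions, in
  -- order, to the successors of the values of `t`. The cycle that brings `j` to the front has sign
  -- `(-1)^j`.
  let F : Fin (n + 1) × Equiv.Perm (Fin n) → Equiv.Perm (Fin (n + 1)) := fun q ↦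
    Equiv.Perm.decomposeFin.symm (0, q.2) * q.1.cycleRange
  have hF0 (q) : F q q.1 = 0 := by simp [F]
  have hFs (q) (i : Fin n) : F q (q.1.succAbove i) = (q.2 i).succ := by
    simp [F, Fin.cycleRange_succAbove]
  have hinj : Function.Injective F := by
    rintro ⟨j, e⟩ ⟨j', e'⟩ h
    have hj : j = j' := (F (j, e)).injective (by rw [hF0 (j, e), h, hF0 (j', e')])
    subst hj
    refine Prod.ext rfl (Equiv.ext fun i ↦ Fin.succ_injective _ ?_)
    rw [← hFs (j, e), h, hFs (j, e')]
  have hbij : Function.Bijective F := by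
    rw [Fintype.bijective_iff_injective_and_card]
    refine ⟨hinj, ?_⟩
    simp [Fintype.card_perm, Nat.factorial_succ]
  refine (Fintype.sum_equiv (Equiv.ofBijective F hbij) _ _ fun q ↦ ?_).symm
  rw [← mul_assoc, Equiv.ofBijective_apply]
  congr 1
  · simp [F, Fin.sign_cycleRange, Equiv.Perm.decomposeFin.symm_sign, mul_comm]
  · congr 1
    funext i
    refine Fin.succAboveCases q.1 ?_ (fun m ↦ ?_) i
    · rw [Fin.insertNth_apply_same, hF0, Fin.cons_zero]
    · rw [Fin.insertNth_apply_succAbove, hFs, Fin.cons_succ]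

variable {𝕂 : Type*} [RCLike 𝕂] {V : Type*} [AddCommGroup V] [Module ℝ V] [TopologicalSpace V]

/-- The wedge product, up to a factor, as a sum over all permutations. -/
theorem factorial_mul_altWedge {k l n : ℕ} (h : k + l = n) (a : V [⋀^Fin k]→L[ℝ] 𝕂)
    (b : V [⋀^Fin l]→L[ℝ] 𝕂) (v : Fin n → V) :
    ((k.factorial * l.factorial : ℕ) : 𝕂) * altWedge a b (fun i ↦ v (Fin.cast h i)) =
      ∑ s : Equiv.Perm (Fin n), ((Equiv.Perm.sign s : ℤ) : 𝕂) *
        (a (fun i ↦ v (s (Fin.cast h (Fin.castAdd l i)))) *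
          b (fun j ↦ v (s (Fin.cast h (Fin.natAdd k j))))) := by
  subst h
  -- Summing over all permutations counts every shuffle once for each of the `k! l!` permutations
  -- inside the two blocks; this is the source of the factor.
  have h := congrArg (fun m ↦ LinearMap.mul' ℝ 𝕂 (m (fun i ↦ v (finSumFinEquiv i))))
    (MultilinearMap.domCoprod_alternization_eq a.toAlternatingMap b.toAlternatingMap)
  simp only [Fintype.card_fin, AlternatingMap.smul_apply, map_nsmul,
    MultilinearMap.alternatization_apply, map_sum] at h
  rw [nsmul_eq_mul] at h
  refine h.symm.trans ?_
  refine Fintype.sum_equiv finSumFinEquiv.permCongr _ _ fun s ↦ ?_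
  have hs : LinearMap.mul' ℝ 𝕂 ((MultilinearMap.domDomCongr s
      (MultilinearMap.domCoprod a.toAlternatingMap.toMultilinearMap
        b.toAlternatingMap.toMultilinearMap)) (fun i ↦ v (finSumFinEquiv i))) =
      a (fun i ↦ v (finSumFinEquiv (s (Sum.inl i)))) *
        b (fun i ↦ v (finSumFinEquiv (s (Sum.inr i)))) := by
    simp
  have hg : (Equiv.Perm.sign (finSumFinEquiv.permCongr s) : ℤˣ) = Equiv.Perm.sign s :=
    Equiv.Perm.sign_permCongr _ _
  have hl (i : Fin k) : finSumFinEquiv.permCongr s (Fin.cast rfl (Fin.castAdd l i)) =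
      finSumFinEquiv (s (Sum.inl i)) := by
    simp [Equiv.permCongr_apply]
  have hr (i : Fin l) : finSumFinEquiv.permCongr s (Fin.cast rfl (Fin.natAdd k i)) =
      finSumFinEquiv (s (Sum.inr i)) := by
    simp [Equiv.permCongr_apply]
  simp only [hg, hl, hr, ← hs]
  rcases Int.units_eq_one_or (Equiv.Perm.sign s) with h | h <;> rw [h] <;> simp

/-- Four index identities for deleting one slot from a concatenation of two blocks: the block that
contains the slot loses it, and the other block stays whole. The slot lies in the left block in the
first two and in the right block in the last two. -/
theorem cast_castAdd_succAbove {k l n : ℕ} (h : k + 1 + l = n + 1) (i : Fin (k + 1)) (m : Fin k) :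
    Fin.cast h (Fin.castAdd l (i.succAbove m)) =
      (Fin.cast h (Fin.castAdd l i)).succAbove
        (Fin.cast (show k + l = n by omega) (Fin.castAdd l m)) := by
  ext
  simp only [Fin.val_cast, Fin.val_castAdd, Fin.succAbove, Fin.lt_def, Fin.val_castSucc]
  split_ifs <;> simp

theorem cast_natAdd_eq_succAbove {k l n : ℕ} (h : k + 1 + l = n + 1) (i : Fin (k + 1)) (m : Fin l) :
    Fin.cast h (Fin.natAdd (k + 1) m) =
      (Fin.cast h (Fin.castAdd l i)).succAbove
        (Fin.cast (show k + l = n by omega) (Fin.natAdd k m)) := by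
  have := i.isLt
  ext
  simp only [Fin.val_cast, Fin.val_castAdd, Fin.val_natAdd, Fin.succAbove, Fin.lt_def,
    Fin.val_castSucc]
  split_ifs <;> simp <;> omega

theorem cast_natAdd_succAbove {k l n : ℕ} (h : k + (l + 1) = n + 1) (i : Fin (l + 1)) (m : Fin l) :
    Fin.cast h (Fin.natAdd k (i.succAbove m)) =
      (Fin.cast h (Fin.natAdd k i)).succAbove
        (Fin.cast (show k + l = n by omega) (Fin.natAdd k m)) := by
  ext
  simp only [Fin.val_cast, Fin.val_natAdd, Fin.succAbove, Fin.lt_def, Fin.val_castSucc]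
  split_ifs <;> simp <;> omega

theorem cast_castAdd_eq_succAbove {k l n : ℕ} (h : k + (l + 1) = n + 1) (i : Fin (l + 1))
    (m : Fin k) :
    Fin.cast h (Fin.castAdd (l + 1) m) =
      (Fin.cast h (Fin.natAdd k i)).succAbove
        (Fin.cast (show k + l = n by omega) (Fin.castAdd l m)) := by
  have := m.isLt
  ext
  simp only [Fin.val_cast, Fin.val_castAdd, Fin.val_natAdd, Fin.succAbove, Fin.lt_def,
    Fin.val_castSucc]
  split_ifs <;> simp <;> omega

end Shuffles

/-! ### Contraction with a vector and the wedge product -/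

section Contraction

variable {𝕂 : Type*} [RCLike 𝕂] {E : Type*} [NormedAddCommGroup E] [NormedSpace ℝ E]

theorem curryLeft_apply_eq {n : ℕ} (a : E [⋀^Fin (n + 1)]→L[ℝ] 𝕂) (v : E) (u : Fin n → E) :
    a.curryLeft v u = a (Fin.cons v u) := rfl

theorem map_insertNth_eq {n : ℕ} (a : E [⋀^Fin (n + 1)]→L[ℝ] 𝕂) (p : Fin (n + 1)) (v : E)
    (u : Fin n → E) : a (Fin.insertNth p v u) = (-1) ^ (p : ℕ) * a.curryLeft v u := by
  have h := a.toAlternatingMap.map_insertNth p v u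
  refine h.trans ?_
  have : ((-1 : ℤ) ^ (p : ℕ)) • a.curryLeft v u = (-1) ^ (p : ℕ) * a.curryLeft v u := by
    rw [zsmul_eq_mul]; simp
  exact this

/-- The part of the signed sum where the first argument goes to the left factor. -/
theorem sum_left_block {k l n : ℕ} (h : k + 1 + l = n + 1) (a : E [⋀^Fin (k + 1)]→L[ℝ] 𝕂)
    (b : E [⋀^Fin l]→L[ℝ] 𝕂) (v : E) (u : Fin n → E) (i : Fin (k + 1)) :
    ∑ t : Equiv.Perm (Fin n), ((-1) ^ (Fin.cast h (Fin.castAdd l i) : ℕ) : 𝕂) *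
        (((Equiv.Perm.sign t : ℤ) : 𝕂) *
          (a (fun r ↦ (Fin.insertNth (Fin.cast h (Fin.castAdd l i)) v (fun i ↦ u (t i)) :
            Fin (n + 1) → E) (Fin.cast h (Fin.castAdd l r))) *
          b (fun r ↦ (Fin.insertNth (Fin.cast h (Fin.castAdd l i)) v (fun i ↦ u (t i)) :
            Fin (n + 1) → E) (Fin.cast h (Fin.natAdd (k + 1) r))))) =
      ((k.factorial * l.factorial : ℕ) : 𝕂) * altWedge (a.curryLeft v) b
        (fun i ↦ u (Fin.cast (show k + l = n by omega) i)) := by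
  rw [factorial_mul_altWedge]
  refine Finset.sum_congr rfl fun t _ ↦ ?_
  have h1 : (fun r ↦ (Fin.insertNth (Fin.cast h (Fin.castAdd l i)) v (fun i ↦ u (t i)) :
      Fin (n + 1) → E) (Fin.cast h (Fin.castAdd l r))) =
      Fin.insertNth i v (fun m ↦ u (t (Fin.cast (show k + l = n by omega) (Fin.castAdd l m)))) := by
    funext r
    refine Fin.succAboveCases i ?_ (fun m ↦ ?_) r
    · rw [Fin.insertNth_apply_same, Fin.insertNth_apply_same]
    · rw [cast_castAdd_succAbove, Fin.insertNth_apply_succAbove, Fin.insertNth_apply_succAbove]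
  have h2 : (fun r ↦ (Fin.insertNth (Fin.cast h (Fin.castAdd l i)) v (fun i ↦ u (t i)) :
      Fin (n + 1) → E) (Fin.cast h (Fin.natAdd (k + 1) r))) =
      fun m ↦ u (t (Fin.cast (show k + l = n by omega) (Fin.natAdd k m))) := by
    funext r
    rw [cast_natAdd_eq_succAbove h i, Fin.insertNth_apply_succAbove]
  rw [h1, h2, map_insertNth_eq]
  -- The sign of the position of `v` cancels the sign of moving `v` to the front of `a`.
  have h3 : ((-1 : 𝕂) ^ (i : ℕ)) * (-1) ^ (i : ℕ) = 1 := by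
    rw [← mul_pow]; simp
  simp only [Fin.val_cast, Fin.val_castAdd]
  linear_combination (((Equiv.Perm.sign t : ℤ) : 𝕂) * (a.curryLeft v _ * b _)) * h3

/-- The part of the signed sum where the first argument goes to the right factor. -/
theorem sum_right_block {k l n : ℕ} (h : k + (l + 1) = n + 1) (a : E [⋀^Fin k]→L[ℝ] 𝕂)
    (b : E [⋀^Fin (l + 1)]→L[ℝ] 𝕂) (v : E) (u : Fin n → E) (i : Fin (l + 1)) :
    ∑ t : Equiv.Perm (Fin n), ((-1) ^ (Fin.cast h (Fin.natAdd k i) : ℕ) : 𝕂) *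
        (((Equiv.Perm.sign t : ℤ) : 𝕂) *
          (a (fun r ↦ (Fin.insertNth (Fin.cast h (Fin.natAdd k i)) v (fun i ↦ u (t i)) :
            Fin (n + 1) → E) (Fin.cast h (Fin.castAdd (l + 1) r))) *
          b (fun r ↦ (Fin.insertNth (Fin.cast h (Fin.natAdd k i)) v (fun i ↦ u (t i)) :
            Fin (n + 1) → E) (Fin.cast h (Fin.natAdd k r))))) =
      (-1) ^ k * (((k.factorial * l.factorial : ℕ) : 𝕂) * altWedge a (b.curryLeft v)
        (fun i ↦ u (Fin.cast (show k + l = n by omega) i))) := by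
  rw [factorial_mul_altWedge, Finset.mul_sum]
  refine Finset.sum_congr rfl fun t _ ↦ ?_
  have h1 : (fun r ↦ (Fin.insertNth (Fin.cast h (Fin.natAdd k i)) v (fun i ↦ u (t i)) :
      Fin (n + 1) → E) (Fin.cast h (Fin.natAdd k r))) =
      Fin.insertNth i v (fun m ↦ u (t (Fin.cast (show k + l = n by omega) (Fin.natAdd k m)))) := by
    funext r
    refine Fin.succAboveCases i ?_ (fun m ↦ ?_) r
    · rw [Fin.insertNth_apply_same, Fin.insertNth_apply_same]
    · rw [cast_natAdd_succAbove, Fin.insertNth_apply_succAbove, Fin.insertNth_apply_succAbove]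
  have h2 : (fun r ↦ (Fin.insertNth (Fin.cast h (Fin.natAdd k i)) v (fun i ↦ u (t i)) :
      Fin (n + 1) → E) (Fin.cast h (Fin.castAdd (l + 1) r))) =
      fun m ↦ u (t (Fin.cast (show k + l = n by omega) (Fin.castAdd l m))) := by
    funext r
    rw [cast_castAdd_eq_succAbove h i, Fin.insertNth_apply_succAbove]
  rw [h1, h2, map_insertNth_eq]
  -- Here `v` sits at position `k + i`, while moving it to the front of `b` costs only `(-1)^i`, so
  -- `(-1)^k` survives.
  have h3 : ((-1 : 𝕂) ^ (i : ℕ)) * (-1) ^ (i : ℕ) = 1 := by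
    rw [← mul_pow]; simp
  simp only [Fin.val_cast, Fin.val_natAdd, pow_add]
  linear_combination ((-1) ^ k * ((Equiv.Perm.sign t : ℤ) : 𝕂) * (a _ * b.curryLeft v _)) * h3

theorem factorial_cast_ne_zero (k l : ℕ) : ((k.factorial * l.factorial : ℕ) : 𝕂) ≠ 0 :=
  Nat.cast_ne_zero.2 (Nat.mul_ne_zero k.factorial_ne_zero l.factorial_ne_zero)

theorem sum_fin_cast_add {k l n : ℕ} (h : k + l = n) (f : Fin n → 𝕂) :
    ∑ j, f j = ∑ i : Fin k, f (Fin.cast h (Fin.castAdd l i)) +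
      ∑ i : Fin l, f (Fin.cast h (Fin.natAdd k i)) := by
  subst h
  exact Fin.sum_univ_add f

/-- Contraction with a vector is an antiderivation of the wedge product. -/
theorem altWedge_cons {k l n : ℕ} (h : k + 1 + (l + 1) = n + 1) (a : E [⋀^Fin (k + 1)]→L[ℝ] 𝕂)
    (b : E [⋀^Fin (l + 1)]→L[ℝ] 𝕂) (v : E) (u : Fin n → E) :
    altWedge a b (fun i ↦ (Fin.cons v u : Fin (n + 1) → E) (Fin.cast h i)) =
      altWedge (a.curryLeft v) b (fun i ↦ u (Fin.cast (by omega) i)) +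
        (-1) ^ (k + 1) * altWedge a (b.curryLeft v) (fun i ↦ u (Fin.cast (by omega) i)) := by
  apply mul_left_cancel₀ (factorial_cast_ne_zero (𝕂 := 𝕂) (k + 1) (l + 1))
  rw [factorial_mul_altWedge h a b (Fin.cons v u), sum_perm_cons (fun w ↦
    a (fun i ↦ w (Fin.cast h (Fin.castAdd (l + 1) i))) *
      b (fun j ↦ w (Fin.cast h (Fin.natAdd (k + 1) j)))), sum_fin_cast_add h]
  -- All slots of a block contribute equally, and their number turns `k! (l+1)!` or `(k+1)! l!` into
  -- the common factor `(k+1)! (l+1)!`.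
  simp only [sum_left_block h, sum_right_block h, Finset.sum_const, Finset.card_univ,
    Fintype.card_fin, nsmul_eq_mul, Nat.factorial_succ]
  push_cast
  ring

/-- A factor of degree zero has no contraction, so its block of slots is empty and the corresponding
half of the antiderivation rule disappears. -/
theorem altWedge_cons_of_right_zero {k n : ℕ} (h : k + 1 + 0 = n + 1)
    (a : E [⋀^Fin (k + 1)]→L[ℝ] 𝕂) (b : E [⋀^Fin 0]→L[ℝ] 𝕂) (v : E) (u : Fin n → E) :
    altWedge a b (fun i ↦ (Fin.cons v u : Fin (n + 1) → E) (Fin.cast h i)) =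
      altWedge (a.curryLeft v) b (fun i ↦ u (Fin.cast (by omega) i)) := by
  apply mul_left_cancel₀ (factorial_cast_ne_zero (𝕂 := 𝕂) (k + 1) 0)
  rw [factorial_mul_altWedge h a b (Fin.cons v u), sum_perm_cons (fun w ↦
    a (fun i ↦ w (Fin.cast h (Fin.castAdd 0 i))) *
      b (fun j ↦ w (Fin.cast h (Fin.natAdd (k + 1) j)))), sum_fin_cast_add h]
  simp only [sum_left_block h, Finset.sum_const, Finset.card_univ, Finset.univ_eq_empty,
    Finset.sum_empty, Fintype.card_fin, nsmul_eq_mul, Nat.factorial_succ]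
  push_cast
  ring

theorem altWedge_cons_of_left_zero {l n : ℕ} (h : 0 + (l + 1) = n + 1) (a : E [⋀^Fin 0]→L[ℝ] 𝕂)
    (b : E [⋀^Fin (l + 1)]→L[ℝ] 𝕂) (v : E) (u : Fin n → E) :
    altWedge a b (fun i ↦ (Fin.cons v u : Fin (n + 1) → E) (Fin.cast h i)) =
      altWedge a (b.curryLeft v) (fun i ↦ u (Fin.cast (by omega) i)) := by
  apply mul_left_cancel₀ (factorial_cast_ne_zero (𝕂 := 𝕂) 0 (l + 1))
  rw [factorial_mul_altWedge h a b (Fin.cons v u), sum_perm_cons (fun w ↦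
    a (fun i ↦ w (Fin.cast h (Fin.castAdd (l + 1) i))) *
      b (fun j ↦ w (Fin.cast h (Fin.natAdd 0 j)))), sum_fin_cast_add h]
  simp only [sum_right_block h, Finset.sum_const, Finset.card_univ, Finset.univ_eq_empty,
    Finset.sum_empty, Fintype.card_fin, nsmul_eq_mul, Nat.factorial_succ]
  push_cast
  ring

theorem altWedge_zero_zero (a b : E [⋀^Fin 0]→L[ℝ] 𝕂) (v : Fin (0 + 0) → E) :
    altWedge a b v = a ![] * b ![] := by
  have h := factorial_mul_altWedge (rfl : 0 + 0 = 0 + 0) a b v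
  simp only [Nat.factorial_zero, mul_one, Nat.cast_one, one_mul] at h
  refine h.trans ?_
  have hu : Subsingleton (Equiv.Perm (Fin (0 + 0))) :=
    (Equiv.permUnique (α := Fin 0)).instSubsingleton
  rw [Fintype.sum_eq_single 1 fun s hs ↦ (hs (Subsingleton.elim _ _)).elim, map_one]
  simp only [Units.val_one, Int.cast_one, one_mul]
  congr 2 <;> exact Subsingleton.elim _ _

end Contraction

end

end PoissonForms

namespace PoissonForms

noncomputable section

/-! ### The graded algebra of alternating forms on a vector space -/

section ExteriorAlgebra

open DirectSum

variable (𝕂 : Type*) [RCLike 𝕂] (E : Type*) [NormedAddCommGroup E] [NormedSpace ℝ E]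

/-- The algebra of all `𝕂`-valued alternating forms on `E`. -/
abbrev AltAlg := ⨁ k : ℕ, E [⋀^Fin k]→L[ℝ] 𝕂

variable {𝕂 E}

/-- An alternating form, considered as an element of the algebra of forms. -/
abbrev altOf (k : ℕ) : (E [⋀^Fin k]→L[ℝ] 𝕂) →ₗ[𝕂] AltAlg 𝕂 E :=
  lof 𝕂 ℕ (fun k ↦ E [⋀^Fin k]→L[ℝ] 𝕂) k

/-- Degrees such as `k + (l + 1)` and `k + 1 + l` are not equal by definition. Inside the direct
sum, forms of such degrees can still be compared, with the arguments relabelled by `Fin.cast`. -/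
theorem altOf_congr {k l : ℕ} (h : k = l) {a : E [⋀^Fin k]→L[ℝ] 𝕂} {b : E [⋀^Fin l]→L[ℝ] 𝕂}
    (H : ∀ u : Fin l → E, a (fun i ↦ u (Fin.cast h i)) = b u) : altOf k a = altOf l b := by
  subst h
  exact congrArg _ (ContinuousAlternatingMap.ext H)

theorem exists_alt_cast {k l : ℕ} (h : k = l) (a : E [⋀^Fin k]→L[ℝ] 𝕂) :
    ∃ b : E [⋀^Fin l]→L[ℝ] 𝕂, ∀ u : Fin l → E, a (fun i ↦ u (Fin.cast h i)) = b u := by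
  subst h
  exact ⟨a, fun u ↦ rfl⟩

/-- The wedge product as a bilinear map. -/
def altWedgeₗ (k l : ℕ) :
    (E [⋀^Fin k]→L[ℝ] 𝕂) →ₗ[𝕂] (E [⋀^Fin l]→L[ℝ] 𝕂) →ₗ[𝕂] (E [⋀^Fin (k + l)]→L[ℝ] 𝕂) :=
  LinearMap.mk₂ 𝕂 altWedge altWedge_add_left altWedge_smul_left altWedge_add_right
    altWedge_smul_right

/-- The product of the algebra of alternating forms. -/
def altMul : AltAlg 𝕂 E →ₗ[𝕂] AltAlg 𝕂 E →ₗ[𝕂] AltAlg 𝕂 E :=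
  toModule 𝕂 ℕ _ fun k ↦ LinearMap.flip <|
    toModule 𝕂 ℕ _ fun l ↦ ((altWedgeₗ k l).compr₂ (altOf (k + l))).flip

theorem altMul_of {k l : ℕ} (a : E [⋀^Fin k]→L[ℝ] 𝕂) (b : E [⋀^Fin l]→L[ℝ] 𝕂) :
    altMul (altOf k a) (altOf l b) = altOf (k + l) (altWedge a b) := by
  simp [altMul, altWedgeₗ]

theorem AltAlg.linearMap_ext {N : Type*} [AddCommMonoid N] [Module 𝕂 N] {f g : AltAlg 𝕂 E →ₗ[𝕂] N}
    (h : ∀ k a, f (altOf k a) = g (altOf k a)) : f = g :=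
  DirectSum.linearMap_ext _ fun k ↦ LinearMap.ext (h k)

/-- Contraction of a homogeneous form with a vector. -/
def insHom (v : E) : ∀ k : ℕ, (E [⋀^Fin k]→L[ℝ] 𝕂) →ₗ[𝕂] AltAlg 𝕂 E
  | 0 => 0
  | k + 1 => altOf k ∘ₗ
    { toFun := fun a ↦ a.curryLeft v
      map_add' := fun _ _ ↦ rfl
      map_smul' := fun _ _ ↦ rfl }

/-- Contraction with a vector. -/
def ins (v : E) : AltAlg 𝕂 E →ₗ[𝕂] AltAlg 𝕂 E := toModule 𝕂 ℕ _ (insHom v)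

@[simp]
theorem ins_zero (v : E) (a : E [⋀^Fin 0]→L[ℝ] 𝕂) : ins v (altOf 0 a) = 0 := by
  simp [ins, insHom]

@[simp]
theorem ins_succ (v : E) {k : ℕ} (a : E [⋀^Fin (k + 1)]→L[ℝ] 𝕂) :
    ins v (altOf (k + 1) a) = altOf k (a.curryLeft v) := by
  simp only [ins, toModule_lof]
  rfl

theorem ins_eq_of (v : E) {N n : ℕ} (h : N = n + 1) {a : E [⋀^Fin N]→L[ℝ] 𝕂}
    {b : E [⋀^Fin n]→L[ℝ] 𝕂}
    (H : ∀ u : Fin n → E, a (fun i ↦ (Fin.cons v u : Fin (n + 1) → E) (Fin.cast h i)) = b u) :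
    ins v (altOf N a) = altOf n b := by
  subst h
  rw [ins_succ]
  exact congrArg _ (ContinuousAlternatingMap.ext H)

/-- The parity involution of the algebra of forms. -/
def altSign : AltAlg 𝕂 E →ₗ[𝕂] AltAlg 𝕂 E := toModule 𝕂 ℕ _ fun k ↦ (-1 : 𝕂) ^ k • altOf k

@[simp]
theorem altSign_of {k : ℕ} (a : E [⋀^Fin k]→L[ℝ] 𝕂) :
    altSign (altOf k a) = (-1 : 𝕂) ^ k • altOf k a := by
  simp [altSign]

theorem ins_altMul_of (v : E) {k l : ℕ} (a : E [⋀^Fin k]→L[ℝ] 𝕂) (b : E [⋀^Fin l]→L[ℝ] 𝕂) :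
    ins v (altMul (altOf k a) (altOf l b)) = altMul (ins v (altOf k a)) (altOf l b) +
      (-1 : 𝕂) ^ k • altMul (altOf k a) (ins v (altOf l b)) := by
  rcases k with _ | k <;> rcases l with _ | l
  · simp only [altMul_of, ins_zero, map_zero, LinearMap.zero_apply, smul_zero, add_zero]
    exact ins_zero v _
  · simp only [altMul_of, ins_zero, map_zero, LinearMap.zero_apply, zero_add, pow_zero, one_smul,
      ins_succ]
    refine ins_eq_of v (n := 0 + l) rfl fun u ↦ ?_
    exact (altWedge_cons_of_left_zero (l := l) (n := 0 + l) rfl a b v u).trans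
      (congrArg _ (funext fun i ↦ rfl))
  · rw [altMul_of, ins_zero, map_zero, smul_zero, ins_succ v a, altMul_of]
    refine Eq.trans ?_ (add_zero _).symm
    refine ins_eq_of v (N := k + 1 + 0) (n := k + 0) rfl fun u ↦ ?_
    exact (altWedge_cons_of_right_zero (k := k) (n := k + 0) rfl a b v u).trans
      (congrArg _ (funext fun i ↦ rfl))
  · rw [altMul_of, ins_succ v a, ins_succ v b, altMul_of, altMul_of]
    have h : k + (l + 1) = k + 1 + l := by omega
    obtain ⟨c, hc⟩ := exists_alt_cast h (altWedge (a.curryLeft v) b)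
    have h1 : altOf (k + (l + 1)) (altWedge (a.curryLeft v) b) = altOf (k + 1 + l) c :=
      altOf_congr h hc
    rw [h1, ← map_smul, ← map_add]
    refine ins_eq_of v (N := k + 1 + (l + 1)) (n := k + 1 + l) rfl fun u ↦ ?_
    refine (altWedge_cons (k := k) (l := l) (n := k + 1 + l) rfl a b v u).trans ?_
    rw [ContinuousAlternatingMap.add_apply, ContinuousAlternatingMap.smul_apply, smul_eq_mul, ← hc]
    rfl

theorem ins_altMul (v : E) (s t : AltAlg 𝕂 E) :
    ins v (altMul s t) = altMul (ins v s) t + altMul (altSign s) (ins v t) := by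
  have h : (altMul (𝕂 := 𝕂) (E := E)).compr₂ (ins v) =
      altMul ∘ₗ ins v + (altMul ∘ₗ altSign).compl₂ (ins v) := by
    refine AltAlg.linearMap_ext fun k a ↦ AltAlg.linearMap_ext fun l b ↦ ?_
    simpa using ins_altMul_of v a b
  exact LinearMap.congr_fun₂ h s t

/-- Feeding the first argument recovers a form of positive degree from its contractions; only the
component of degree zero is invisible to them. This makes induction on the degree available for
algebraic identities. -/
theorem AltAlg.ext_ins {x y : AltAlg 𝕂 E} (h0 : x 0 = y 0) (h : ∀ v, ins v x = ins v y) :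
    x = y := by
  have key (x : AltAlg 𝕂 E) (k : ℕ) (v : E) : ins v x k = (x (k + 1)).curryLeft v := by
    induction x using DirectSum.induction_on with
    | zero => simp
    | of i a =>
      change ins v (altOf i a) k = (altOf i a (k + 1)).curryLeft v
      rcases i with _ | i
      · rw [ins_zero]
        erw [DirectSum.of_eq_of_ne 0 (k + 1) _ (by omega)]
        rfl
      · rw [ins_succ]
        by_cases hi : i = k
        · subst hi
          erw [DirectSum.of_eq_same, DirectSum.of_eq_same]
        · erw [DirectSum.of_eq_of_ne i k _ (by omega),
            DirectSum.of_eq_of_ne (i + 1) (k + 1) _ (by omega)]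
          rfl
    | add x y hx hy =>
      rw [map_add, DirectSum.add_apply, DirectSum.add_apply, hx, hy]
      rfl
  refine DFinsupp.ext fun k ↦ ?_
  rcases k with _ | k
  · exact h0
  · ext u
    have h1 := congrArg (fun z : AltAlg 𝕂 E ↦ z k (Fin.tail u)) (h (u 0))
    simp only [key] at h1
    have h2 (c : E [⋀^Fin (k + 1)]→L[ℝ] 𝕂) : c.curryLeft (u 0) (Fin.tail u) = c u := by
      rw [curryLeft_apply_eq, Fin.cons_self_tail]
    rwa [h2, h2] at h1

theorem altOf_apply_zero {k : ℕ} (a : E [⋀^Fin (k + 1)]→L[ℝ] 𝕂) : altOf (k + 1) a 0 = 0 :=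
  DirectSum.of_eq_of_ne (k + 1) 0 _ (by omega)

theorem altOf_apply_zero' {k : ℕ} (hk : k ≠ 0) (a : E [⋀^Fin k]→L[ℝ] 𝕂) : altOf k a 0 = 0 :=
  DirectSum.of_eq_of_ne k 0 _ hk.symm

theorem altMul_zero_left (a : E [⋀^Fin 0]→L[ℝ] 𝕂) {l : ℕ} (b : E [⋀^Fin l]→L[ℝ] 𝕂) :
    altMul (altOf 0 a) (altOf l b) = a ![] • altOf l b := by
  induction l with
  | zero =>
    rw [altMul_of, ← map_smul]
    refine altOf_congr rfl fun u ↦ ?_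
    rw [altWedge_zero_zero]
    change _ = a ![] * b u
    rw [Subsingleton.elim (α := Fin 0 → E) u ![]]
  | succ l ih =>
    refine AltAlg.ext_ins ?_ fun v ↦ ?_
    · rw [altMul_of, DirectSum.smul_apply, altOf_apply_zero, altOf_apply_zero' (by omega), smul_zero]
    · rw [ins_altMul, ins_zero, map_zero, LinearMap.zero_apply, zero_add, altSign_of, pow_zero,
        one_smul, ins_succ, ih, map_smul, ins_succ]

/-- Induction on the total degree. Contraction is an antiderivation, so contracting either side
gives the same three terms with one degree lowered, and these agree by the induction hypothesis.
Total degree zero is multiplication of scalars. -/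
theorem altMul_assoc_of {n : ℕ} : ∀ {k l m : ℕ}, k + l + m = n → ∀ (a : E [⋀^Fin k]→L[ℝ] 𝕂)
    (b : E [⋀^Fin l]→L[ℝ] 𝕂) (c : E [⋀^Fin m]→L[ℝ] 𝕂),
    altMul (altMul (altOf k a) (altOf l b)) (altOf m c) =
      altMul (altOf k a) (altMul (altOf l b) (altOf m c)) := by
  induction n with
  | zero =>
    intro k l m h a b c
    obtain rfl : k = 0 := by omega
    obtain rfl : l = 0 := by omega
    simp only [altMul_zero_left, map_smul, LinearMap.smul_apply, smul_comm (a ![])]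
  | succ n ih =>
    intro k l m h a b c
    refine AltAlg.ext_ins ?_ fun v ↦ ?_
    · simp only [altMul_of]
      rw [altOf_apply_zero' (by omega), altOf_apply_zero' (by omega)]
    · have h1 : altMul (altMul (ins v (altOf k a)) (altOf l b)) (altOf m c) =
          altMul (ins v (altOf k a)) (altMul (altOf l b) (altOf m c)) := by
        rcases k with _ | k
        · simp
        · rw [ins_succ]; exact ih (by omega) _ _ _
      have h2 : altMul (altMul (altOf k a) (ins v (altOf l b))) (altOf m c) =
          altMul (altOf k a) (altMul (ins v (altOf l b)) (altOf m c)) := by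
        rcases l with _ | l
        · simp
        · rw [ins_succ]; exact ih (by omega) _ _ _
      have h3 : altMul (altMul (altOf k a) (altOf l b)) (ins v (altOf m c)) =
          altMul (altOf k a) (altMul (altOf l b) (ins v (altOf m c))) := by
        rcases m with _ | m
        · simp
        · rw [ins_succ]; exact ih (by omega) _ _ _
      have h4 : altSign (altMul (altOf k a) (altOf l b)) =
          (-1 : 𝕂) ^ (k + l) • altMul (altOf k a) (altOf l b) := by
        rw [altMul_of, altSign_of]
      simp only [ins_altMul, altSign_of, h4, map_add, map_smul, LinearMap.add_apply,
        LinearMap.smul_apply, h1, h2, h3, smul_smul, pow_add, add_assoc, mul_comm]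

theorem altMul_assoc (s t r : AltAlg 𝕂 E) :
    altMul (altMul s t) r = altMul s (altMul t r) := by
  have h : (altMul (𝕂 := 𝕂) (E := E)).compr₂ altMul =
      (LinearMap.llcomp 𝕂 (AltAlg 𝕂 E) (AltAlg 𝕂 E) (AltAlg 𝕂 E)).compl₁₂ altMul altMul := by
    refine AltAlg.linearMap_ext fun k a ↦ AltAlg.linearMap_ext fun l b ↦
      AltAlg.linearMap_ext fun m c ↦ ?_
    exact altMul_assoc_of rfl a b c
  exact congrArg (fun f : AltAlg 𝕂 E →ₗ[𝕂] AltAlg 𝕂 E →ₗ[𝕂] AltAlg 𝕂 E →ₗ[𝕂] AltAlg 𝕂 E ↦ f s t r) h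

theorem altMul_zero_right (a : E [⋀^Fin 0]→L[ℝ] 𝕂) {l : ℕ} (b : E [⋀^Fin l]→L[ℝ] 𝕂) :
    altMul (altOf l b) (altOf 0 a) = a ![] • altOf l b := by
  induction l with
  | zero =>
    rw [altMul_of, ← map_smul]
    refine altOf_congr rfl fun u ↦ ?_
    rw [altWedge_zero_zero]
    change _ = a ![] * b u
    rw [Subsingleton.elim (α := Fin 0 → E) u ![], mul_comm]
  | succ l ih =>
    refine AltAlg.ext_ins ?_ fun v ↦ ?_
    · rw [altMul_of, DirectSum.smul_apply, altOf_apply_zero, altOf_apply_zero' (by omega), smul_zero]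
    · rw [ins_altMul, ins_zero, map_zero, add_zero, map_smul, ins_succ, ih]

/-- The same induction. Lowering `k` by one changes `(-1)^(k l)` by `(-1)^l`, which is exactly the
sign the antiderivation rule produces when the contraction passes the form of degree `l`. -/
theorem altMul_comm_of {n : ℕ} : ∀ {k l : ℕ}, k + l = n → ∀ (a : E [⋀^Fin k]→L[ℝ] 𝕂)
    (b : E [⋀^Fin l]→L[ℝ] 𝕂), altMul (altOf k a) (altOf l b) =
      (-1 : 𝕂) ^ (k * l) • altMul (altOf l b) (altOf k a) := by
  induction n with
  | zero =>
    intro k l h a b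
    obtain rfl : k = 0 := by omega
    rw [altMul_zero_left, altMul_zero_right, zero_mul, pow_zero, one_smul]
  | succ n ih =>
    intro k l h a b
    refine AltAlg.ext_ins ?_ fun v ↦ ?_
    · simp only [altMul_of, DirectSum.smul_apply]
      rw [altOf_apply_zero' (by omega), altOf_apply_zero' (by omega), smul_zero]
    · have h1 : altMul (ins v (altOf k a)) (altOf l b) =
          (-1 : 𝕂) ^ (k * l + l) • altMul (altOf l b) (ins v (altOf k a)) := by
        rcases k with _ | k
        · simp
        · rw [ins_succ, ih (by omega)]
          congr 1
          rw [show (k + 1) * l + l = k * l + 2 * l by ring, pow_add, pow_mul (-1) 2 l]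
          simp
      have h2 : (-1 : 𝕂) ^ k • altMul (altOf k a) (ins v (altOf l b)) =
          (-1 : 𝕂) ^ (k * l) • altMul (ins v (altOf l b)) (altOf k a) := by
        rcases l with _ | l
        · simp
        · rw [ins_succ, ih (by omega), smul_smul, ← pow_add]
          congr 2
          ring
      simp only [ins_altMul, altSign_of, map_smul, LinearMap.smul_apply, h1, h2, smul_add,
        smul_smul, pow_add]
      rw [add_comm]

instance instRingAltAlg : Ring (AltAlg 𝕂 E) :=
  { (inferInstance : AddCommGroup (AltAlg 𝕂 E)) with
    mul := fun s t ↦ altMul s t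
    one := altOf 0 (ContinuousAlternatingMap.constOfIsEmpty ℝ E (Fin 0) 1)
    left_distrib := fun s t r ↦ map_add (altMul s) t r
    right_distrib := fun s t r ↦ LinearMap.map_add₂ altMul s t r
    zero_mul := fun s ↦ LinearMap.map_zero₂ altMul s
    mul_zero := fun s ↦ map_zero (altMul s)
    mul_assoc := altMul_assoc
    one_mul := fun s ↦ by
      refine LinearMap.congr_fun (f := altMul _) (g := LinearMap.id)
        (AltAlg.linearMap_ext fun k a ↦ ?_) s
      exact (altMul_zero_left _ a).trans (one_smul _ _)
    mul_one := fun s ↦ by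
      refine LinearMap.congr_fun (f := altMul.flip _) (g := LinearMap.id)
        (AltAlg.linearMap_ext fun k a ↦ ?_) s
      exact (altMul_zero_right _ a).trans (one_smul _ _) }

instance : IsScalarTower 𝕂 (AltAlg 𝕂 E) (AltAlg 𝕂 E) :=
  ⟨fun c s t ↦ LinearMap.map_smul₂ altMul c s t⟩

instance : SMulCommClass 𝕂 (AltAlg 𝕂 E) (AltAlg 𝕂 E) :=
  ⟨fun c s t ↦ (map_smul (altMul s) c t).symm⟩

theorem AltAlg.mul_of {k l : ℕ} (a : E [⋀^Fin k]→L[ℝ] 𝕂) (b : E [⋀^Fin l]→L[ℝ] 𝕂) :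
    altOf k a * altOf l b = altOf (k + l) (altWedge a b) := altMul_of a b

theorem AltAlg.zero_mul_of (a : E [⋀^Fin 0]→L[ℝ] 𝕂) (s : AltAlg 𝕂 E) :
    altOf 0 a * s = a ![] • s := by
  refine LinearMap.congr_fun (f := altMul _) (g := a ![] • LinearMap.id)
    (AltAlg.linearMap_ext fun k b ↦ ?_) s
  exact altMul_zero_left a b

theorem AltAlg.mul_comm_of {k l : ℕ} (a : E [⋀^Fin k]→L[ℝ] 𝕂) (b : E [⋀^Fin l]→L[ℝ] 𝕂) :
    altOf k a * altOf l b = (-1 : 𝕂) ^ (k * l) • (altOf l b * altOf k a) := altMul_comm_of rfl a b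

theorem ins_mul (v : E) (s t : AltAlg 𝕂 E) :
    ins v (s * t) = ins v s * t + altSign s * ins v t := ins_altMul v s t

theorem ins_add (u v : E) (s : AltAlg 𝕂 E) : ins (u + v) s = ins u s + ins v s := by
  refine LinearMap.congr_fun (f := ins (u + v)) (g := ins u + ins v)
    (AltAlg.linearMap_ext fun k a ↦ ?_) s
  rcases k with _ | k
  · simp
  · simp [ins_succ]

theorem ins_smul (r : ℝ) (v : E) (s : AltAlg 𝕂 E) : ins (r • v) s = (r : 𝕂) • ins v s := by
  refine LinearMap.congr_fun (f := ins (r • v)) (g := (r : 𝕂) • ins v)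
    (AltAlg.linearMap_ext fun k a ↦ ?_) s
  rcases k with _ | k
  · simp
  · have h : a.curryLeft (r • v) = (r : 𝕂) • a.curryLeft v := by rw [map_smul, real_smul_alt]
    rw [LinearMap.smul_apply, ins_succ, ins_succ, h, map_smul]

end ExteriorAlgebra

end

end PoissonForms

namespace PoissonForms

noncomputable section

/-! ### Bases, alternatization and algebraic derivations -/

section ExteriorAlgebraFinite

open DirectSum

variable {𝕂 : Type*} [RCLike 𝕂] {E : Type*} [NormedAddCommGroup E] [NormedSpace ℝ E]

theorem alt_one_ext {a b : E [⋀^Fin 1]→L[ℝ] 𝕂} (h : ∀ v : E, a ![v] = b ![v]) : a = b := by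
  ext u
  have : u = ![u 0] := by
    funext i
    rw [Subsingleton.elim i 0]
    rfl
  rw [this, h]

theorem altOf_zero_eq (a : E [⋀^Fin 0]→L[ℝ] 𝕂) : altOf 0 a = a ![] • (1 : AltAlg 𝕂 E) := by
  rw [← AltAlg.zero_mul_of, mul_one]

theorem ins_one (v : E) (ξ : E [⋀^Fin 1]→L[ℝ] 𝕂) :
    ins v (altOf 1 ξ) = ξ ![v] • (1 : AltAlg 𝕂 E) := by
  rw [ins_succ, altOf_zero_eq]
  congr 1

/-- Pull-back along a linear map, on the algebra of forms. -/
def pullAlg (g : E →L[ℝ] E) : AltAlg 𝕂 E →ₗ[𝕂] AltAlg 𝕂 E :=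
  toModule 𝕂 ℕ _ fun k ↦ altOf k ∘ₗ pullAlt g

@[simp]
theorem pullAlg_of (g : E →L[ℝ] E) {k : ℕ} (a : E [⋀^Fin k]→L[ℝ] 𝕂) :
    pullAlg g (altOf k a) = altOf k (pullAlt g a) := by
  simp [pullAlg]

theorem AltAlg.bilin_ext {N : Type*} [AddCommMonoid N] [Module 𝕂 N]
    {f g : AltAlg 𝕂 E →ₗ[𝕂] AltAlg 𝕂 E →ₗ[𝕂] N}
    (h : ∀ k l a b, f (altOf k a) (altOf l b) = g (altOf k a) (altOf l b)) (s t) : f s t = g s t :=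
  LinearMap.congr_fun₂ (AltAlg.linearMap_ext fun k a ↦ AltAlg.linearMap_ext fun l b ↦ h k l a b) s t

theorem pullAlg_mul (g : E →L[ℝ] E) (s t : AltAlg 𝕂 E) :
    pullAlg g (s * t) = pullAlg g s * pullAlg g t := by
  refine AltAlg.bilin_ext (f := altMul.compr₂ (pullAlg g))
    (g := altMul.compl₁₂ (pullAlg g) (pullAlg g)) (fun k l a b ↦ ?_) s t
  simp only [LinearMap.compr₂_apply, LinearMap.compl₁₂_apply, altMul_of, pullAlg_of]
  exact congrArg _ (altWedge_comp a b g)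

theorem altSign_mul (s t : AltAlg 𝕂 E) : altSign (s * t) = altSign s * altSign t := by
  refine AltAlg.bilin_ext (f := altMul.compr₂ altSign)
    (g := altMul.compl₁₂ altSign altSign) (fun k l a b ↦ ?_) s t
  simp only [LinearMap.compr₂_apply, LinearMap.compl₁₂_apply, altMul_of, altSign_of, map_smul,
    LinearMap.smul_apply, smul_smul, pow_add]
  rw [mul_comm]

theorem altSign_altSign (s : AltAlg 𝕂 E) : altSign (altSign s) = s := by
  refine LinearMap.congr_fun (f := altSign ∘ₗ altSign) (g := LinearMap.id)
    (AltAlg.linearMap_ext fun k a ↦ ?_) s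
  simp [smul_smul, ← mul_pow]

theorem altSign_pow_of (m : ℕ) {k : ℕ} (a : E [⋀^Fin k]→L[ℝ] 𝕂) :
    (altSign ^ m) (altOf k a) = (-1 : 𝕂) ^ (m * k) • altOf k a := by
  induction m with
  | zero => simp
  | succ m ih =>
    rw [pow_succ', Module.End.mul_apply, ih, map_smul, altSign_of, smul_smul, add_mul, one_mul,
      pow_add]

/-- Graded commutativity of the algebra of forms. -/
theorem AltAlg.of_mul_comm {k : ℕ} (a : E [⋀^Fin k]→L[ℝ] 𝕂) (s : AltAlg 𝕂 E) :
    s * altOf k a = altOf k a * (altSign ^ k) s := by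
  refine LinearMap.congr_fun (f := altMul.flip (altOf k a))
    (g := altMul (altOf k a) ∘ₗ (altSign ^ k)) (AltAlg.linearMap_ext fun l b ↦ ?_) s
  simp only [LinearMap.flip_apply, LinearMap.comp_apply, altSign_pow_of, map_smul]
  rw [mul_comm k l]
  exact AltAlg.mul_comm_of b a

/-- The contraction of a one-form-valued derivative with its alternatization. -/
theorem curryLeft_alternatizeUncurryFin {n : ℕ} (f : E →L[ℝ] E [⋀^Fin (n + 1)]→L[ℝ] 𝕂) (v : E) :
    (ContinuousAlternatingMap.alternatizeUncurryFin f).curryLeft v =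
      f v - ContinuousAlternatingMap.alternatizeUncurryFin
        (((ContinuousLinearMap.apply ℝ (E [⋀^Fin n]→L[ℝ] 𝕂) v).comp
          (ContinuousAlternatingMap.curryLeftLI (𝕜 := ℝ) (E := E) (F := 𝕂)
            (n := n)).toContinuousLinearMap).comp f) := by
  ext u
  rw [curryLeft_apply_eq, ContinuousAlternatingMap.alternatizeUncurryFin_apply, Fin.sum_univ_succ,
    ContinuousAlternatingMap.sub_apply, ContinuousAlternatingMap.alternatizeUncurryFin_apply,
    sub_eq_add_neg, ← Finset.sum_neg_distrib]
  congr 1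
  · simp
  · refine Finset.sum_congr rfl fun j _ ↦ ?_
    have h : j.succ.removeNth (Fin.cons v u : Fin (n + 2) → E) = Fin.cons v (j.removeNth u) := by
      funext i
      refine Fin.cases ?_ (fun m ↦ ?_) i
      · simp [Fin.removeNth]
      · simp [Fin.removeNth]
    rw [h, Fin.cons_succ, Fin.val_succ, pow_succ]
    simp only [mul_neg, mul_one, neg_smul]
    rfl

variable [FiniteDimensional ℝ E]

/-- The coordinate covectors of the standard basis of `E`. -/
def coordCov (i : Fin (Module.finrank ℝ E)) : E [⋀^Fin 1]→L[ℝ] 𝕂 :=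
  ContinuousAlternatingMap.ofSubsingleton ℝ E 𝕂 (0 : Fin 1) ((RCLike.ofRealCLM (K := 𝕂)).comp
    (LinearMap.toContinuousLinearMap ((Module.finBasis ℝ E).coord i)))

theorem coordCov_apply (i : Fin (Module.finrank ℝ E)) (v : Fin 1 → E) :
    (coordCov i : E [⋀^Fin 1]→L[ℝ] 𝕂) v = (((Module.finBasis ℝ E).repr (v 0) i : ℝ) : 𝕂) := by
  simp [coordCov]

theorem alt_one_apply_eq_sum (ξ : E [⋀^Fin 1]→L[ℝ] 𝕂) (v : E) :
    ξ ![v] = ∑ i, (((Module.finBasis ℝ E).repr v i : ℝ) : 𝕂) * ξ ![Module.finBasis ℝ E i] := by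
  have hlin : ∀ u, (ξ.curryLeft u) ![] = ξ ![u] := fun u ↦ by
    rw [curryLeft_apply_eq]; congr 1
  conv_lhs => rw [← hlin, ← (Module.finBasis ℝ E).sum_repr v, map_sum]
  rw [ContinuousAlternatingMap.sum_apply]
  refine Finset.sum_congr rfl fun i _ ↦ ?_
  rw [map_smul, ContinuousAlternatingMap.smul_apply, hlin, RCLike.real_smul_eq_coe_mul]

theorem alt_one_eq_sum (ξ : E [⋀^Fin 1]→L[ℝ] 𝕂) :
    ξ = ∑ i, ξ ![Module.finBasis ℝ E i] • coordCov i := by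
  refine alt_one_ext fun v ↦ ?_
  rw [alt_one_apply_eq_sum, ContinuousAlternatingMap.sum_apply]
  refine Finset.sum_congr rfl fun i _ ↦ ?_
  rw [ContinuousAlternatingMap.smul_apply, coordCov_apply, smul_eq_mul, mul_comm]
  rfl

/-- Alternatization in terms of a basis: it is the sum of `eⁱ ∧ f(eᵢ)`. -/
theorem altOf_alternatizeUncurryFin {n : ℕ} (f : E →L[ℝ] E [⋀^Fin n]→L[ℝ] 𝕂) :
    altOf (n + 1) (ContinuousAlternatingMap.alternatizeUncurryFin f) =
      ∑ i, altOf 1 (coordCov i) * altOf n (f (Module.finBasis ℝ E i)) := by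
  have hf (n : ℕ) (f : E →L[ℝ] E [⋀^Fin n]→L[ℝ] 𝕂) (v : E) : altOf n (f v) =
      ∑ i, (coordCov i : E [⋀^Fin 1]→L[ℝ] 𝕂) ![v] • altOf n (f (Module.finBasis ℝ E i)) := by
    conv_lhs => rw [← (Module.finBasis ℝ E).sum_repr v]
    simp only [map_sum, map_smul, coordCov_apply, real_smul_alt]
    rfl
  have h0 (n : ℕ) (f : E →L[ℝ] E [⋀^Fin n]→L[ℝ] 𝕂) :
      (∑ i, altOf 1 (coordCov i) * altOf n (f (Module.finBasis ℝ E i)) : AltAlg 𝕂 E) 0 = 0 := by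
    have : ∀ i, altOf 1 (coordCov i : E [⋀^Fin 1]→L[ℝ] 𝕂) * altOf n (f (Module.finBasis ℝ E i)) =
      altOf (1 + n) (altWedge (coordCov i) (f (Module.finBasis ℝ E i))) := fun i ↦ AltAlg.mul_of _ _
    simp only [this, ← map_sum]
    exact altOf_apply_zero' (by omega) _
  -- Both sides are compared after contraction with `v`. On the right the antiderivation rule gives
  -- `∑ eⁱ(v) f(eᵢ)`, which is `f v`, minus `∑ eⁱ ∧ ι_v f(eᵢ)`, which the induction hypothesis
  -- identifies with the alternatization of the contracted map.
  induction n with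
  | zero =>
    refine AltAlg.ext_ins ?_ fun v ↦ ?_
    · rw [altOf_apply_zero, h0]
    · rw [ins_succ, map_sum]
      simp only [ins_mul, ins_one, ins_zero, mul_zero, add_zero, smul_mul_assoc, one_mul]
      rw [← hf]
      refine congrArg _ ?_
      ext u
      rw [curryLeft_apply_eq, ContinuousAlternatingMap.alternatizeUncurryFin_apply]
      simp
  | succ n ih =>
    refine AltAlg.ext_ins ?_ fun v ↦ ?_
    · rw [altOf_apply_zero, h0]
    · rw [ins_succ, map_sum, curryLeft_alternatizeUncurryFin, map_sub, ih]
      simp only [ins_mul, ins_one v (coordCov _), smul_mul_assoc, one_mul, Finset.sum_add_distrib,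
        ← hf, altSign_of, pow_one, neg_smul, one_smul, neg_mul, Finset.sum_neg_distrib]
      simp only [ins_succ]
      rw [sub_eq_add_neg]
      rfl

/-- The algebraic derivation of the algebra of forms that extends `κ`. -/
def algDer {r : ℕ} (κ : (E [⋀^Fin 1]→L[ℝ] 𝕂) →ₗ[𝕂] (E [⋀^Fin r]→L[ℝ] 𝕂)) :
    AltAlg 𝕂 E →ₗ[𝕂] AltAlg 𝕂 E :=
  ∑ i, altMul (altOf r (κ (coordCov i))) ∘ₗ ins (Module.finBasis ℝ E i)

variable {r : ℕ} (κ : (E [⋀^Fin 1]→L[ℝ] 𝕂) →ₗ[𝕂] (E [⋀^Fin r]→L[ℝ] 𝕂))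

theorem algDer_apply (s : AltAlg 𝕂 E) :
    algDer κ s = ∑ i, altOf r (κ (coordCov i)) * ins (Module.finBasis ℝ E i) s := by
  simp only [algDer, LinearMap.sum_apply, LinearMap.comp_apply]
  rfl

theorem algDer_zero (a : E [⋀^Fin 0]→L[ℝ] 𝕂) : algDer κ (altOf 0 a) = 0 := by
  simp [algDer_apply]

theorem algDer_one (ξ : E [⋀^Fin 1]→L[ℝ] 𝕂) : algDer κ (altOf 1 ξ) = altOf r (κ ξ) := by
  rw [algDer_apply]
  conv_rhs => rw [alt_one_eq_sum ξ]
  simp only [ins_one, mul_smul_comm, mul_one, map_sum, map_smul]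

/-- Contraction contributes one sign, and moving `κ(eⁱ)`, of degree `r`, past `s` contributes `r`
more. The derivation has degree `r - 1`; its parity is recorded as `r + 1`, which also makes sense
for `r = 0`. -/
theorem algDer_mul (s t : AltAlg 𝕂 E) :
    algDer κ (s * t) = algDer κ s * t + (altSign ^ (r + 1)) s * algDer κ t := by
  simp only [algDer_apply, Finset.sum_mul, Finset.mul_sum, ← Finset.sum_add_distrib]
  refine Finset.sum_congr rfl fun i _ ↦ ?_
  have h := AltAlg.of_mul_comm (κ (coordCov i)) ((altSign ^ (r + 1)) s)
  have h2 : (altSign ^ r) ((altSign ^ (r + 1)) s) = altSign s := by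
    rw [← Module.End.mul_apply, ← pow_add, show r + (r + 1) = 2 * r + 1 by ring, pow_succ,
      Module.End.mul_apply, pow_mul]
    have : (altSign ^ 2 : AltAlg 𝕂 E →ₗ[𝕂] AltAlg 𝕂 E) = 1 := by
      ext1 s
      exact LinearMap.ext fun a ↦ by
        simp only [pow_two, LinearMap.comp_apply, Module.End.mul_apply, altSign_altSign]
        rfl
    rw [this, one_pow]
    rfl
  rw [ins_mul, mul_add, ← mul_assoc, ← mul_assoc, ← mul_assoc, h, h2]

theorem algDer_of_succ {l : ℕ} (a : E [⋀^Fin (l + 1)]→L[ℝ] 𝕂) :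
    algDer κ (altOf (l + 1) a) = altOf (r + l)
      (∑ i, altWedge (κ (coordCov i)) (a.curryLeft (Module.finBasis ℝ E i))) := by
  rw [algDer_apply, map_sum]
  refine Finset.sum_congr rfl fun i _ ↦ ?_
  rw [ins_succ, AltAlg.mul_of]

/-- The algebraic derivation does not depend on the choice of the basis. -/
theorem algDer_eq_sum_frame (A A' : E →L[ℝ] E) (h : A' ∘L A = ContinuousLinearMap.id ℝ E)
    (s : AltAlg 𝕂 E) :
    algDer κ s = ∑ i, altOf r (κ (pullAlt A (coordCov i))) *
      ins (A' (Module.finBasis ℝ E i)) s := by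
  -- The matrix of `A` is moved from the coframe to the frame, where `A'` undoes `A`.
  have h1 (i) : pullAlt A (coordCov i : E [⋀^Fin 1]→L[ℝ] 𝕂) =
      ∑ j, (((Module.finBasis ℝ E).repr (A (Module.finBasis ℝ E j)) i : ℝ) : 𝕂) • coordCov j := by
    conv_lhs => rw [alt_one_eq_sum (pullAlt A (coordCov i : E [⋀^Fin 1]→L[ℝ] 𝕂))]
    refine Finset.sum_congr rfl fun j _ ↦ ?_
    congr 1
  simp only [h1, map_sum, map_smul, Finset.sum_mul, smul_mul_assoc]
  rw [Finset.sum_comm, algDer_apply]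
  refine Finset.sum_congr rfl fun j _ ↦ ?_
  simp only [← mul_smul_comm, ← Finset.mul_sum]
  congr 1
  let L : E →+ AltAlg 𝕂 E := AddMonoidHom.mk' (fun v ↦ ins (A' v) s) fun u v ↦ by
    simp only [map_add, ins_add]
  have h2 : L (A (Module.finBasis ℝ E j)) = L (∑ i, (Module.finBasis ℝ E).repr
      (A (Module.finBasis ℝ E j)) i • Module.finBasis ℝ E i) := by
    rw [(Module.finBasis ℝ E).sum_repr]
  rw [map_sum] at h2
  have h3 : L (A (Module.finBasis ℝ E j)) = ins (Module.finBasis ℝ E j) s :=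
    congrArg (fun v ↦ ins v s) (DFunLike.congr_fun h (Module.finBasis ℝ E j))
  rw [← h3, h2]
  refine Finset.sum_congr rfl fun i _ ↦ ?_
  refine (congrArg (fun v ↦ ins v s) (map_smul A' _ _)).trans (ins_smul _ _ _)

/-- The Euler identity: a form of degree `k + 1` is recovered from its contractions. -/
theorem algDer_id {k : ℕ} (a : E [⋀^Fin (k + 1)]→L[ℝ] 𝕂) :
    algDer LinearMap.id (altOf (k + 1) a) = ((k + 1 : ℕ) : 𝕂) • altOf (k + 1) a := by
  have h := altOf_alternatizeUncurryFin (a.curryLeft)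
  rw [ContinuousAlternatingMap.alternatizeUncurryFin_curryLeft] at h
  rw [algDer_apply]
  simp only [ins_succ, LinearMap.id_apply]
  rw [← h, map_nsmul, Nat.cast_smul_eq_nsmul]

end ExteriorAlgebraFinite

end

end PoissonForms

namespace PoissonForms

noncomputable section

/-! ### Differential forms as a differential graded algebra -/

section FormAlgebra

open DirectSum

variable {𝕂 : Type*} [RCLike 𝕂] {E : Type*} [NormedAddCommGroup E] [NormedSpace ℝ E]
  {M : Type*} [TopologicalSpace M] [ChartedSpace E M]

instance instAddCommGroupForm (k : ℕ) : AddCommGroup (Form 𝕂 E M k) := Submodule.addCommGroup _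
instance instAddCommMonoidForm (k : ℕ) : AddCommMonoid (Form 𝕂 E M k) := Submodule.addCommMonoid _
instance instModuleForm (k : ℕ) : Module 𝕂 (Form 𝕂 E M k) := Submodule.module _
instance instAddCommMonoidForms : AddCommMonoid (Forms 𝕂 E M) := DirectSum.instAddCommMonoid _ _
instance instModuleForms : Module 𝕂 (Forms 𝕂 E M) := DirectSum.instModule

/-- The group is assembled over the additive monoid of the preceding instance, so that the two
structures agree by definition. -/
instance instAddCommGroupForms : AddCommGroup (Forms 𝕂 E M) :=
  let G : AddCommGroup (⨁ k, Form 𝕂 E M k) :=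
    @DirectSum.instAddCommGroup ℕ (fun k ↦ Form 𝕂 E M k) _
  { instAddCommMonoidForms with
    neg := G.neg
    sub := G.sub
    sub_eq_add_neg := G.sub_eq_add_neg
    zsmul := G.zsmul
    zsmul_zero' := G.zsmul_zero'
    zsmul_succ' := G.zsmul_succ'
    zsmul_neg' := G.zsmul_neg'
    neg_add_cancel := G.neg_add_cancel }

instance instContMDiffRingRCLike {𝕂 : Type*} [RCLike 𝕂] : ContMDiffRing 𝓘(ℝ, 𝕂) ∞ 𝕂 :=
  { (instNormedSpaceLieAddGroup : LieAddGroup 𝓘(ℝ, 𝕂) ∞ 𝕂) with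
    contMDiff_mul := by
      have h : ContDiff ℝ ∞ (fun p : 𝕂 × 𝕂 ↦ p.1 * p.2) := contDiff_mul
      have h2 := h.contMDiff
      rw [modelWithCornersSelf_prod, ← chartedSpaceSelf_prod] at h2
      exact h2 }

/-- The value of a form at a point. -/
def Form.at (x : M) {k : ℕ} : Form 𝕂 E M k →ₗ[𝕂] (E [⋀^Fin k]→L[ℝ] 𝕂) where
  toFun σ := σ.1 x
  map_add' _ _ := rfl
  map_smul' _ _ := rfl

/-- The value at a point of an inhomogeneous form. -/
def evAt (x : M) : Forms 𝕂 E M →ₗ[𝕂] AltAlg 𝕂 E :=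
  toModule 𝕂 ℕ _ fun k ↦ altOf k ∘ₗ Form.at x

@[simp]
theorem evAt_of (x : M) {k : ℕ} (σ : Form 𝕂 E M k) :
    evAt x (ofForm k σ) = altOf k (Form.at x σ) := by
  simp [evAt]

theorem evAt_apply (x : M) (s : Forms 𝕂 E M) (k : ℕ) : evAt x s k = Form.at x (s k) := by
  induction s using DirectSum.induction_on with
  | zero => simp
  | of i σ =>
    change evAt x (ofForm i σ) k = Form.at x (ofForm i σ k)
    rw [evAt_of]
    by_cases hi : i = k
    · subst hi
      erw [DirectSum.of_eq_same, DirectSum.of_eq_same]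
    · erw [DirectSum.of_eq_of_ne i k _ (Ne.symm hi), DirectSum.of_eq_of_ne i k _ (Ne.symm hi)]
      rw [map_zero]
  | add s t hs ht => rw [map_add, DirectSum.add_apply, DirectSum.add_apply, hs, ht, map_add]

/-- Identities between forms may be checked at each point. Through this the ring laws and sign rules
are inherited from the alternating forms on a single vector space. -/
theorem Forms.ext_evAt {s t : Forms 𝕂 E M} (h : ∀ x, evAt x s = evAt x t) : s = t := by
  refine DFinsupp.ext fun k ↦ Form.ext fun x ↦ ?_
  have := congrArg (fun z : AltAlg 𝕂 E ↦ z k) (h x)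
  simp only [evAt_apply] at this
  exact this

theorem ofForm_injective (k : ℕ) : Function.Injective (ofForm (𝕂 := 𝕂) (E := E) (M := M) k) :=
  DirectSum.of_injective k

theorem Forms.linearMap_ext {N : Type*} [AddCommMonoid N] [Module 𝕂 N]
    {f g : Forms 𝕂 E M →ₗ[𝕂] N} (h : ∀ k σ, f (ofForm k σ) = g (ofForm k σ)) : f = g :=
  DirectSum.linearMap_ext _ fun k ↦ LinearMap.ext (h k)

theorem Forms.bilin_ext {N : Type*} [AddCommMonoid N] [Module 𝕂 N]
    {f g : Forms 𝕂 E M →ₗ[𝕂] Forms 𝕂 E M →ₗ[𝕂] N}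
    (h : ∀ k l σ τ, f (ofForm k σ) (ofForm l τ) = g (ofForm k σ) (ofForm l τ)) (s t) :
    f s t = g s t :=
  LinearMap.congr_fun₂ (Forms.linearMap_ext fun k σ ↦ Forms.linearMap_ext fun l τ ↦ h k l σ τ) s t

/-- The parity involution of the algebra of forms on a manifold. -/
def formSign : Forms 𝕂 E M →ₗ[𝕂] Forms 𝕂 E M := toModule 𝕂 ℕ _ fun k ↦ (-1 : 𝕂) ^ k • ofForm k

@[simp]
theorem formSign_of {k : ℕ} (σ : Form 𝕂 E M k) :
    formSign (ofForm k σ) = (-1 : 𝕂) ^ k • ofForm k σ := by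
  simp [formSign]

theorem evAt_formSign (x : M) (s : Forms 𝕂 E M) : evAt x (formSign s) = altSign (evAt x s) := by
  refine LinearMap.congr_fun (f := evAt x ∘ₗ formSign) (g := altSign ∘ₗ evAt x)
    (Forms.linearMap_ext fun k σ ↦ ?_) s
  simp

theorem formSign_formSign (s : Forms 𝕂 E M) : formSign (formSign s) = s :=
  Forms.ext_evAt fun x ↦ by simp only [evAt_formSign, altSign_altSign]

theorem formSign_pow_of (m : ℕ) {k : ℕ} (σ : Form 𝕂 E M k) :
    (formSign ^ m) (ofForm k σ) = (-1 : 𝕂) ^ (m * k) • ofForm k σ := by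
  induction m with
  | zero => simp
  | succ m ih =>
    rw [pow_succ', Module.End.mul_apply, ih, map_smul, formSign_of, smul_smul, add_mul, one_mul,
      pow_add]

theorem evAt_formSign_pow (x : M) (m : ℕ) (s : Forms 𝕂 E M) :
    evAt x ((formSign ^ m) s) = (altSign ^ m) (evAt x s) := by
  induction m with
  | zero => simp
  | succ m ih => rw [pow_succ', pow_succ', Module.End.mul_apply, Module.End.mul_apply,
      evAt_formSign, ih]

theorem formSign_pow_two : (formSign ^ 2 : Forms 𝕂 E M →ₗ[𝕂] Forms 𝕂 E M) = 1 :=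
  LinearMap.ext fun s ↦ by
    rw [pow_two, Module.End.mul_apply, formSign_formSign]
    rfl

variable [FiniteDimensional ℝ E]

theorem wedgeForms_of {k l : ℕ} (σ : Form 𝕂 E M k) (τ : Form 𝕂 E M l) :
    wedgeForms (ofForm k σ) (ofForm l τ) = ofForm (k + l) (wedge k l σ τ) := by
  simp [wedgeForms]

theorem evAt_wedgeForms (x : M) (s t : Forms 𝕂 E M) :
    evAt x (wedgeForms s t) = evAt x s * evAt x t := by
  refine Forms.bilin_ext (f := wedgeForms.compr₂ (evAt x))
    (g := altMul.compl₁₂ (evAt x) (evAt x)) (fun k l σ τ ↦ ?_) s t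
  simp only [LinearMap.compr₂_apply, LinearMap.compl₁₂_apply, wedgeForms_of, evAt_of, altMul_of]
  rfl

variable [IsManifold 𝓘(ℝ, E) ∞ M]

/-- A smooth function, considered as an element of `Ω^*(M)`. -/
def fn (f : SmoothFun 𝕂 E M) : Forms 𝕂 E M := ofForm 0 (ofFun f)

theorem evAt_fn (x : M) (f : SmoothFun 𝕂 E M) : evAt x (fn f) = f x • (1 : AltAlg 𝕂 E) := by
  rw [fn, evAt_of, altOf_zero_eq]
  rfl

instance instRingForms : Ring (Forms 𝕂 E M) :=
  { instAddCommGroupForms with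
    mul := fun s t ↦ wedgeForms s t
    one := fn 1
    left_distrib := fun s t r ↦ map_add (wedgeForms s) t r
    right_distrib := fun s t r ↦ LinearMap.map_add₂ wedgeForms s t r
    zero_mul := fun s ↦ LinearMap.map_zero₂ wedgeForms s
    mul_zero := fun s ↦ map_zero (wedgeForms s)
    mul_assoc := fun s t r ↦ Forms.ext_evAt fun x ↦ by
      change evAt x (wedgeForms (wedgeForms s t) r) = evAt x (wedgeForms s (wedgeForms t r))
      simp only [evAt_wedgeForms, mul_assoc]
    one_mul := fun s ↦ Forms.ext_evAt fun x ↦ by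
      change evAt x (wedgeForms (fn 1) s) = evAt x s
      rw [evAt_wedgeForms, evAt_fn, ContMDiffMap.coe_one, Pi.one_apply, one_smul, one_mul]
    mul_one := fun s ↦ Forms.ext_evAt fun x ↦ by
      change evAt x (wedgeForms s (fn 1)) = evAt x s
      rw [evAt_wedgeForms, evAt_fn, ContMDiffMap.coe_one, Pi.one_apply, one_smul, mul_one] }

instance : IsScalarTower 𝕂 (Forms 𝕂 E M) (Forms 𝕂 E M) :=
  ⟨fun c s t ↦ LinearMap.map_smul₂ wedgeForms c s t⟩

instance : SMulCommClass 𝕂 (Forms 𝕂 E M) (Forms 𝕂 E M) :=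
  ⟨fun c s t ↦ (map_smul (wedgeForms s) c t).symm⟩

theorem wedgeForms_eq_mul (s t : Forms 𝕂 E M) : wedgeForms s t = s * t := rfl

theorem evAt_mul (x : M) (s t : Forms 𝕂 E M) : evAt x (s * t) = evAt x s * evAt x t :=
  evAt_wedgeForms x s t

theorem evAt_one (x : M) : evAt x (1 : Forms 𝕂 E M) = 1 := by
  change evAt x (fn 1) = 1
  rw [evAt_fn, ContMDiffMap.coe_one, Pi.one_apply, one_smul]

theorem ofForm_mul {k l : ℕ} (σ : Form 𝕂 E M k) (τ : Form 𝕂 E M l) :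
    ofForm k σ * ofForm l τ = ofForm (k + l) (wedge k l σ τ) := wedgeForms_of σ τ

theorem formSign_mul (s t : Forms 𝕂 E M) : formSign (s * t) = formSign s * formSign t :=
  Forms.ext_evAt fun x ↦ by simp only [evAt_formSign, evAt_mul, altSign_mul]

theorem formSign_fn (f : SmoothFun 𝕂 E M) : formSign (fn f) = fn f := by
  simp [fn]

theorem formSign_pow_fn (m : ℕ) (f : SmoothFun 𝕂 E M) : (formSign ^ m) (fn f) = fn f := by
  rw [fn, formSign_pow_of]; simp

/-- Graded commutativity of the wedge product. -/
theorem mul_ofForm_comm {k : ℕ} (σ : Form 𝕂 E M k) (s : Forms 𝕂 E M) :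
    s * ofForm k σ = ofForm k σ * (formSign ^ k) s :=
  Forms.ext_evAt fun x ↦ by
    rw [evAt_mul, evAt_mul, evAt_formSign_pow, evAt_of, AltAlg.of_mul_comm]

theorem mul_fn_comm (f : SmoothFun 𝕂 E M) (s : Forms 𝕂 E M) : s * fn f = fn f * s := by
  rw [fn, mul_ofForm_comm]; simp

theorem evAt_fn_mul (x : M) (f : SmoothFun 𝕂 E M) (s : Forms 𝕂 E M) :
    evAt x (fn f * s) = f x • evAt x s := by
  rw [evAt_mul, evAt_fn, smul_mul_assoc, one_mul]

theorem Form.at_smul (x : M) (f : SmoothFun 𝕂 E M) {k : ℕ} (σ : Form 𝕂 E M k) :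
    Form.at x (f • σ) = f x • Form.at x σ := rfl

theorem fn_mul_of (f : SmoothFun 𝕂 E M) {k : ℕ} (σ : Form 𝕂 E M k) :
    fn f * ofForm k σ = ofForm k (f • σ) :=
  Forms.ext_evAt fun x ↦ by rw [evAt_fn_mul, evAt_of, evAt_of, Form.at_smul, map_smul]

theorem fn_mul (f g : SmoothFun 𝕂 E M) : fn (f * g) = fn f * fn g :=
  Forms.ext_evAt fun x ↦ by
    rw [evAt_fn_mul, evAt_fn, evAt_fn, smul_smul]
    rfl

theorem fn_add (f g : SmoothFun 𝕂 E M) : fn (f + g) = fn f + fn g :=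
  Forms.ext_evAt fun x ↦ by
    rw [map_add, evAt_fn, evAt_fn, evAt_fn, ← add_smul]
    rfl

/-- A constant function. -/
def constFn (c : 𝕂) : SmoothFun 𝕂 E M := ⟨fun _ ↦ c, contMDiff_const⟩

theorem fn_const (c : 𝕂) : fn (constFn c : SmoothFun 𝕂 E M) = c • 1 :=
  Forms.ext_evAt fun x ↦ by
    rw [map_smul, evAt_fn, evAt_one]
    rfl

theorem fn_injective : Function.Injective (fn : SmoothFun 𝕂 E M → Forms 𝕂 E M) := by
  intro f g h
  ext x
  have h1 := congrArg (fun σ : Form 𝕂 E M 0 ↦ Form.at x σ ![]) (ofForm_injective 0 h)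
  exact h1

theorem exists_eq_ofFun (σ : Form 𝕂 E M 0) : ∃ f : SmoothFun 𝕂 E M, σ = ofFun f := by
  refine ⟨⟨fun x ↦ Form.at x σ ![], contMDiff_of_charts fun p ↦ ?_⟩, Form.ext fun x ↦ ?_⟩
  · have h := (σ.2 p)
    refine ((ContinuousAlternatingMap.constOfIsEmptyLIE ℝ E
      𝕂 (Fin 0)).symm.contDiff.comp_contDiffOn h).congr fun y _ ↦ ?_
    change Form.at _ σ _ = Form.at _ σ _
    exact congrArg _ (Subsingleton.elim (α := Fin 0 → E) _ _)
  · ext u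
    exact congrArg (Form.at x σ) (Subsingleton.elim (α := Fin 0 → E) _ _)

theorem exists_ofForm_zero_eq_fn (σ : Form 𝕂 E M 0) : ∃ f : SmoothFun 𝕂 E M, ofForm 0 σ = fn f := by
  obtain ⟨f, rfl⟩ := exists_eq_ofFun σ
  exact ⟨f, rfl⟩

@[simp]
theorem dForms_of {k : ℕ} (σ : Form 𝕂 E M k) : dForms (ofForm k σ) = ofForm (k + 1) (extD k σ) := by
  simp [dForms]

/-- Near `x`, and not just at `x`, the form `dσ` is represented in the chart at `x` by the
derivative of the representative of `σ`. So `d² = 0` on the model space applies. -/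
theorem extD_extD {k : ℕ} (σ : Form 𝕂 E M k) : extD (k + 1) (extD k σ) = 0 := by
  refine Form.ext fun x ↦ ?_
  have h : localRep (extDerivAt σ.1) x =ᶠ[𝓝 (extChartAt 𝓘(ℝ, E) x x)]
      extDeriv (localRep σ.1 x) := by
    filter_upwards [(isOpen_target (E := E) x).mem_nhds (mem_extChartAt_target x)] with y hy
    exact localRep_extDerivAt σ hy
  change (extDeriv (localRep (extDerivAt σ.1) x) _).compContinuousLinearMap _ = 0
  rw [h.extDeriv_eq, extDeriv_extDeriv_apply (r := ∞) ((σ.2 x).contDiffAt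
    ((isOpen_target x).mem_nhds (mem_extChartAt_target x)))
    (by simpa using WithTop.coe_le_coe.2 (le_top : (2 : ℕ∞) ≤ ⊤))]
  rfl

theorem dForms_dForms (s : Forms 𝕂 E M) : dForms (dForms s) = 0 := by
  refine LinearMap.congr_fun (f := dForms ∘ₗ dForms) (g := 0) (Forms.linearMap_ext fun k σ ↦ ?_) s
  simp [extD_extD]

theorem dForms_formSign (s : Forms 𝕂 E M) : dForms (formSign s) = -formSign (dForms s) := by
  refine LinearMap.congr_fun (f := dForms ∘ₗ formSign) (g := -(formSign (𝕂 := 𝕂) ∘ₗ dForms))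
    (Forms.linearMap_ext fun k σ ↦ ?_) s
  simp [pow_succ]

/-- The derivative of the preferred chart at its base point. -/
def chartDeriv (x : M) : E →L[ℝ] E := mfderiv 𝓘(ℝ, E) 𝓘(ℝ, E) (extChartAt 𝓘(ℝ, E) x) x

theorem altOf_at_eq_pull (x : M) {k : ℕ} (σ : Form 𝕂 E M k) :
    altOf k (Form.at x σ) =
      pullAlg (chartDeriv x) (altOf k (localRep σ.1 x (extChartAt 𝓘(ℝ, E) x x))) := by
  rw [pullAlg_of]
  exact congrArg _ (localRep_comp_mfderiv σ.1 (mem_extChartAt_source x)).symm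

theorem evAt_dForms_of (x : M) {k : ℕ} (σ : Form 𝕂 E M k) :
    evAt x (dForms (ofForm k σ)) = pullAlg (chartDeriv x) (∑ i, altOf 1 (coordCov i) *
      altOf k (fderiv ℝ (localRep σ.1 x) (extChartAt 𝓘(ℝ, E) x x) (Module.finBasis ℝ E i))) := by
  rw [← altOf_alternatizeUncurryFin, pullAlg_of, dForms_of, evAt_of]
  rfl

theorem fderiv_altWedge {k l : ℕ} {a : E → E [⋀^Fin k]→L[ℝ] 𝕂} {b : E → E [⋀^Fin l]→L[ℝ] 𝕂} {y : E}
    (ha : DifferentiableAt ℝ a y) (hb : DifferentiableAt ℝ b y) (v : E) :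
    fderiv ℝ (fun z ↦ altWedge (a z) (b z)) y v =
      altWedge (fderiv ℝ a y v) (b y) + altWedge (a y) (fderiv ℝ b y v) := by
  let B : (E [⋀^Fin k]→L[ℝ] 𝕂) →ₗ[ℝ] (E [⋀^Fin l]→L[ℝ] 𝕂) →ₗ[ℝ] (E [⋀^Fin (k + l)]→L[ℝ] 𝕂) :=
    LinearMap.mk₂ ℝ altWedge altWedge_add_left
      (fun r a b ↦ by simp only [real_smul_alt, altWedge_smul_left]) altWedge_add_right
      (fun r a b ↦ by simp only [real_smul_alt, altWedge_smul_right])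
  have h := (B.toContinuousBilinearMap.hasFDerivAt_of_bilinear ha.hasFDerivAt
    hb.hasFDerivAt).fderiv
  have h2 := DFunLike.congr_fun h v
  exact h2.trans (add_comm (altWedge (a y) (fderiv ℝ b y v)) (altWedge (fderiv ℝ a y v) (b y)))

/-- In a chart `d = ∑ eⁱ ∧ ∂ᵢ`, so the rule is the product rule for `∂ᵢ`; moving `eⁱ` past `σ`
produces `(-1)^k`. -/
theorem dForms_mul_of {k l : ℕ} (σ : Form 𝕂 E M k) (τ : Form 𝕂 E M l) :
    dForms (ofForm k σ * ofForm l τ) = dForms (ofForm k σ) * ofForm l τ +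
      (-1 : 𝕂) ^ k • (ofForm k σ * dForms (ofForm l τ)) := by
  refine Forms.ext_evAt fun x ↦ ?_
  have hw : localRep (wedge k l σ τ).1 x = fun y ↦
      altWedge (localRep σ.1 x y) (localRep τ.1 x y) := funext fun y ↦ altWedge_comp _ _ _
  rw [ofForm_mul, map_add, map_smul, evAt_mul, evAt_mul, evAt_of, evAt_of, altOf_at_eq_pull x σ,
    altOf_at_eq_pull x τ]
  simp only [evAt_dForms_of, hw]
  rw [← pullAlg_mul, ← pullAlg_mul, ← map_smul, ← map_add]
  congr 1
  simp only [fderiv_altWedge (Form.differentiableAt σ (mem_extChartAt_target x))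
    (Form.differentiableAt τ (mem_extChartAt_target x)), map_add, ← AltAlg.mul_of, mul_add,
    Finset.sum_add_distrib, Finset.sum_mul, Finset.mul_sum, Finset.smul_sum, mul_assoc]
  congr 1
  refine Finset.sum_congr rfl fun i _ ↦ ?_
  rw [← mul_assoc, AltAlg.mul_comm_of, one_mul, smul_mul_assoc, mul_assoc]

theorem dForms_mul (s t : Forms 𝕂 E M) :
    dForms (s * t) = dForms s * t + formSign s * dForms t := by
  refine Forms.bilin_ext (f := wedgeForms.compr₂ dForms)
    (g := wedgeForms ∘ₗ dForms + wedgeForms.compl₁₂ formSign dForms) (fun k l σ τ ↦ ?_) s t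
  have h := dForms_mul_of σ τ
  simp only [LinearMap.compr₂_apply, LinearMap.compl₁₂_apply, LinearMap.add_apply,
    LinearMap.comp_apply, wedgeForms_eq_mul, h, formSign_of, smul_mul_assoc]

end FormAlgebra

end

end PoissonForms

namespace PoissonForms

noncomputable section

/-! ### Smoothness in charts, cutoffs and extension of local data -/

section Localization

open DirectSum

variable {𝕂 : Type*} [RCLike 𝕂] {E : Type*} [NormedAddCommGroup E] [NormedSpace ℝ E]
  [FiniteDimensional ℝ E]

/-- Evaluation on tuples of basis vectors embeds the alternating forms linearly into a finite
product of copies of `𝕂`, and a linear left inverse carries smoothness back. -/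
theorem contDiffAt_alt {D : Type*} [NormedAddCommGroup D] [NormedSpace ℝ D] {k : ℕ}
    {f : D → E [⋀^Fin k]→L[ℝ] 𝕂} {z : D} (h : ∀ u, ContDiffAt ℝ ∞ (fun z ↦ f z u) z) :
    ContDiffAt ℝ ∞ f z := by
  let b := Module.finBasis ℝ E
  let L : (E [⋀^Fin k]→L[ℝ] 𝕂) →ₗ[ℝ] ((Fin k → Fin (Module.finrank ℝ E)) → 𝕂) :=
    { toFun := fun a I ↦ a (fun i ↦ b (I i))
      map_add' := fun _ _ ↦ rfl
      map_smul' := fun _ _ ↦ rfl }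
  have hL : Function.Injective L := by
    intro a a' haa
    have h1 : a.toMultilinearMap = a'.toMultilinearMap :=
      Module.Basis.ext_multilinear (fun _ ↦ b) fun I ↦ congrFun haa I
    ext u
    exact congrArg (fun m : MultilinearMap ℝ (fun _ : Fin k ↦ E) 𝕂 ↦ m u) h1
  obtain ⟨G, hG⟩ := L.exists_leftInverse_of_injective (LinearMap.ker_eq_bot.2 hL)
  have h1 : ContDiffAt ℝ ∞ (fun z ↦ L (f z)) z := contDiffAt_pi.2 fun I ↦ h _
  have h2 := (LinearMap.toContinuousLinearMap G).contDiff.contDiffAt.comp z h1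
  refine h2.congr_of_eventuallyEq (Filter.Eventually.of_forall fun w ↦ ?_)
  exact (LinearMap.congr_fun hG (f w)).symm

/-- The value of a form on vectors is multilinear in the vectors and linear in the form, hence
jointly analytic. -/
theorem ContDiffAt.compContinuousLinearMap_alt {k : ℕ} {a : E → E [⋀^Fin k]→L[ℝ] 𝕂}
    {L : E → E →L[ℝ] E} {y : E} (ha : ContDiffAt ℝ ∞ a y) (hL : ContDiffAt ℝ ∞ L y) :
    ContDiffAt ℝ ∞ (fun z ↦ (a z).compContinuousLinearMap (L z)) y := by
  refine contDiffAt_alt fun u ↦ ?_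
  let T : (E [⋀^Fin k]→L[ℝ] 𝕂) →L[ℝ] ContinuousMultilinearMap ℝ (fun _ : Fin k ↦ E) 𝕂 :=
    ContinuousAlternatingMap.toContinuousMultilinearMapCLM ℝ
  have hT : ContDiff ℝ ∞ (fun q : (E [⋀^Fin k]→L[ℝ] 𝕂) × (Fin k → E) ↦ T q.1 q.2) :=
    contDiff_iff_contDiffAt.2 fun q ↦
      (T.analyticOnNhd_uncurry_of_multilinear (s := Set.univ) q (Set.mem_univ q)).contDiffAt
  have h1 : ContDiffAt ℝ ∞ (fun z ↦ (a z, fun i ↦ L z (u i))) y :=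
    ha.prodMk (contDiffAt_pi.2 fun i ↦ hL.clm_apply contDiffAt_const)
  exact hT.contDiffAt.comp y h1

variable {M : Type*} [TopologicalSpace M] [ChartedSpace E M] [IsManifold 𝓘(ℝ, E) ∞ M]

/-- A field of forms that is smooth in some chart around each point is smooth. -/
theorem mem_form_of_charts {k : ℕ} (σ : M → E [⋀^Fin k]→L[ℝ] 𝕂)
    (h : ∀ x, ∃ p, x ∈ (extChartAt 𝓘(ℝ, E) p).source ∧
      ContDiffAt ℝ ∞ (localRep (E := E) (M := M) σ p) (extChartAt 𝓘(ℝ, E) p x)) :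
    σ ∈ Form 𝕂 E M k := by
  intro q y hy
  refine ContDiffAt.contDiffWithinAt ?_
  obtain ⟨p, hxp, hp⟩ := h ((extChartAt 𝓘(ℝ, E) q).symm y)
  set t : E → E := fun z ↦ extChartAt 𝓘(ℝ, E) p ((extChartAt 𝓘(ℝ, E) q).symm z) with ht
  have hsymm : ContMDiffAt 𝓘(ℝ, E) 𝓘(ℝ, E) ∞ (extChartAt 𝓘(ℝ, E) q).symm y :=
    (contMDiffOn_extChartAt_symm (n := ∞) q).contMDiffAt ((isOpen_target q).mem_nhds hy)
  have hsrc : ∀ᶠ z in 𝓝 y, z ∈ (extChartAt 𝓘(ℝ, E) q).target ∧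
      (extChartAt 𝓘(ℝ, E) q).symm z ∈ (extChartAt 𝓘(ℝ, E) p).source :=
    ((isOpen_target q).eventually_mem hy).and
      (hsymm.continuousAt.eventually ((isOpen_extChartAt_source p).mem_nhds hxp))
  have hty : ContDiffAt ℝ ∞ t y := by
    have h2 : ContMDiffAt 𝓘(ℝ, E) 𝓘(ℝ, E) ∞ (extChartAt 𝓘(ℝ, E) p)
        ((extChartAt 𝓘(ℝ, E) q).symm y) := contMDiffAt_extChartAt' (by simpa using hxp)
    exact (h2.comp y hsymm).contDiffAt
  -- The two representatives differ by pull-back along the change of charts `t`, so smoothness in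
  -- the chart at `p` passes to the chart at `q`.
  have hev : localRep (E := E) (M := M) σ q =ᶠ[𝓝 y]
      fun z ↦ (localRep (E := E) (M := M) σ p (t z)).compContinuousLinearMap (fderiv ℝ t z) := by
    filter_upwards [hsrc] with z hz
    have hfd : fderiv ℝ t z = (mfderiv 𝓘(ℝ, E) 𝓘(ℝ, E) (extChartAt 𝓘(ℝ, E) p)
        ((extChartAt 𝓘(ℝ, E) q).symm z)) ∘L
        (mfderiv 𝓘(ℝ, E) 𝓘(ℝ, E) (extChartAt 𝓘(ℝ, E) q).symm z) := by
      rw [← mfderiv_eq_fderiv]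
      exact mfderiv_comp z (mdifferentiableAt_extChartAt (by simpa using hz.2)) (mdiff_symm hz.1)
    rw [hfd]
    exact (congrArg (fun a ↦ a.compContinuousLinearMap
      (mfderiv 𝓘(ℝ, E) 𝓘(ℝ, E) (extChartAt 𝓘(ℝ, E) q).symm z))
      (localRep_comp_mfderiv σ hz.2)).symm
  refine ContDiffAt.congr_of_eventuallyEq ?_ hev
  refine ContDiffAt.compContinuousLinearMap_alt
    (ContDiffAt.comp (g := localRep (E := E) (M := M) σ p) (f := t) y hp hty) ?_
  exact hty.fderiv_right (by simp)

/-- A field of forms that agrees locally with smooth forms is smooth. -/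
theorem mem_form_of_locally {k : ℕ} (σ : M → E [⋀^Fin k]→L[ℝ] 𝕂)
    (h : ∀ p, ∃ τ : Form 𝕂 E M k, ∀ᶠ x in 𝓝 p, σ x = Form.at x τ) : σ ∈ Form 𝕂 E M k := by
  refine mem_form_of_charts σ fun x ↦ ⟨x, mem_extChartAt_source x, ?_⟩
  obtain ⟨τ, hτ⟩ := h x
  refine ((τ.2 x).contDiffAt ((isOpen_target x).mem_nhds
    (mem_extChartAt_target x))).congr_of_eventuallyEq ?_
  have hc : ContinuousAt (extChartAt 𝓘(ℝ, E) x).symm (extChartAt 𝓘(ℝ, E) x x) :=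
    continuousAt_extChartAt_symm x
  have hτ' : ∀ᶠ z in 𝓝 ((extChartAt 𝓘(ℝ, E) x).symm (extChartAt 𝓘(ℝ, E) x x)),
      σ z = Form.at z τ := by rwa [extChartAt_to_inv]
  filter_upwards [hc.eventually hτ'] with y hy
  exact congrArg (fun a : E [⋀^Fin k]→L[ℝ] 𝕂 ↦ a.compContinuousLinearMap
    (mfderiv 𝓘(ℝ, E) 𝓘(ℝ, E) (extChartAt 𝓘(ℝ, E) x).symm y)) hy

variable [T2Space M]

theorem exists_bump {U : Set M} {p : M} (hU : U ∈ 𝓝 p) :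
    ∃ χ : M → ℝ, ContMDiff 𝓘(ℝ, E) 𝓘(ℝ, ℝ) ∞ χ ∧ (∀ᶠ x in 𝓝 p, χ x = 1) ∧ tsupport χ ⊆ U := by
  obtain ⟨f, -, hf⟩ := (SmoothBumpFunction.nhds_basis_tsupport (I := 𝓘(ℝ, E)) p).mem_iff.1 hU
  exact ⟨f, f.contMDiff, f.eventuallyEq_one, hf⟩

theorem contMDiff_ofReal {F : M → ℝ} (hF : ContMDiff 𝓘(ℝ, E) 𝓘(ℝ, ℝ) ∞ F) :
    ContMDiff 𝓘(ℝ, E) 𝓘(ℝ, 𝕂) ∞ (fun x ↦ (F x : 𝕂)) :=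
  (RCLike.ofRealCLM (K := 𝕂)).contDiff.contMDiff.comp hF

/-- A real bump function as a smooth `𝕂`-valued function. -/
theorem exists_bump_fun {U : Set M} {p : M} (hU : U ∈ 𝓝 p) :
    ∃ χ : SmoothFun 𝕂 E M, (∀ x, RCLike.im (χ x) = 0) ∧ (∀ᶠ x in 𝓝 p, χ x = 1) ∧
      ∀ x ∉ U, χ x = 0 := by
  obtain ⟨χ, hs, h1, hsupp⟩ := exists_bump (E := E) hU
  refine ⟨⟨fun x ↦ (χ x : 𝕂), contMDiff_ofReal hs⟩, fun x ↦ RCLike.ofReal_im _, ?_, fun x hx ↦ ?_⟩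
  · filter_upwards [h1] with x hx
    change ((χ x : ℝ) : 𝕂) = 1
    rw [hx, RCLike.ofReal_one]
  · change ((χ x : ℝ) : 𝕂) = 0
    rw [image_eq_zero_of_notMem_tsupport fun h ↦ hx (hsupp h), RCLike.ofReal_zero]

/-- A function that is smooth near a point agrees near that point with a smooth function. -/
theorem exists_smoothFun_eventuallyEq {U : Set M} {p : M} (hU : IsOpen U) (hp : p ∈ U) {F : M → 𝕂}
    (hF : ContMDiffOn 𝓘(ℝ, E) 𝓘(ℝ, 𝕂) ∞ F U) :
    ∃ g : SmoothFun 𝕂 E M, (∀ᶠ x in 𝓝 p, g x = F x) ∧ ∀ x, ∃ r : ℝ, g x = (r : 𝕂) * F x := by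
  obtain ⟨χ, hs, h1, hsupp⟩ := exists_bump (E := E) (hU.mem_nhds hp)
  refine ⟨⟨fun x ↦ χ x • F x, contMDiff_of_tsupport fun x hx ↦ ?_⟩, ?_, fun x ↦ ⟨χ x, ?_⟩⟩
  · have hxU : x ∈ U := hsupp (tsupport_smul_subset_left _ _ hx)
    exact (hs x).smul (hF.contMDiffAt (hU.mem_nhds hxU))
  · filter_upwards [h1] with x hx
    change χ x • F x = F x
    rw [hx, one_smul]
  · exact RCLike.real_smul_eq_coe_mul _ _

/-- A field of forms that is smooth in a chart agrees near each point with a smooth form. -/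
theorem exists_form_eventuallyEq {k : ℕ} (σ : M → E [⋀^Fin k]→L[ℝ] 𝕂) {p x₀ : M}
    (hx₀ : x₀ ∈ (extChartAt 𝓘(ℝ, E) p).source)
    (hσ : ContDiffOn ℝ ∞ (localRep (E := E) (M := M) σ p) (extChartAt 𝓘(ℝ, E) p).target) :
    ∃ τ : Form 𝕂 E M k, (∀ᶠ x in 𝓝 x₀, Form.at x τ = σ x) ∧
      ∀ x, ∃ r : ℝ, Form.at x τ = (r : 𝕂) • σ x := by
  obtain ⟨χ, hs, h1, hsupp⟩ := exists_bump (E := E)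
    ((isOpen_extChartAt_source (I := 𝓘(ℝ, E)) p).mem_nhds hx₀)
  refine ⟨⟨fun x ↦ (χ x : 𝕂) • σ x, mem_form_of_charts _ fun x ↦ ?_⟩, ?_, fun x ↦ ⟨χ x, rfl⟩⟩
  -- Inside the chart the product with the cutoff is smooth; a point outside has a neighbourhood on
  -- which the cutoff vanishes.
  · by_cases hx : x ∈ (extChartAt 𝓘(ℝ, E) p).source
    · refine ⟨p, hx, ?_⟩
      have hy := (extChartAt 𝓘(ℝ, E) p).map_source hx
      have h2 := SmoothFun.contDiffOn (𝕂 := 𝕂) ⟨fun x ↦ (χ x : 𝕂), contMDiff_ofReal hs⟩ p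
      exact (h2.contDiffAt ((isOpen_target p).mem_nhds hy)).smul
        (hσ.contDiffAt ((isOpen_target p).mem_nhds hy))
    · refine ⟨x, mem_extChartAt_source x, ?_⟩
      have hx' : x ∉ tsupport χ := fun h ↦ hx (hsupp h)
      have h0 : ∀ᶠ z in 𝓝 x, χ z = 0 := notMem_tsupport_iff_eventuallyEq.1 hx'
      have hc : ContinuousAt (extChartAt 𝓘(ℝ, E) x).symm (extChartAt 𝓘(ℝ, E) x x) :=
        continuousAt_extChartAt_symm x
      have h0' : ∀ᶠ z in 𝓝 ((extChartAt 𝓘(ℝ, E) x).symm (extChartAt 𝓘(ℝ, E) x x)), χ z = 0 := by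
        rwa [extChartAt_to_inv]
      refine (contDiffAt_const (c := 0)).congr_of_eventuallyEq ?_
      filter_upwards [hc.eventually h0'] with y hy
      ext u
      change ((χ ((extChartAt 𝓘(ℝ, E) x).symm y) : ℝ) : 𝕂) * _ = 0
      rw [hy, RCLike.ofReal_zero, zero_mul]
  · filter_upwards [h1] with x hx
    change ((χ x : ℝ) : 𝕂) • σ x = σ x
    rw [hx, RCLike.ofReal_one, one_smul]

end Localization

end

end PoissonForms

namespace PoissonForms

noncomputable section

/-! ### Coordinate frames and local decomposition of forms -/

section Frames

open DirectSum

variable {𝕂 : Type*} [RCLike 𝕂] {E : Type*} [NormedAddCommGroup E] [NormedSpace ℝ E]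
  [FiniteDimensional ℝ E]
  {M : Type*} [TopologicalSpace M] [ChartedSpace E M] [IsManifold 𝓘(ℝ, E) ∞ M]

/-- The derivative of the chart `φ_p` at `x`. -/
def chartD (p x : M) : E →L[ℝ] E := mfderiv 𝓘(ℝ, E) 𝓘(ℝ, E) (extChartAt 𝓘(ℝ, E) p) x

/-- The derivative of the inverse of the chart `φ_p` at the image of `x`. -/
def chartDInv (p x : M) : E →L[ℝ] E :=
  mfderiv 𝓘(ℝ, E) 𝓘(ℝ, E) (extChartAt 𝓘(ℝ, E) p).symm (extChartAt 𝓘(ℝ, E) p x)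

theorem chartDInv_comp_chartD {p x : M} (hx : x ∈ (extChartAt 𝓘(ℝ, E) p).source) :
    chartDInv p x ∘L chartD p x = ContinuousLinearMap.id ℝ E := by
  have key := mfderivWithin_extChartAt_symm_comp_mfderiv_extChartAt' (I := 𝓘(ℝ, E)) hx
  simp only [modelWithCornersSelf_coe, Set.range_id, mfderivWithin_univ] at key
  exact key

theorem chartD_comp_chartDInv {p x : M} (hx : x ∈ (extChartAt 𝓘(ℝ, E) p).source) :
    chartD p x ∘L chartDInv p x = ContinuousLinearMap.id ℝ E := by
  have key := mfderiv_chart_comp_symm ((extChartAt 𝓘(ℝ, E) p).map_source hx)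
  rw [(extChartAt 𝓘(ℝ, E) p).left_inv hx] at key
  exact key

theorem at_eq_pull_localRep {k : ℕ} (σ : Form 𝕂 E M k) {p x : M}
    (hx : x ∈ (extChartAt 𝓘(ℝ, E) p).source) :
    Form.at x σ = pullAlt (chartD p x) (localRep σ.1 p (extChartAt 𝓘(ℝ, E) p x)) :=
  (localRep_comp_mfderiv σ.1 hx).symm

theorem at_dFun (f : SmoothFun 𝕂 E M) {p x : M} (hx : x ∈ (extChartAt 𝓘(ℝ, E) p).source) (v : E) :
    Form.at x (dFun f) ![v] = fderiv ℝ (fun y ↦ f ((extChartAt 𝓘(ℝ, E) p).symm y))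
      (extChartAt 𝓘(ℝ, E) p x) (chartD p x v) := by
  have hy := (extChartAt 𝓘(ℝ, E) p).map_source hx
  rw [at_eq_pull_localRep (dFun f) hx]
  have h1 : localRep (dFun f).1 p (extChartAt 𝓘(ℝ, E) p x) =
      extDeriv (localRep (ofFun f).1 p) (extChartAt 𝓘(ℝ, E) p x) :=
    localRep_extDerivAt (ofFun f) hy
  rw [h1]
  have hd : DifferentiableAt ℝ (fun y ↦ f ((extChartAt 𝓘(ℝ, E) p).symm y))
      (extChartAt 𝓘(ℝ, E) p x) :=
    ((SmoothFun.contDiffOn f p).contDiffAt ((isOpen_target p).mem_nhds hy)).differentiableAt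
      (by simp)
  change extDeriv (localRep (ofFun f).1 p) (extChartAt 𝓘(ℝ, E) p x)
    (fun i ↦ chartD p x (![v] i)) = _
  rw [extDeriv_apply (Form.differentiableAt (ofFun f) hy)]
  simp only [Fin.sum_univ_succ, Finset.univ_eq_empty, Finset.sum_empty, add_zero, Fin.val_zero,
    pow_zero, one_smul]
  rfl

theorem ofForm_dFun (f : SmoothFun 𝕂 E M) : ofForm 1 (dFun f) = dForms (fn f) :=
  (dForms_of (ofFun f)).symm

variable [T2Space M]

/-- Any smooth function on the target of a chart is realized near a point by a smooth function
on `M`. -/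
theorem exists_smoothFun_chart {p x₀ : M} (hx₀ : x₀ ∈ (extChartAt 𝓘(ℝ, E) p).source) {V : Set E}
    (hV : IsOpen V) (hxV : extChartAt 𝓘(ℝ, E) p x₀ ∈ V) {F : E → 𝕂} (hF : ContDiffOn ℝ ∞ F V) :
    ∃ g : SmoothFun 𝕂 E M, (∀ᶠ x in 𝓝 x₀, g x = F (extChartAt 𝓘(ℝ, E) p x)) ∧
      ∀ x, ∃ r : ℝ, g x = (r : 𝕂) * F (extChartAt 𝓘(ℝ, E) p x) := by
  have hU : IsOpen ((extChartAt 𝓘(ℝ, E) p).source ∩ extChartAt 𝓘(ℝ, E) p ⁻¹' V) :=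
    (continuousOn_extChartAt p).isOpen_inter_preimage (isOpen_extChartAt_source p) hV
  refine exists_smoothFun_eventuallyEq hU ⟨hx₀, hxV⟩ ?_
  refine (hF.contMDiffOn (n := ∞)).comp ?_ fun x hx ↦ hx.2
  exact (contMDiffOn_extChartAt (n := ∞)).mono fun x hx ↦ by simpa using hx.1

/-- A covector on the model space, as the differential of a smooth function near a point. -/
theorem exists_dFun_eq_pull (ξ : E [⋀^Fin 1]→L[ℝ] 𝕂) {p x₀ : M}
    (hx₀ : x₀ ∈ (extChartAt 𝓘(ℝ, E) p).source) :
    ∃ g : SmoothFun 𝕂 E M, (∀ᶠ x in 𝓝 x₀, Form.at x (dFun g) = pullAlt (chartD p x) ξ) ∧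
      ((∀ v, RCLike.im (ξ v) = 0) → ∀ x, RCLike.im (g x) = 0) := by
  let L : E →L[ℝ] 𝕂 := (ContinuousAlternatingMap.ofSubsingleton ℝ E 𝕂 (0 : Fin 1)).symm ξ
  have hL (v : E) : L v = ξ ![v] := by
    change ξ (fun _ ↦ v) = ξ ![v]
    congr 1
    funext i
    rw [Subsingleton.elim i 0]
    rfl
  -- The function is a cutoff of the linear function `ξ` in the chart. The cutoff factor is real, so
  -- a real covector gives a real function.
  obtain ⟨g, hg, hr⟩ := exists_smoothFun_chart (M := M) hx₀ isOpen_univ (Set.mem_univ _)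
    (L.contDiff (n := ∞)).contDiffOn
  refine ⟨g, ?_, fun hξ x ↦ ?_⟩
  · filter_upwards [hg.eventually_nhds, (isOpen_extChartAt_source p).mem_nhds hx₀] with x hx hxs
    refine alt_one_ext fun v ↦ ?_
    rw [at_dFun g hxs]
    have hc : ContinuousAt (extChartAt 𝓘(ℝ, E) p).symm (extChartAt 𝓘(ℝ, E) p x) :=
      continuousAt_extChartAt_symm' hxs
    have h1 : (fun y ↦ g ((extChartAt 𝓘(ℝ, E) p).symm y)) =ᶠ[𝓝 (extChartAt 𝓘(ℝ, E) p x)] L := by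
      rw [← (extChartAt 𝓘(ℝ, E) p).left_inv hxs] at hx
      filter_upwards [hc.eventually hx,
        (isOpen_target p).mem_nhds ((extChartAt 𝓘(ℝ, E) p).map_source hxs)] with y hy hyt
      rw [hy, (extChartAt 𝓘(ℝ, E) p).right_inv hyt]
    rw [h1.fderiv_eq, ContinuousLinearMap.fderiv, hL]
    change _ = ξ (fun i ↦ chartD p x (![v] i))
    congr 1
    funext i
    rw [Subsingleton.elim i 0]
    rfl
  · obtain ⟨r, hr⟩ := hr x
    rw [hr, hL, RCLike.im_ofReal_mul, hξ, mul_zero]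

/-- Contraction of a form with a coordinate vector field near a point. -/
theorem exists_contraction {k : ℕ} (w : Form 𝕂 E M (k + 1)) (v : E) {p x₀ : M}
    (hx₀ : x₀ ∈ (extChartAt 𝓘(ℝ, E) p).source) :
    ∃ w' : Form 𝕂 E M k,
      (∀ᶠ x in 𝓝 x₀, Form.at x w' = (Form.at x w).curryLeft (chartDInv p x v)) ∧
      (IsRealForm w → IsRealForm w') := by
  let σ : M → E [⋀^Fin k]→L[ℝ] 𝕂 := fun x ↦ (Form.at x w).curryLeft (chartDInv p x v)
  have hσ : ContDiffOn ℝ ∞ (localRep (E := E) (M := M) σ p) (extChartAt 𝓘(ℝ, E) p).target := by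
    have h1 : ContDiffOn ℝ ∞ (fun y ↦ (localRep w.1 p y).curryLeft v)
        (extChartAt 𝓘(ℝ, E) p).target :=
      ((ContinuousAlternatingMap.curryLeftLI (𝕜 := ℝ) (E := E) (F := 𝕂)
        (n := k)).contDiff.comp_contDiffOn (w.2 p)).clm_apply contDiffOn_const
    refine h1.congr fun y hy ↦ ?_
    ext u
    have hy' : extChartAt 𝓘(ℝ, E) p ((extChartAt 𝓘(ℝ, E) p).symm y) = y :=
      (extChartAt 𝓘(ℝ, E) p).right_inv hy
    change (w.1 ((extChartAt 𝓘(ℝ, E) p).symm y)) (Fin.cons (mfderiv 𝓘(ℝ, E) 𝓘(ℝ, E)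
      (extChartAt 𝓘(ℝ, E) p).symm (extChartAt 𝓘(ℝ, E) p ((extChartAt 𝓘(ℝ, E) p).symm y)) v)
      (fun i ↦ mfderiv 𝓘(ℝ, E) 𝓘(ℝ, E) (extChartAt 𝓘(ℝ, E) p).symm y (u i))) =
      (w.1 ((extChartAt 𝓘(ℝ, E) p).symm y)) (fun i ↦ mfderiv 𝓘(ℝ, E) 𝓘(ℝ, E)
      (extChartAt 𝓘(ℝ, E) p).symm y ((Fin.cons v u : Fin (k + 1) → E) i))
    congr 1
    funext i
    refine Fin.cases ?_ (fun j ↦ ?_) i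
    · exact congrArg (fun z ↦ (mfderiv 𝓘(ℝ, E) 𝓘(ℝ, E)
        (extChartAt 𝓘(ℝ, E) p).symm z : E →L[ℝ] E) v) hy'
    · rfl
  obtain ⟨τ, hτ, hr⟩ := exists_form_eventuallyEq σ hx₀ hσ
  refine ⟨τ, hτ, fun hw x u ↦ ?_⟩
  obtain ⟨r, hr⟩ := hr x
  change RCLike.im (Form.at x τ u) = 0
  rw [hr]
  change RCLike.im ((r : 𝕂) * _) = 0
  rw [RCLike.im_ofReal_mul]
  have h0 : RCLike.im (Form.at x w (Fin.cons (chartDInv p x v) u)) = 0 := hw x _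
  exact (congrArg (fun t ↦ r * t) h0).trans (mul_zero r)

/-- Locally every form of positive degree is a sum of products with exact one-forms. -/
theorem exists_local_decomposition {k : ℕ} (w : Form 𝕂 E M (k + 1)) (p : M) :
    ∃ (χ : SmoothFun 𝕂 E M) (g : Fin (Module.finrank ℝ E) → SmoothFun 𝕂 E M)
      (u : Fin (Module.finrank ℝ E) → Form 𝕂 E M k), (∀ᶠ x in 𝓝 p, χ x = 1) ∧
      fn χ * ofForm (k + 1) w = ∑ i, dForms (fn (g i)) * ofForm k (u i) ∧
      (∀ x, RCLike.im (χ x) = 0) ∧ (∀ i x, RCLike.im (g i x) = 0) ∧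
      (IsRealForm w → ∀ i, IsRealForm (u i)) ∧
      (Form.at p w = 0 → ∀ i, Form.at p (u i) = 0) := by
  have hp := mem_extChartAt_source (I := 𝓘(ℝ, E)) p
  choose g hg hgr using fun i : Fin (Module.finrank ℝ E) ↦
    exists_dFun_eq_pull (M := M) (coordCov i : E [⋀^Fin 1]→L[ℝ] 𝕂) hp
  choose u hu hur using fun i : Fin (Module.finrank ℝ E) ↦
    exists_contraction w (Module.finBasis ℝ E i) hp
  have hU : {x | (∀ i, Form.at x (dFun (g i)) = pullAlt (chartD p x) (coordCov i)) ∧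
      (∀ i, Form.at x (u i) = (Form.at x w).curryLeft (chartDInv p x (Module.finBasis ℝ E i))) ∧
      x ∈ (extChartAt 𝓘(ℝ, E) p).source} ∈ 𝓝 p := by
    filter_upwards [Filter.eventually_all.2 hg, Filter.eventually_all.2 hu,
      (isOpen_extChartAt_source p).mem_nhds hp] with x h1 h2 h3 using ⟨h1, h2, h3⟩
  obtain ⟨χ, hχr, hχ1, hχ0⟩ := exists_bump_fun (𝕂 := 𝕂) (E := E) hU
  have hc : ((k + 1 : ℕ) : 𝕂) ≠ 0 := Nat.cast_ne_zero.2 (Nat.succ_ne_zero k)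
  -- By the Euler identity `∑ dxⁱ ∧ ι_i w = (k + 1) w`, which explains the factor `1 / (k + 1)`. The
  -- cutoff `χ` vanishes wherever `g` or `u` fails to be adapted to the coordinate frame.
  refine ⟨χ, g, fun i ↦ χ • (((k + 1 : ℕ) : 𝕂)⁻¹ • u i), hχ1, ?_, hχr,
    fun i x ↦ hgr i (fun v ↦ by rw [coordCov_apply, RCLike.ofReal_im]) x, fun hw i x v ↦ ?_, fun hw i ↦ ?_⟩
  · refine Forms.ext_evAt fun x ↦ ?_
    rw [evAt_fn_mul, map_sum, evAt_of]
    by_cases hx : x ∈ {x | (∀ i, Form.at x (dFun (g i)) = pullAlt (chartD p x) (coordCov i)) ∧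
      (∀ i, Form.at x (u i) = (Form.at x w).curryLeft (chartDInv p x (Module.finBasis ℝ E i))) ∧
      x ∈ (extChartAt 𝓘(ℝ, E) p).source}
    · obtain ⟨h1, h2, h3⟩ := hx
      have h4 := algDer_id (Form.at x w)
      rw [algDer_eq_sum_frame _ (chartD p x) (chartDInv p x) (chartDInv_comp_chartD h3)] at h4
      have h5 : altOf (k + 1) (Form.at x w) = ((k + 1 : ℕ) : 𝕂)⁻¹ •
          ((k + 1 : ℕ) : 𝕂) • altOf (k + 1) (Form.at x w) := by
        rw [smul_smul, inv_mul_cancel₀ hc, one_smul]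
      rw [h5, ← h4, Finset.smul_sum, Finset.smul_sum]
      refine Finset.sum_congr rfl fun i _ ↦ ?_
      rw [evAt_mul, ← ofForm_dFun, evAt_of, evAt_of, Form.at_smul, map_smul, map_smul, h1, h2,
        ins_succ, map_smul, mul_smul_comm, mul_smul_comm, LinearMap.id_apply]
    · rw [hχ0 x hx, zero_smul]
      refine (Finset.sum_eq_zero fun i _ ↦ ?_).symm
      rw [evAt_mul, evAt_of, Form.at_smul, map_smul, hχ0 x hx, zero_smul, mul_zero]
  · change RCLike.im (χ x * (((k + 1 : ℕ) : 𝕂)⁻¹ * Form.at x (u i) v)) = 0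
    have h1 : RCLike.im (Form.at x (u i) v) = 0 := hur i hw x v
    simp [RCLike.mul_im, h1, hχr x]
  · have h0 : Form.at p (u i) = 0 := by
      rw [(hu i).self_of_nhds, hw]
      rfl
    rw [Form.at_smul, map_smul, h0]
    ext v
    exact (congrArg (fun a ↦ χ p * a) (mul_zero _)).trans (mul_zero _)

end Frames

end

end PoissonForms

namespace PoissonForms

noncomputable section

open DirectSum

/-! ### Graded derivations, degree and reality -/

section Derivations

variable {𝕂 : Type*} [RCLike 𝕂] {E : Type*} [NormedAddCommGroup E] [NormedSpace ℝ E]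
  [FiniteDimensional ℝ E] {M : Type*} [TopologicalSpace M] [ChartedSpace E M]
  [IsManifold 𝓘(ℝ, E) ∞ M]

theorem neg_one_pow_smul_smul {V : Type*} [AddCommGroup V] [Module 𝕂 V] (n : ℕ) (s : V) :
    (-1 : 𝕂) ^ n • (-1 : 𝕂) ^ n • s = s := by
  rw [smul_smul, ← mul_pow, neg_one_mul, neg_neg, one_pow, one_smul]

theorem formSign_pow_add_two (m : ℕ) :
    (formSign ^ (m + 2) : Forms 𝕂 E M →ₗ[𝕂] Forms 𝕂 E M) = formSign ^ m := by
  rw [pow_add, formSign_pow_two, mul_one]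

theorem formSign_pow_formSign_pow (m : ℕ) (s : Forms 𝕂 E M) :
    (formSign ^ m) ((formSign ^ m) s) = s := by
  rw [← Module.End.mul_apply, ← pow_add, ← two_mul, pow_mul, formSign_pow_two, one_pow,
    Module.End.one_apply]

/-- Graded derivations of the algebra of forms whose parity is that of `m`. -/
structure IsDer (m : ℕ) (δ : Forms 𝕂 E M →ₗ[𝕂] Forms 𝕂 E M) : Prop where
  map_mul : ∀ s t, δ (s * t) = δ s * t + (formSign ^ m) s * δ t
  map_sign : ∀ s, δ (formSign s) = (-1 : 𝕂) ^ m • formSign (δ s)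

namespace IsDer

variable {m n : ℕ} {δ δ' : Forms 𝕂 E M →ₗ[𝕂] Forms 𝕂 E M}

theorem map_sign_pow (h : IsDer m δ) (n : ℕ) (s : Forms 𝕂 E M) :
    δ ((formSign ^ n) s) = (-1 : 𝕂) ^ (m * n) • (formSign ^ n) (δ s) := by
  induction n generalizing s with
  | zero => simp
  | succ n ih =>
    rw [pow_succ, Module.End.mul_apply, ih, h.map_sign, map_smul, smul_smul, ← pow_add,
      Module.End.mul_apply, mul_add, mul_one]

theorem add (h : IsDer m δ) (h' : IsDer m δ') : IsDer m (δ + δ') where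
  map_mul s t := by
    simp only [LinearMap.add_apply, h.map_mul, h'.map_mul, add_mul, mul_add]
    abel
  map_sign s := by simp only [LinearMap.add_apply, h.map_sign, h'.map_sign, map_add, smul_add]

theorem smul (h : IsDer m δ) (c : 𝕂) : IsDer m (c • δ) where
  map_mul s t := by
    simp only [LinearMap.smul_apply, h.map_mul, smul_add, smul_mul_assoc, mul_smul_comm]
  map_sign s := by
    simp only [LinearMap.smul_apply, h.map_sign, map_smul]
    exact smul_comm _ _ _

theorem neg (h : IsDer m δ) : IsDer m (-δ) := by
  rw [← neg_one_smul 𝕂 δ]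
  exact h.smul _

theorem sub (h : IsDer m δ) (h' : IsDer m δ') : IsDer m (δ - δ') := by
  rw [sub_eq_add_neg]
  exact h.add h'.neg

/-- Signs see only the parity of `m`. This returns from the parity `r + 1` of an algebraic
derivation, composed with one more odd operation, to the parity `r`. -/
theorem of_add_two (h : IsDer (m + 2) δ) : IsDer m δ where
  map_mul s t := by rw [h.map_mul, formSign_pow_add_two]
  map_sign s := by rw [h.map_sign, pow_add, neg_one_sq, mul_one]

/-- The mixed terms, with one derivation on each factor, cancel. To see this the derivations must be
moved through the parity involution, which is what `map_sign` provides. -/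
theorem commutator (h : IsDer m δ) (h' : IsDer n δ') :
    IsDer (m + n) (δ ∘ₗ δ' - (-1 : 𝕂) ^ (m * n) • δ' ∘ₗ δ) where
  map_mul s t := by
    have e1 : (formSign ^ m) (δ' s) = (-1 : 𝕂) ^ (m * n) • δ' ((formSign ^ m) s) := by
      rw [h'.map_sign_pow, mul_comm n m, neg_one_pow_smul_smul]
    have e2 : (formSign ^ n) (δ s) = (-1 : 𝕂) ^ (m * n) • δ ((formSign ^ n) s) := by
      rw [h.map_sign_pow, neg_one_pow_smul_smul]
    have e3 : (formSign ^ n) ((formSign ^ m) s) = (formSign ^ (m + n)) s := by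
      rw [add_comm, pow_add, Module.End.mul_apply]
    have e4 : (formSign ^ m) ((formSign ^ n) s) = (formSign ^ (m + n)) s := by
      rw [pow_add, Module.End.mul_apply]
    simp only [LinearMap.sub_apply, LinearMap.smul_apply, LinearMap.comp_apply, h.map_mul,
      h'.map_mul, map_add, e1, e2, e3, e4, smul_add, smul_mul_assoc, neg_one_pow_smul_smul,
      sub_mul, mul_sub, mul_smul_comm]
    abel
  map_sign s := by
    simp only [LinearMap.sub_apply, LinearMap.smul_apply, LinearMap.comp_apply, h.map_sign,
      h'.map_sign, map_smul, map_sub, smul_sub, smul_smul, pow_add]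
    congr 2 <;> ring

theorem mul_left (h : IsDer m δ) {k : ℕ} (σ : Form 𝕂 E M k) :
    IsDer (k + m) (LinearMap.mulLeft 𝕂 (ofForm k σ) ∘ₗ δ) where
  map_mul s t := by
    have e : (formSign ^ (k + m)) s * ofForm k σ = ofForm k σ * (formSign ^ m) s := by
      rw [mul_ofForm_comm, pow_add, Module.End.mul_apply, formSign_pow_formSign_pow]
    simp only [LinearMap.comp_apply, LinearMap.mulLeft_apply, h.map_mul, mul_add, ← mul_assoc, e]
  map_sign s := by
    simp only [LinearMap.comp_apply, LinearMap.mulLeft_apply, h.map_sign, formSign_mul,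
      formSign_of, mul_smul_comm, smul_mul_assoc, smul_smul, pow_add]
    rw [mul_right_comm, ← mul_pow, neg_one_mul, neg_neg, one_pow, one_mul]

theorem map_fn_mul (h : IsDer m δ) (f : SmoothFun 𝕂 E M) (s : Forms 𝕂 E M) :
    δ (fn f * s) = δ (fn f) * s + fn f * δ s := by
  rw [h.map_mul, formSign_pow_fn]

end IsDer

theorem isDer_dForms : IsDer 1 (dForms : Forms 𝕂 E M →ₗ[𝕂] Forms 𝕂 E M) where
  map_mul s t := by rw [pow_one, dForms_mul]
  map_sign s := by rw [dForms_formSign, pow_one, neg_one_smul]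

/-- A form of pure degree `n`. -/
def HasDegree (n : ℕ) (s : Forms 𝕂 E M) : Prop := s ∈ LinearMap.range (ofForm n)

theorem hasDegree_iff {n : ℕ} {s : Forms 𝕂 E M} : HasDegree n s ↔ ∀ j ≠ n, s j = 0 := by
  constructor
  · rintro ⟨σ, rfl⟩ j hj
    exact DirectSum.of_eq_of_ne _ _ _ hj
  · intro h
    refine ⟨s n, ?_⟩
    refine DFinsupp.ext fun j ↦ ?_
    by_cases hj : j = n
    · subst hj
      exact DirectSum.of_eq_same _ _
    · rw [h j hj]
      exact DirectSum.of_eq_of_ne _ _ _ hj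

theorem hasDegree_of (n : ℕ) (σ : Form 𝕂 E M n) : HasDegree n (ofForm n σ) := ⟨σ, rfl⟩

theorem hasDegree_fn (f : SmoothFun 𝕂 E M) : HasDegree 0 (fn f) := ⟨_, rfl⟩

theorem HasDegree.add {n : ℕ} {s t : Forms 𝕂 E M} (hs : HasDegree n s) (ht : HasDegree n t) :
    HasDegree n (s + t) := Submodule.add_mem _ hs ht

theorem HasDegree.sub {n : ℕ} {s t : Forms 𝕂 E M} (hs : HasDegree n s) (ht : HasDegree n t) :
    HasDegree n (s - t) := Submodule.sub_mem _ hs ht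

theorem HasDegree.neg {n : ℕ} {s : Forms 𝕂 E M} (hs : HasDegree n s) :
    HasDegree n (-s) := Submodule.neg_mem _ hs

theorem HasDegree.smul {n : ℕ} {s : Forms 𝕂 E M} (hs : HasDegree n s) (c : 𝕂) :
    HasDegree n (c • s) := Submodule.smul_mem _ c hs

theorem HasDegree.mul {k l n : ℕ} (h : k + l = n) {s t : Forms 𝕂 E M} (hs : HasDegree k s)
    (ht : HasDegree l t) : HasDegree n (s * t) := by
  subst h
  obtain ⟨σ, rfl⟩ := hs
  obtain ⟨τ, rfl⟩ := ht
  exact ⟨wedge k l σ τ, (ofForm_mul σ τ).symm⟩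

theorem HasDegree.dForms {n : ℕ} {s : Forms 𝕂 E M} (hs : HasDegree n s) :
    HasDegree (n + 1) (dForms s) := by
  obtain ⟨σ, rfl⟩ := hs
  exact ⟨_, (dForms_of σ).symm⟩

theorem HasDegree.formSign_pow {n : ℕ} {s : Forms 𝕂 E M} (hs : HasDegree n s) (m : ℕ) :
    HasDegree n ((formSign ^ m) s) := by
  obtain ⟨σ, rfl⟩ := hs
  rw [formSign_pow_of]
  exact (hasDegree_of n σ).smul _

theorem HasDegree.formSign_pow_eq {n : ℕ} {s : Forms 𝕂 E M} (hs : HasDegree n s) (m : ℕ) :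
    (formSign ^ m) s = (-1 : 𝕂) ^ (m * n) • s := by
  obtain ⟨σ, rfl⟩ := hs
  rw [formSign_pow_of]

theorem HasDegree.formSign_eq {n : ℕ} {s : Forms 𝕂 E M} (hs : HasDegree n s) :
    formSign s = (-1 : 𝕂) ^ n • s := by
  obtain ⟨σ, rfl⟩ := hs
  rw [formSign_of]

theorem fn_mul_apply (f : SmoothFun 𝕂 E M) (s : Forms 𝕂 E M) (j : ℕ) (x : M) :
    Form.at x ((fn f * s) j) = f x • Form.at x (s j) := by
  rw [← evAt_apply, ← evAt_apply, evAt_fn_mul]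
  rfl

/-- Multiplication by a function acts componentwise and pointwise, so a function equal to `1` at `p`
does not change the value at `p`. The local decompositions describe only such a product, never the
form itself. -/
theorem hasDegree_of_local {n : ℕ} {s : Forms 𝕂 E M}
    (h : ∀ p, ∃ χ : SmoothFun 𝕂 E M, χ p = 1 ∧ HasDegree n (fn χ * s)) : HasDegree n s := by
  refine hasDegree_iff.2 fun j hj ↦ Form.ext fun p ↦ ?_
  obtain ⟨χ, hχ, hd⟩ := h p
  have h1 := fn_mul_apply χ s j p
  rw [hasDegree_iff.1 hd j hj, hχ, one_smul, map_zero] at h1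
  exact h1.symm

theorem eq_zero_of_local {s : Forms 𝕂 E M}
    (h : ∀ p, ∃ χ : SmoothFun 𝕂 E M, χ p = 1 ∧ fn χ * s = 0) : s = 0 := by
  refine Forms.ext_evAt fun p ↦ ?_
  obtain ⟨χ, hχ, hd⟩ := h p
  have h1 := evAt_fn_mul p χ s
  rw [hd, hχ, one_smul] at h1
  exact h1.symm

section Real

/-- All components of the form are real. -/
def IsRealElt (s : Forms 𝕂 E M) : Prop := ∀ k, IsRealForm (s k)

theorem isRealElt_of {k : ℕ} {σ : Form 𝕂 E M k} : IsRealElt (ofForm k σ) ↔ IsRealForm σ := by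
  constructor
  · intro h
    have := h k
    rwa [show (ofForm k σ : Forms 𝕂 E M) k = σ from DirectSum.of_eq_same _ _] at this
  · intro h j
    by_cases hj : j = k
    · subst hj
      rwa [show (ofForm j σ : Forms 𝕂 E M) j = σ from DirectSum.of_eq_same _ _]
    · rw [show (ofForm k σ : Forms 𝕂 E M) j = 0 from DirectSum.of_eq_of_ne _ _ _ hj]
      exact fun x v ↦ map_zero _

theorem IsRealElt.add {s t : Forms 𝕂 E M} (hs : IsRealElt s) (ht : IsRealElt t) :
    IsRealElt (s + t) := fun k x v ↦ by
  have h : RCLike.im ((s k).1 x v + (t k).1 x v) = 0 := by rw [map_add, hs k x v, ht k x v, add_zero]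
  exact h

theorem IsRealElt.neg {s : Forms 𝕂 E M} (hs : IsRealElt s) : IsRealElt (-s) := fun k x v ↦ by
  have h : RCLike.im (-(s k).1 x v) = 0 := by rw [map_neg, hs k x v, neg_zero]
  exact h

theorem IsRealElt.sub {s t : Forms 𝕂 E M} (hs : IsRealElt s) (ht : IsRealElt t) :
    IsRealElt (s - t) := by
  rw [sub_eq_add_neg]
  exact hs.add ht.neg

theorem isRealElt_zero : IsRealElt (0 : Forms 𝕂 E M) := fun _ _ _ ↦ map_zero _

theorem IsRealElt.sum {ι : Type*} (S : Finset ι) {s : ι → Forms 𝕂 E M}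
    (h : ∀ i ∈ S, IsRealElt (s i)) : IsRealElt (∑ i ∈ S, s i) := by
  classical
  induction S using Finset.induction_on with
  | empty => exact isRealElt_zero
  | insert a S ha ih =>
    rw [Finset.sum_insert ha]
    exact (h a (Finset.mem_insert_self a S)).add
      (ih fun i hi ↦ h i (Finset.mem_insert_of_mem hi))

theorem IsRealForm.wedge {k l : ℕ} {σ : Form 𝕂 E M k} {τ : Form 𝕂 E M l} (hσ : IsRealForm σ)
    (hτ : IsRealForm τ) : IsRealForm (wedge k l σ τ) := fun x v ↦ by
  change RCLike.im (altWedge (σ.1 x) (τ.1 x) v) = 0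
  rw [altWedge_apply, map_sum]
  refine Finset.sum_eq_zero fun s _ ↦ ?_
  induction s using Quotient.inductionOn' with
  | h s =>
    rw [mul'_summand, ← RCLike.ofReal_intCast, RCLike.im_ofReal_mul, RCLike.mul_im, hσ x _, hτ x _]
    simp

theorem IsRealElt.of_linear {δ : Forms 𝕂 E M →ₗ[𝕂] Forms 𝕂 E M}
    (h : ∀ k (σ : Form 𝕂 E M k), IsRealForm σ → IsRealElt (δ (ofForm k σ)))
    {s : Forms 𝕂 E M} (hs : IsRealElt s) : IsRealElt (δ s) := by
  classical
  rw [← DirectSum.sum_support_of s, map_sum]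
  exact IsRealElt.sum _ fun i _ ↦ h i (s i) (hs i)

theorem IsRealElt.mul {s t : Forms 𝕂 E M} (hs : IsRealElt s) (ht : IsRealElt t) :
    IsRealElt (s * t) := by
  refine IsRealElt.of_linear (δ := LinearMap.mulLeft 𝕂 s) (fun l τ hτ ↦ ?_) ht
  refine IsRealElt.of_linear (δ := LinearMap.mulRight 𝕂 (ofForm l τ)) (fun k σ hσ ↦ ?_) hs
  rw [LinearMap.mulRight_apply, ofForm_mul]
  exact isRealElt_of.2 (hσ.wedge hτ)

theorem isRealElt_fn {f : SmoothFun 𝕂 E M} : IsRealElt (fn f) ↔ ∀ x, RCLike.im (f x) = 0 :=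
  isRealElt_of.trans ⟨fun h x ↦ h x 0, fun h x _ ↦ h x⟩

theorem IsRealElt.formSign_pow {s : Forms 𝕂 E M} (hs : IsRealElt s) (m : ℕ) :
    IsRealElt ((formSign ^ m) s) := by
  refine IsRealElt.of_linear (fun k σ hσ ↦ ?_) hs
  rw [formSign_pow_of]
  rcases neg_one_pow_eq_or 𝕂 (m * k) with h | h <;> rw [h]
  · rw [one_smul]
    exact isRealElt_of.2 hσ
  · rw [neg_one_smul]
    exact (isRealElt_of.2 hσ).neg

theorem isRealElt_of_local {s : Forms 𝕂 E M}
    (h : ∀ p, ∃ χ : SmoothFun 𝕂 E M, χ p = 1 ∧ IsRealElt (fn χ * s)) : IsRealElt s := by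
  intro j p v
  obtain ⟨χ, hχ, hd⟩ := h p
  have h1 := fn_mul_apply χ s j p
  rw [hχ, one_smul] at h1
  have h2 : RCLike.im (Form.at p ((fn χ * s) j) v) = 0 := hd j p v
  rw [h1] at h2
  exact h2

end Real

variable [T2Space M]

namespace IsDer

variable {m : ℕ} {δ δ' : Forms 𝕂 E M →ₗ[𝕂] Forms 𝕂 E M}

/-- Induction on the degree. Since `δ` kills functions, it commutes with multiplication by the
cutoff; what is left is a sum of products `dg_i ∧ u_i` with `u_i` of lower degree. -/
theorem eq_zero (h : IsDer m δ) (h0 : ∀ f, δ (fn f) = 0) (h1 : ∀ f, δ (dForms (fn f)) = 0) :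
    δ = 0 := by
  refine Forms.linearMap_ext fun k σ ↦ ?_
  rw [LinearMap.zero_apply]
  induction k with
  | zero =>
    obtain ⟨f, hf⟩ := exists_ofForm_zero_eq_fn σ
    rw [hf, h0]
  | succ k ih =>
    refine eq_zero_of_local fun p ↦ ?_
    obtain ⟨χ, g, u, hχ, hw, -⟩ := exists_local_decomposition σ p
    refine ⟨χ, hχ.self_of_nhds, ?_⟩
    have := h.map_fn_mul χ (ofForm (k + 1) σ)
    rw [h0, zero_mul, zero_add] at this
    rw [← this, hw, map_sum]
    refine Finset.sum_eq_zero fun i _ ↦ ?_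
    rw [h.map_mul, h1, zero_mul, ih, mul_zero, zero_add]

/-- A derivation is determined by its values on functions and on exact one-forms. -/
theorem ext (h : IsDer m δ) (h' : IsDer m δ') (h0 : ∀ f, δ (fn f) = δ' (fn f))
    (h1 : ∀ f, δ (dForms (fn f)) = δ' (dForms (fn f))) : δ = δ' :=
  sub_eq_zero.1 ((h.sub h').eq_zero (fun f ↦ by rw [LinearMap.sub_apply, h0, sub_self])
    fun f ↦ by rw [LinearMap.sub_apply, h1, sub_self])

/-- The induction of `eq_zero`, except that the cutoff now contributes a term `δ(χ) σ`. It has the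
expected degree and is subtracted. -/
theorem hasDegree (h : IsDer m δ) {n : ℕ} (h0 : ∀ f, HasDegree n (δ (fn f)))
    (h1 : ∀ f, HasDegree (n + 1) (δ (dForms (fn f)))) {k : ℕ} (σ : Form 𝕂 E M k) :
    HasDegree (k + n) (δ (ofForm k σ)) := by
  induction k with
  | zero =>
    obtain ⟨f, hf⟩ := exists_ofForm_zero_eq_fn σ
    rw [hf, zero_add]
    exact h0 f
  | succ k ih =>
    refine hasDegree_of_local fun p ↦ ?_
    obtain ⟨χ, g, u, hχ, hw, -⟩ := exists_local_decomposition σ p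
    refine ⟨χ, hχ.self_of_nhds, ?_⟩
    have := h.map_fn_mul χ (ofForm (k + 1) σ)
    rw [← sub_eq_iff_eq_add'] at this
    rw [← this, hw, map_sum]
    refine HasDegree.sub (Submodule.sum_mem _ fun i _ ↦ ?_)
      (HasDegree.mul (add_comm _ _) (h0 χ) (hasDegree_of _ σ))
    rw [h.map_mul]
    exact HasDegree.add (HasDegree.mul (by omega) (h1 _) (hasDegree_of k (u i)))
      (HasDegree.mul (by omega) ((hasDegree_fn (g i)).dForms.formSign_pow m) (ih (u i)))

theorem isReal (h : IsDer m δ) (h0 : ∀ f, IsRealElt (fn f) → IsRealElt (δ (fn f)))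
    (h1 : ∀ f, IsRealElt (fn f) → IsRealElt (δ (dForms (fn f))))
    (hd : ∀ f : SmoothFun 𝕂 E M, IsRealElt (fn f) → IsRealElt (dForms (fn f)))
    {s : Forms 𝕂 E M} (hs : IsRealElt s) : IsRealElt (δ s) := by
  refine IsRealElt.of_linear (fun k σ hσ ↦ ?_) hs
  induction k with
  | zero =>
    obtain ⟨f, hf⟩ := exists_ofForm_zero_eq_fn σ
    rw [hf]
    exact h0 f (by rw [← hf]; exact isRealElt_of.2 hσ)
  | succ k ih =>
    refine isRealElt_of_local fun p ↦ ?_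
    obtain ⟨χ, g, u, hχ, hw, hχr, hgr, hur, -⟩ := exists_local_decomposition σ p
    refine ⟨χ, hχ.self_of_nhds, ?_⟩
    have hg i : IsRealElt (fn (g i)) := isRealElt_fn.2 (hgr i)
    have := h.map_fn_mul χ (ofForm (k + 1) σ)
    rw [← sub_eq_iff_eq_add'] at this
    rw [← this, hw, map_sum]
    refine IsRealElt.sub (IsRealElt.sum _ fun i _ ↦ ?_)
      (IsRealElt.mul (h0 χ (isRealElt_fn.2 hχr)) (isRealElt_of.2 hσ))
    rw [h.map_mul]
    exact IsRealElt.add (IsRealElt.mul (h1 _ (hg i)) (isRealElt_of.2 (hur hσ i)))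
      (IsRealElt.mul ((hd _ (hg i)).formSign_pow m) (ih (u i) (hur hσ i)))

end IsDer

end Derivations

end

end PoissonForms

namespace PoissonForms

noncomputable section

open DirectSum

/-! ### Function-linear maps and the derivations they define -/

section Tensors

variable {𝕂 : Type*} [RCLike 𝕂] {E : Type*} [NormedAddCommGroup E] [NormedSpace ℝ E]
  [FiniteDimensional ℝ E] {M : Type*} [TopologicalSpace M] [T2Space M] [ChartedSpace E M]
  [IsManifold 𝓘(ℝ, E) ∞ M]

theorem altOf_injective (k : ℕ) :
    Function.Injective (altOf k : (E [⋀^Fin k]→L[ℝ] 𝕂) →ₗ[𝕂] AltAlg 𝕂 E) :=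
  DirectSum.of_injective (β := fun k ↦ E [⋀^Fin k]→L[ℝ] 𝕂) k

theorem Form.ext_altOf {k : ℕ} {σ τ : Form 𝕂 E M k}
    (h : ∀ x, altOf k (Form.at x σ) = altOf k (Form.at x τ)) : σ = τ :=
  Form.ext fun x ↦ altOf_injective (E := E) k (h x)

/-- Every covector is the value of an exact form. -/
theorem exists_dFun_at (x : M) (ξ : E [⋀^Fin 1]→L[ℝ] 𝕂) :
    ∃ g : SmoothFun 𝕂 E M, Form.at x (dFun g) = ξ := by
  have hx := mem_extChartAt_source (I := 𝓘(ℝ, E)) x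
  obtain ⟨g, hg, -⟩ := exists_dFun_eq_pull (M := M) (pullAlt (chartDInv x x) ξ) hx
  refine ⟨g, hg.self_of_nhds.trans ?_⟩
  ext v
  change ξ (fun i ↦ chartDInv x x (chartD x x (v i))) = ξ v
  refine congrArg ξ (funext fun i ↦ ?_)
  exact DFunLike.congr_fun (chartDInv_comp_chartD hx) (v i)

/-- Locally every one-form is a linear combination of exact forms. -/
theorem exists_one_form_decomposition (α : Form 𝕂 E M 1) (p : M) :
    ∃ (χ : SmoothFun 𝕂 E M) (v g : Fin (Module.finrank ℝ E) → SmoothFun 𝕂 E M),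
      (∀ᶠ x in 𝓝 p, χ x = 1) ∧ χ • α = ∑ i, v i • dFun (g i) ∧ IsRealElt (fn χ) ∧
      (∀ i, IsRealElt (fn (g i))) ∧ (IsRealForm α → ∀ i, IsRealElt (fn (v i))) ∧
      (Form.at p α = 0 → ∀ i, v i p = 0) := by
  obtain ⟨χ, g, u, hχ, hw, hχr, hgr, hur, hu⟩ := exists_local_decomposition α p
  choose v hv using fun i ↦ exists_eq_ofFun (u i)
  refine ⟨χ, v, g, hχ, ofForm_injective 1 ?_, isRealElt_fn.2 hχr, fun i ↦ isRealElt_fn.2 (hgr i),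
    fun h i ↦ isRealElt_of.2 (hv i ▸ hur h i), fun h i ↦ ?_⟩
  · rw [← fn_mul_of, hw, map_sum]
    refine Finset.sum_congr rfl fun i _ ↦ ?_
    rw [hv i, ← fn_mul_of, ofForm_dFun]
    exact mul_fn_comm _ _
  · have h1 := congrArg (fun a : E [⋀^Fin 0]→L[ℝ] 𝕂 ↦ a ![]) (hu h i)
    rw [hv i] at h1
    exact h1

/-- Linear maps from one-forms to `r`-forms that are linear over functions. -/
structure IsTensor {r : ℕ} (κ : Form 𝕂 E M 1 →ₗ[𝕂] Form 𝕂 E M r) : Prop where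
  map_fun_smul : ∀ (f : SmoothFun 𝕂 E M) (α : Form 𝕂 E M 1), κ (f • α) = f • κ α

namespace IsTensor

variable {r : ℕ} {κ : Form 𝕂 E M 1 →ₗ[𝕂] Form 𝕂 E M r}

/-- Near `x` a one-form that vanishes at `x` is a combination of exact forms whose coefficients
vanish at `x`, and function-linearity pulls these coefficients out. -/
theorem at_eq_zero (h : IsTensor κ) {x : M} {α : Form 𝕂 E M 1} (hα : Form.at x α = 0) :
    Form.at x (κ α) = 0 := by
  obtain ⟨χ, v, g, hχ, h1, -, -, -, hv⟩ := exists_one_form_decomposition α x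
  have h2 : Form.at x (κ (χ • α)) = Form.at x (κ α) := by
    rw [h.map_fun_smul, Form.at_smul, hχ.self_of_nhds, one_smul]
  rw [← h2, h1, map_sum, map_sum]
  refine Finset.sum_eq_zero fun i _ ↦ ?_
  rw [h.map_fun_smul, Form.at_smul, hv hα]
  exact zero_smul 𝕂 (Form.at x (κ (dFun (g i))))

theorem at_congr (h : IsTensor κ) {x : M} {α β : Form 𝕂 E M 1} (hα : Form.at x α = Form.at x β) :
    Form.at x (κ α) = Form.at x (κ β) := by
  rw [← sub_eq_zero, ← map_sub, ← map_sub]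
  exact h.at_eq_zero (by rw [map_sub, hα, sub_self])

/-- Tensors are determined by their values on exact forms. -/
theorem ext {κ' : Form 𝕂 E M 1 →ₗ[𝕂] Form 𝕂 E M r} (h : IsTensor κ) (h' : IsTensor κ')
    (hd : ∀ g, κ (dFun g) = κ' (dFun g)) : κ = κ' := by
  refine LinearMap.ext fun α ↦ Form.ext fun x ↦ ?_
  change Form.at x (κ α) = Form.at x (κ' α)
  obtain ⟨g, hg⟩ := exists_dFun_at x (Form.at x α)
  rw [h.at_congr hg.symm, h'.at_congr hg.symm, hd]

end IsTensor

/-- Evaluation of one-forms at `x` is onto, and by `at_congr` the tensor at `x` depends only on the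
value there. Composing with a linear section gives the fibre map. -/
theorem exists_tensorAt {r : ℕ} {κ : Form 𝕂 E M 1 →ₗ[𝕂] Form 𝕂 E M r} (h : IsTensor κ) (x : M) :
    ∃ L : (E [⋀^Fin 1]→L[ℝ] 𝕂) →ₗ[𝕂] (E [⋀^Fin r]→L[ℝ] 𝕂),
      ∀ α, L (Form.at x α) = Form.at x (κ α) := by
  obtain ⟨s, hs⟩ := LinearMap.exists_rightInverse_of_surjective
    (Form.at x : Form 𝕂 E M 1 →ₗ[𝕂] (E [⋀^Fin 1]→L[ℝ] 𝕂))
    (LinearMap.range_eq_top.2 fun ξ ↦ (exists_dFun_at x ξ).imp' dFun fun _ h ↦ h)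
  refine ⟨Form.at x ∘ₗ κ ∘ₗ s, fun α ↦ h.at_congr ?_⟩
  exact LinearMap.congr_fun hs (Form.at x α)

/-- The value of a tensor at a point. -/
def tensorAt {r : ℕ} {κ : Form 𝕂 E M 1 →ₗ[𝕂] Form 𝕂 E M r} (h : IsTensor κ) (x : M) :
    (E [⋀^Fin 1]→L[ℝ] 𝕂) →ₗ[𝕂] (E [⋀^Fin r]→L[ℝ] 𝕂) := (exists_tensorAt h x).choose

theorem tensorAt_at {r : ℕ} {κ : Form 𝕂 E M 1 →ₗ[𝕂] Form 𝕂 E M r} (h : IsTensor κ) (x : M)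
    (α : Form 𝕂 E M 1) : tensorAt h x (Form.at x α) = Form.at x (κ α) :=
  (exists_tensorAt h x).choose_spec α

variable {r : ℕ} {κ : Form 𝕂 E M 1 →ₗ[𝕂] Form 𝕂 E M r}

/-- The fixed basis of `E`, read in the tangent spaces, need not be a smooth frame, so smoothness is
not visible in the definition of `algDer`. By `algDer_eq_sum_frame` it may be replaced near each
point by a coordinate frame, in which the insertion is a sum of wedge products of smooth forms. -/
theorem exists_insertion (h : IsTensor κ) {k : ℕ} (σ : Form 𝕂 E M (k + 1)) :
    ∃ τ : Form 𝕂 E M (r + k), ∀ x, altOf (r + k) (Form.at x τ) =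
      algDer (tensorAt h x) (altOf (k + 1) (Form.at x σ)) := by
  let F : M → E [⋀^Fin (r + k)]→L[ℝ] 𝕂 := fun x ↦ ∑ i, altWedge (tensorAt h x (coordCov i))
    ((Form.at x σ).curryLeft (Module.finBasis ℝ E i))
  have hF (x : M) : altOf (r + k) (F x) = algDer (tensorAt h x) (altOf (k + 1) (Form.at x σ)) :=
    (algDer_of_succ _ _).symm
  refine ⟨⟨F, mem_form_of_locally F fun p ↦ ?_⟩, hF⟩
  have hp := mem_extChartAt_source (I := 𝓘(ℝ, E)) p
  choose g hg _ using fun i : Fin (Module.finrank ℝ E) ↦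
    exists_dFun_eq_pull (M := M) (coordCov i : E [⋀^Fin 1]→L[ℝ] 𝕂) hp
  choose u hu _ using fun i : Fin (Module.finrank ℝ E) ↦
    exists_contraction σ (Module.finBasis ℝ E i) hp
  refine ⟨∑ i, wedge r k (κ (dFun (g i))) (u i), ?_⟩
  filter_upwards [Filter.eventually_all.2 hg, Filter.eventually_all.2 hu,
    (isOpen_extChartAt_source p).mem_nhds hp] with x h1 h2 h3
  refine altOf_injective (r + k) ?_
  rw [hF, algDer_eq_sum_frame _ (chartD p x) (chartDInv p x) (chartDInv_comp_chartD h3), map_sum,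
    map_sum]
  refine Finset.sum_congr rfl fun i _ ↦ ?_
  rw [← h1, tensorAt_at, ins_succ, ← h2, AltAlg.mul_of]
  rfl

/-- The algebraic derivation of the algebra of forms defined by a tensor: it vanishes on functions
and extends the tensor from one-forms. -/
theorem exists_algebraic_derivation (h : IsTensor κ) :
    ∃ δ : Forms 𝕂 E M →ₗ[𝕂] Forms 𝕂 E M, IsDer (r + 1) δ ∧ (∀ f, δ (fn f) = 0) ∧
      ∀ α, δ (ofForm 1 α) = ofForm r (κ α) := by
  choose τ hτ using fun (k : ℕ) (σ : Form 𝕂 E M (k + 1)) ↦ exists_insertion h σ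
  let ι : ∀ k, Form 𝕂 E M k →ₗ[𝕂] Forms 𝕂 E M := fun k ↦ match k with
    | 0 => 0
    | k + 1 => ofForm (r + k) ∘ₗ
      { toFun := τ k
        map_add' := fun a b ↦ Form.ext_altOf fun x ↦ by simp only [map_add, hτ]
        map_smul' := fun c a ↦ Form.ext_altOf fun x ↦ by
          simp only [map_smul, hτ, RingHom.id_apply] }
  let δ : Forms 𝕂 E M →ₗ[𝕂] Forms 𝕂 E M := toModule 𝕂 ℕ _ ι
  have hδ0 (σ : Form 𝕂 E M 0) : δ (ofForm 0 σ) = 0 := by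
    simp only [δ, toModule_lof]
    rfl
  have hδs {k : ℕ} (σ : Form 𝕂 E M (k + 1)) : δ (ofForm (k + 1) σ) = ofForm (r + k) (τ k σ) := by
    simp only [δ, toModule_lof]
    rfl
  -- At each point `δ` is the algebraic derivation of the fibre, from which it inherits the product
  -- rule.
  have hev (x : M) (s : Forms 𝕂 E M) : evAt x (δ s) = algDer (tensorAt h x) (evAt x s) := by
    refine LinearMap.congr_fun (f := evAt x ∘ₗ δ) (g := algDer (tensorAt h x) ∘ₗ evAt x)
      (Forms.linearMap_ext fun k σ ↦ ?_) s
    rw [LinearMap.comp_apply, LinearMap.comp_apply, evAt_of]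
    cases k with
    | zero => rw [hδ0, algDer_zero, map_zero]
    | succ k => rw [hδs, evAt_of, hτ]
  refine ⟨δ, ⟨fun s t ↦ Forms.ext_evAt fun x ↦ ?_, fun s ↦ ?_⟩, fun f ↦ hδ0 _, fun α ↦ ?_⟩
  · rw [map_add, evAt_mul, evAt_mul, hev, hev, hev, evAt_mul, algDer_mul, evAt_formSign_pow]
  · refine LinearMap.congr_fun (f := δ ∘ₗ formSign) (g := (-1 : 𝕂) ^ (r + 1) • formSign ∘ₗ δ)
      (Forms.linearMap_ext fun k σ ↦ ?_) s
    simp only [LinearMap.comp_apply, LinearMap.smul_apply, formSign_of, map_smul]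
    cases k with
    | zero => rw [hδ0, map_zero, smul_zero, smul_zero]
    | succ k =>
      rw [hδs, formSign_of, smul_smul, ← pow_add, show r + 1 + (r + k) = 2 * r + (k + 1) by ring,
        pow_add _ (2 * r), pow_mul, neg_one_sq, one_pow, one_mul]
  · refine Forms.ext_evAt fun x ↦ ?_
    rw [hev, evAt_of, evAt_of, algDer_one, tensorAt_at]

/-- A derivation of degree `r` is given by an arbitrary tensor on exact differentials of functions
and, up to a correction, by another tensor on exact one-forms. -/
theorem exists_derivation (h : IsTensor κ) {μ : Form 𝕂 E M 1 →ₗ[𝕂] Form 𝕂 E M (r + 1)}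
    (hμ : IsTensor μ) :
    ∃ δ : Forms 𝕂 E M →ₗ[𝕂] Forms 𝕂 E M, IsDer r δ ∧
      (∀ f, δ (fn f) = ofForm r (κ (dFun f))) ∧
      ∀ f, δ (dForms (fn f)) = (-1 : 𝕂) ^ r • dForms (ofForm r (κ (dFun f))) +
        ofForm (r + 1) (μ (dFun f)) := by
  obtain ⟨i, hi, hi0, hi1⟩ := exists_algebraic_derivation h
  obtain ⟨j, hj, hj0, hj1⟩ := exists_algebraic_derivation hμ
  -- The Frölicher–Nijenhuis form of a derivation: the graded commutator of `i` with `d` realizes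
  -- `κ` on functions and graded-commutes with `d`, while `j` vanishes on functions and corrects the
  -- value on exact forms by `μ`.
  refine ⟨(i ∘ₗ dForms - (-1 : 𝕂) ^ ((r + 1) * 1) • dForms ∘ₗ i) + j,
    ((hi.commutator isDer_dForms).of_add_two).add hj.of_add_two, fun f ↦ ?_, fun f ↦ ?_⟩
  · simp only [LinearMap.add_apply, LinearMap.sub_apply, LinearMap.smul_apply,
      LinearMap.comp_apply, hi0, hj0, map_zero, smul_zero, sub_zero, add_zero, ← ofForm_dFun, hi1]
  · simp only [LinearMap.add_apply, LinearMap.sub_apply, LinearMap.smul_apply,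
      LinearMap.comp_apply, dForms_dForms, map_zero, zero_sub]
    rw [← ofForm_dFun, hi1, hj1, mul_one, pow_succ, mul_neg_one, neg_smul, neg_neg]

end Tensors

end

end PoissonForms

namespace PoissonForms

noncomputable section

open DirectSum

/-! ### Hadamard's lemma -/

section Hadamard

open MeasureTheory
open scoped Convolution

/-- Hadamard's lemma. -/
theorem exists_eq_add_clm_sub {E V : Type*} [NormedAddCommGroup E] [NormedSpace ℝ E]
    [NormedAddCommGroup V] [NormedSpace ℝ V] [CompleteSpace V] {F : E → V} (hF : ContDiff ℝ ∞ F)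
    (a : E) :
    ∃ G : E → E →L[ℝ] V, ContDiff ℝ ∞ G ∧ G a = fderiv ℝ F a ∧ ∀ y, F y = F a + G y (y - a) := by
  have hF' : ContDiff ℝ ∞ (fderiv ℝ F) := hF.fderiv_right (by simp)
  have hline (y : E) : Continuous fun t : ℝ ↦ fderiv ℝ F (a + t • (y - a)) :=
    hF'.continuous.comp (by fun_prop)
  let G : E → E →L[ℝ] V := fun y ↦ ∫ t in (0 : ℝ)..1, fderiv ℝ F (a + t • (y - a))
  -- The bump equals `1` on `[-1, 1]`, so it changes nothing on the interval of integration. It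
  -- gives the integrand compact support in `t`, and the integral becomes a convolution evaluated at
  -- `0`, whence the reversed sign of `s`; such convolutions are smooth in the parameter `y`.
  let ψ : ContDiffBump (0 : ℝ) := ⟨1, 2, one_pos, one_lt_two⟩
  let g : E → ℝ → E →L[ℝ] V := fun y s ↦ ψ s • fderiv ℝ F (a - s • (y - a))
  have hG : G = fun y ↦ ((Set.Ioc (0 : ℝ) 1).indicator (fun _ ↦ (1 : ℝ))
      ⋆[ContinuousLinearMap.lsmul ℝ ℝ, volume] g y) 0 := by
    funext y
    rw [convolution_def]
    simp only [G, intervalIntegral.integral_of_le zero_le_one]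
    rw [← integral_indicator measurableSet_Ioc]
    refine integral_congr_ae (Filter.Eventually.of_forall fun t ↦ ?_)
    by_cases ht : t ∈ Set.Ioc (0 : ℝ) 1
    · have h1 : ψ (-t) = 1 := by
        refine ψ.one_of_mem_closedBall ?_
        rw [mem_closedBall_zero_iff, norm_neg, Real.norm_of_nonneg ht.1.le]
        exact ht.2
      simp only [Set.indicator_of_mem ht, g, h1, ContinuousLinearMap.lsmul_apply, one_smul,
        zero_sub, neg_smul, sub_neg_eq_add]
    · simp only [Set.indicator_of_notMem ht, map_zero, _root_.zero_apply]
  refine ⟨G, ?_, ?_, fun y ↦ ?_⟩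
  · rw [hG, ← contDiffOn_univ]
    refine contDiffOn_convolution_right_with_param_comp (n := ⊤) _ contDiffOn_const isOpen_univ
      (isCompact_closedBall (0 : ℝ) 2) (fun p s _ hs ↦ ?_) ?_ ?_
    · have h0 : ψ s = 0 := ψ.zero_of_le_dist (by
        rw [Metric.mem_closedBall, not_le] at hs
        exact hs.le)
      simp only [g, h0, zero_smul]
    · exact ((integrable_indicator_iff measurableSet_Ioc).2
        (integrableOn_const (by simp))).locallyIntegrable
    · refine ContDiff.contDiffOn ?_
      change ContDiff ℝ ∞ fun q : E × ℝ ↦ ψ q.2 • fderiv ℝ F (a - q.2 • (q.1 - a))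
      refine (ψ.contDiff.comp contDiff_snd).smul (hF'.comp ?_)
      exact contDiff_const.sub (contDiff_snd.smul (contDiff_fst.sub contDiff_const))
  · simp [G]
  · have h1 : G y (y - a) = ∫ t in (0 : ℝ)..1, fderiv ℝ F (a + t • (y - a)) (y - a) :=
      ContinuousLinearMap.intervalIntegral_apply ((hline y).intervalIntegrable _ _) _
    have h2 : ∫ t in (0 : ℝ)..1, fderiv ℝ F (a + t • (y - a)) (y - a) =
        F (a + (1 : ℝ) • (y - a)) - F (a + (0 : ℝ) • (y - a)) := by
      refine intervalIntegral.integral_eq_sub_of_hasDerivAt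
        (f := fun t : ℝ ↦ F (a + t • (y - a))) (fun t _ ↦ ?_)
        (((hline y).clm_apply continuous_const).intervalIntegrable _ _)
      have h3 : HasDerivAt (fun t : ℝ ↦ a + t • (y - a)) (y - a) t := by
        simpa using ((hasDerivAt_id t).smul_const (y - a)).const_add a
      exact ((hF.differentiable (by simp)) _).hasFDerivAt.comp_hasDerivAt t h3
    rw [h1, h2]
    simp

end Hadamard

/-! ### Derivations on functions factor through the differential -/

section FunctionDerivations

variable {𝕂 : Type*} [RCLike 𝕂] {E : Type*} [NormedAddCommGroup E] [NormedSpace ℝ E]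
  [FiniteDimensional ℝ E] {M : Type*} [TopologicalSpace M] [T2Space M] [ChartedSpace E M]
  [IsManifold 𝓘(ℝ, E) ∞ M]

/-- A function with vanishing differential at `x` is, up to a constant and near `x`, a sum of
products of functions vanishing at `x`. -/
theorem exists_eventuallyEq_sum_mul {f : SmoothFun 𝕂 E M} {x : M} (hf : Form.at x (dFun f) = 0) :
    ∃ c h : Fin (Module.finrank ℝ E) → SmoothFun 𝕂 E M, (∀ i, c i x = 0) ∧ (∀ i, h i x = 0) ∧
      ∀ᶠ z in 𝓝 x, f z = f x + ∑ i, c i z * h i z := by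
  have hx := mem_extChartAt_source (I := 𝓘(ℝ, E)) x
  set a := extChartAt 𝓘(ℝ, E) x x with ha
  have hat : a ∈ (extChartAt 𝓘(ℝ, E) x).target := mem_extChartAt_target x
  -- Hadamard's lemma needs a function on all of `E`, so the coordinate expression of `f` is cut off
  -- on `E`, regarded as a manifold.
  obtain ⟨F, hF, -⟩ := exists_smoothFun_eventuallyEq (M := E) (E := E) (isOpen_target x) hat
    (SmoothFun.contDiffOn f x).contMDiffOn
  obtain ⟨G, hG, hGa, hFG⟩ := exists_eq_add_clm_sub F.contMDiff.contDiff a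
  have hG0 : G a = 0 := by
    refine ContinuousLinearMap.ext fun v ↦ ?_
    have h1 := at_dFun f hx (chartDInv x x v)
    rw [hf] at h1
    have h2 : chartD x x (chartDInv x x v) = v :=
      DFunLike.congr_fun (chartD_comp_chartDInv hx) v
    rw [h2, ← ha, ← Filter.EventuallyEq.fderiv_eq hF] at h1
    rw [hGa]
    exact h1.symm
  let b := Module.finBasis ℝ E
  -- In `F(y) = F(a) + G(y)(y - a)` the `c_i` are the coordinates of `y - a`, and the `h_i` below
  -- are the coefficients `G(y)(b_i)`, which vanish at `a` because `G(a)` is the differential.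
  choose c hc _ using fun i ↦ exists_smoothFun_chart (𝕂 := 𝕂) hx isOpen_univ (Set.mem_univ _)
    (F := fun y ↦ ((b.coord i (y - a) : ℝ) : 𝕂)) (ContDiff.contDiffOn
      ((RCLike.ofRealCLM (K := 𝕂)).contDiff.comp
        ((b.coord i).toContinuousLinearMap.contDiff.comp (contDiff_id.sub contDiff_const))))
  choose h hh _ using fun i ↦ exists_smoothFun_chart (𝕂 := 𝕂) hx isOpen_univ (Set.mem_univ _)
    (F := fun y ↦ G y (b i)) (hG.clm_apply contDiff_const).contDiffOn
  refine ⟨c, h, fun i ↦ ?_, fun i ↦ ?_, ?_⟩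
  · rw [(hc i).self_of_nhds, ← ha, sub_self, map_zero, RCLike.ofReal_zero]
  · rw [(hh i).self_of_nhds, ← ha, hG0]
    rfl
  · have hF' : ∀ᶠ z in 𝓝 x, F (extChartAt 𝓘(ℝ, E) x z) =
        f ((extChartAt 𝓘(ℝ, E) x).symm (extChartAt 𝓘(ℝ, E) x z)) :=
      (continuousAt_extChartAt (I := 𝓘(ℝ, E)) x).eventually hF
    filter_upwards [hF', Filter.eventually_all.2 hc, Filter.eventually_all.2 hh,
      (isOpen_extChartAt_source (I := 𝓘(ℝ, E)) x).mem_nhds hx] with z h1 h2 h3 h4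
    rw [(extChartAt 𝓘(ℝ, E) x).left_inv h4] at h1
    have h5 : F a = f x := by
      rw [hF.self_of_nhds, ha, extChartAt_to_inv]
    rw [← h1, hFG, h5]
    congr 1
    conv_lhs => rw [← b.sum_repr (extChartAt 𝓘(ℝ, E) x z - a), map_sum]
    refine Finset.sum_congr rfl fun i _ ↦ ?_
    rw [h2, h3, map_smul, RCLike.real_smul_eq_coe_mul]
    rfl

variable {r : ℕ} {δ : Form 𝕂 E M 0 →ₗ[𝕂] Form 𝕂 E M r}

theorem ofFun_constFn (c : 𝕂) :
    ofFun (constFn c : SmoothFun 𝕂 E M) = c • ofFun (1 : SmoothFun 𝕂 E M) :=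
  ofForm_injective 0 (by rw [map_smul]; exact fn_const c)

theorem ofFun_add (f g : SmoothFun 𝕂 E M) : ofFun (f + g) = ofFun f + ofFun g :=
  ofForm_injective 0 (by rw [map_add]; exact fn_add f g)

/-- A derivation kills constants, is local by means of a cutoff, and at `x` kills products of two
functions vanishing at `x`. By `exists_eventuallyEq_sum_mul`, a function with zero differential at
`x` consists of such terms near `x`. -/
theorem derivation_at_eq_zero
    (hδ : ∀ f g : SmoothFun 𝕂 E M, δ (ofFun (f * g)) = f • δ (ofFun g) + g • δ (ofFun f))
    {x : M} {σ : Form 𝕂 E M 0} (hσ : Form.at x (extD 0 σ) = 0) : Form.at x (δ σ) = 0 := by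
  have hmul (f g : SmoothFun 𝕂 E M) : Form.at x (δ (ofFun (f * g))) =
      f x • Form.at x (δ (ofFun g)) + g x • Form.at x (δ (ofFun f)) := by
    rw [hδ, map_add, Form.at_smul, Form.at_smul]
  have hone : δ (ofFun (1 : SmoothFun 𝕂 E M)) = 0 := by
    refine Form.ext fun y ↦ ?_
    have h1 : Form.at y (δ (ofFun (1 * 1 : SmoothFun 𝕂 E M))) =
        (1 : 𝕂) • Form.at y (δ (ofFun (1 : SmoothFun 𝕂 E M))) +
          (1 : 𝕂) • Form.at y (δ (ofFun (1 : SmoothFun 𝕂 E M))) := by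
      rw [hδ, map_add]
      rfl
    rw [mul_one, one_smul, left_eq_add] at h1
    exact h1
  have hloc (f : SmoothFun 𝕂 E M) (hf : ∀ᶠ z in 𝓝 x, f z = 0) : Form.at x (δ (ofFun f)) = 0 := by
    obtain ⟨χ, -, h1, h0⟩ := exists_bump_fun (𝕂 := 𝕂) (E := E) hf
    have h2 : χ * f = constFn 0 := by
      ext z
      change χ z * f z = 0
      by_cases hz : f z = 0
      · rw [hz, mul_zero]
      · rw [h0 z hz, zero_mul]
    have h3 := hmul χ f
    rw [h2, ofFun_constFn, map_smul, hone, smul_zero, map_zero, h1.self_of_nhds,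
      hf.self_of_nhds, one_smul] at h3
    have h4 : (0 : 𝕂) • Form.at x (δ (ofFun χ)) = 0 := zero_smul 𝕂 (Form.at x (δ (ofFun χ)))
    rw [h4, add_zero] at h3
    exact h3.symm
  obtain ⟨f, rfl⟩ := exists_eq_ofFun σ
  obtain ⟨c, h, hc, hh, hf⟩ := exists_eventuallyEq_sum_mul (f := f) hσ
  let F : SmoothFun 𝕂 E M := f + (constFn (-f x) + constFn (-1) * ∑ i, c i * h i)
  have hF : Form.at x (δ (ofFun F)) = 0 := by
    refine hloc F ?_
    filter_upwards [hf] with z hz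
    have hs : (∑ i, c i * h i : SmoothFun 𝕂 E M) z = ∑ i, c i z * h i z := by
      have h1 := map_sum (ContMDiffMap.coeFnAddMonoidHom (I := 𝓘(ℝ, E)) (N := M) (I' := 𝓘(ℝ, 𝕂))
        (n := ∞) (G := 𝕂)) (fun i ↦ c i * h i) Finset.univ
      exact (congrFun h1 z).trans (Finset.sum_apply z _ _)
    change f z + (-f x + -1 * (∑ i, c i * h i : SmoothFun 𝕂 E M) z) = 0
    rw [hs, hz]
    ring
  have hsum (S : Finset (Fin (Module.finrank ℝ E))) :
      Form.at x (δ (ofFun (∑ i ∈ S, c i * h i))) = 0 := by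
    classical
    induction S using Finset.induction_on with
    | empty =>
      rw [Finset.sum_empty]
      exact hloc 0 (Filter.Eventually.of_forall fun _ ↦ rfl)
    | insert i S hi ih =>
      rw [Finset.sum_insert hi, ofFun_add, map_add, map_add, ih, hmul, hc, hh, add_zero]
      have h4 (a : E [⋀^Fin r]→L[ℝ] 𝕂) : (0 : 𝕂) • a = 0 := zero_smul 𝕂 a
      rw [h4, h4, add_zero]
  have hneg (g : SmoothFun 𝕂 E M) : δ (ofFun (constFn (-1) * g)) = -δ (ofFun g) := by
    rw [← map_neg]
    congr 1
    refine ofForm_injective 0 ?_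
    rw [map_neg]
    change fn _ = - fn g
    rw [fn_mul, fn_const, neg_one_smul, neg_one_mul]
  simp only [F, ofFun_add, map_add, hneg, map_neg, hsum, ofFun_constFn, map_smul, hone, smul_zero,
    neg_zero, add_zero, map_zero] at hF
  exact hF

/-- A derivation on functions with values in forms factors through the differential. -/
theorem exists_tensor_of_derivation
    (hδ : ∀ f g : SmoothFun 𝕂 E M, δ (ofFun (f * g)) = f • δ (ofFun g) + g • δ (ofFun f)) :
    ∃ κ : Form 𝕂 E M 1 →ₗ[𝕂] Form 𝕂 E M r, IsTensor κ ∧ ∀ f, κ (dFun f) = δ (ofFun f) := by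
  have hL (x : M) : ∃ L : (E [⋀^Fin 1]→L[ℝ] 𝕂) →ₗ[𝕂] (E [⋀^Fin r]→L[ℝ] 𝕂),
      ∀ σ, L (Form.at x (extD 0 σ)) = Form.at x (δ σ) := by
    obtain ⟨s, hs⟩ := LinearMap.exists_rightInverse_of_surjective
      ((Form.at x : Form 𝕂 E M 1 →ₗ[𝕂] (E [⋀^Fin 1]→L[ℝ] 𝕂)) ∘ₗ extD 0)
      (LinearMap.range_eq_top.2 fun ξ ↦ (exists_dFun_at x ξ).imp' ofFun fun _ h ↦ h)
    refine ⟨Form.at x ∘ₗ δ ∘ₗ s, fun σ ↦ ?_⟩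
    change Form.at x (δ (s (Form.at x (extD 0 σ)))) = Form.at x (δ σ)
    rw [← sub_eq_zero, ← map_sub, ← map_sub]
    refine derivation_at_eq_zero hδ ?_
    have h1 : Form.at x (extD 0 (s (Form.at x (extD 0 σ)))) = Form.at x (extD 0 σ) :=
      LinearMap.congr_fun hs (Form.at x (extD 0 σ))
    rw [map_sub, map_sub, h1, sub_self]
  choose L hL using hL
  -- Where `α = ∑ v_i dg_i`, the field of values is `∑ v_i δ(g_i)`, hence smooth.
  have hmem (α : Form 𝕂 E M 1) : (fun x ↦ L x (Form.at x α)) ∈ Form 𝕂 E M r := by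
    refine mem_form_of_locally _ fun p ↦ ?_
    obtain ⟨χ, v, g, hχ, h1, -⟩ := exists_one_form_decomposition α p
    refine ⟨∑ i, v i • δ (ofFun (g i)), ?_⟩
    filter_upwards [hχ] with x hx
    have h2 : Form.at x α = ∑ i, v i x • Form.at x (dFun (g i)) := by
      have h3 := congrArg (Form.at x) h1
      rw [Form.at_smul, hx, one_smul, map_sum] at h3
      exact h3
    rw [h2, map_sum, map_sum]
    refine Finset.sum_congr rfl fun i _ ↦ ?_
    rw [map_smul, Form.at_smul]
    exact congrArg (fun a ↦ v i x • a) (hL x (ofFun (g i)))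
  refine ⟨{ toFun := fun α ↦ ⟨_, hmem α⟩
            map_add' := fun α β ↦ Form.ext fun x ↦ ?_
            map_smul' := fun c α ↦ Form.ext fun x ↦ ?_ }, ⟨fun f α ↦ Form.ext fun x ↦ ?_⟩,
    fun f ↦ Form.ext fun x ↦ hL x (ofFun f)⟩
  · change L x (Form.at x (α + β)) = L x (Form.at x α) + L x (Form.at x β)
    rw [map_add, map_add]
  · change L x (Form.at x (c • α)) = c • L x (Form.at x α)
    rw [map_smul, map_smul]
  · change L x (Form.at x (f • α)) = f x • L x (Form.at x α)
    rw [Form.at_smul, map_smul]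

end FunctionDerivations

end

end PoissonForms

namespace PoissonForms

noncomputable section

open DirectSum

/-! ### Extension of a contravariant connection to all forms and the bracket it defines -/

section Connections

variable {𝕂 : Type*} [RCLike 𝕂] {E : Type*} [NormedAddCommGroup E] [NormedSpace ℝ E]
  [FiniteDimensional ℝ E] {M : Type*} [TopologicalSpace M] [ChartedSpace E M]
  [IsManifold 𝓘(ℝ, E) ∞ M]

theorem HasDegree.ofForm_apply {n : ℕ} {s : Forms 𝕂 E M} (hs : HasDegree n s) :
    ofForm n (s n) = s := by
  obtain ⟨σ, rfl⟩ := hs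
  rw [show (ofForm n σ : Forms 𝕂 E M) n = σ from DirectSum.of_eq_same _ _]

/-- The component of a linear map on forms from degree `k` to degree `l`. -/
def degreePart (k l : ℕ) (δ : Forms 𝕂 E M →ₗ[𝕂] Forms 𝕂 E M) :
    Form 𝕂 E M k →ₗ[𝕂] Form 𝕂 E M l :=
  DirectSum.component 𝕂 ℕ (fun k ↦ Form 𝕂 E M k) l ∘ₗ δ ∘ₗ ofForm k

theorem ofForm_degreePart {k l : ℕ} {δ : Forms 𝕂 E M →ₗ[𝕂] Forms 𝕂 E M} {σ : Form 𝕂 E M k}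
    (h : HasDegree l (δ (ofForm k σ))) : ofForm l (degreePart k l δ σ) = δ (ofForm k σ) :=
  h.ofForm_apply

namespace Bivector

variable (π : Bivector 𝕂 E M)

theorem fn_pair_add_right (α β γ : Form 𝕂 E M 1) :
    fn (π.pair α (β + γ)) = fn (π.pair α β) + fn (π.pair α γ) := by
  rw [← fn_add]
  congr 1
  ext x
  exact map_add (π.toFun x (α.1 x)) (β.1 x) (γ.1 x)

theorem fn_pair_add_left (α β γ : Form 𝕂 E M 1) :
    fn (π.pair (α + β) γ) = fn (π.pair α γ) + fn (π.pair β γ) := by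
  rw [← fn_add]
  congr 1
  ext x
  exact LinearMap.map_add₂ (π.toFun x) (α.1 x) (β.1 x) (γ.1 x)

theorem fn_pair_smul_right (c : 𝕂) (α β : Form 𝕂 E M 1) :
    fn (π.pair α (c • β)) = c • fn (π.pair α β) := by
  rw [← one_mul (fn (π.pair α β)), ← smul_mul_assoc, ← fn_const, ← fn_mul]
  congr 1
  ext x
  exact map_smul (π.toFun x (α.1 x)) c (β.1 x)

theorem fn_pair_smul_left (c : 𝕂) (α β : Form 𝕂 E M 1) :
    fn (π.pair (c • α) β) = c • fn (π.pair α β) := by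
  rw [← one_mul (fn (π.pair α β)), ← smul_mul_assoc, ← fn_const, ← fn_mul]
  congr 1
  ext x
  exact LinearMap.map_smul₂ (π.toFun x) c (α.1 x) (β.1 x)

theorem pair_fun_smul_right (f : SmoothFun 𝕂 E M) (α β : Form 𝕂 E M 1) :
    π.pair α (f • β) = f * π.pair α β := by
  ext x
  exact map_smul (π.toFun x (α.1 x)) (f x) (β.1 x)

theorem pair_fun_smul_left (f : SmoothFun 𝕂 E M) (α β : Form 𝕂 E M 1) :
    π.pair (f • α) β = f * π.pair α β := by
  ext x
  exact LinearMap.map_smul₂ (π.toFun x) (f x) (α.1 x) (β.1 x)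

theorem fn_pair_antisymm (α β : Form 𝕂 E M 1) : fn (π.pair α β) = -fn (π.pair β α) := by
  rw [← neg_one_smul 𝕂 (fn (π.pair β α)), ← one_mul (fn (π.pair β α)), ← smul_mul_assoc,
    ← fn_const, ← fn_mul]
  congr 1
  ext x
  have h : (π.toFun x).IsAlt := π.alt x
  have h2 : π.toFun x (α.1 x) (β.1 x) = -π.toFun x (β.1 x) (α.1 x) := (h.neg _ _).symm
  have h3 : π.toFun x (α.1 x) (β.1 x) = -1 * π.toFun x (β.1 x) (α.1 x) := by
    rw [h2, neg_one_mul]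
  exact h3

/-- The contraction with the vector field `#α`, on one-forms. -/
def pairLeft (α : Form 𝕂 E M 1) : Form 𝕂 E M 1 →ₗ[𝕂] Form 𝕂 E M 0 where
  toFun β := ofFun (π.pair α β)
  map_add' β γ := ofForm_injective 0 (by
    rw [map_add]
    exact π.fn_pair_add_right α β γ)
  map_smul' c β := ofForm_injective 0 (by
    rw [map_smul]
    exact π.fn_pair_smul_right c α β)

end Bivector

variable [T2Space M] {π : Bivector 𝕂 E M}
  {D : Form 𝕂 E M 1 →ₗ[𝕂] Form 𝕂 E M 1 →ₗ[𝕂] Form 𝕂 E M 1}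

theorem Bivector.isTensor_pairLeft (α : Form 𝕂 E M 1) : IsTensor (π.pairLeft α) :=
  ⟨fun f β ↦ ofForm_injective 0 (by
    rw [← fn_mul_of]
    change fn (π.pair α (f • β)) = fn f * fn (π.pair α β)
    rw [π.pair_fun_smul_right, fn_mul])⟩

theorem isTensor_zero {r : ℕ} : IsTensor (0 : Form 𝕂 E M 1 →ₗ[𝕂] Form 𝕂 E M r) :=
  ⟨fun f α ↦ ofForm_injective r (by simp [← fn_mul_of])⟩

theorem IsTensor.smul {r : ℕ} {κ : Form 𝕂 E M 1 →ₗ[𝕂] Form 𝕂 E M r} (hκ : IsTensor κ) (c : 𝕂) :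
    IsTensor (c • κ) :=
  ⟨fun f α ↦ ofForm_injective r (by
    rw [← fn_mul_of, LinearMap.smul_apply, LinearMap.smul_apply, (ofForm r).map_smul,
      (ofForm r).map_smul, hκ.map_fun_smul, ← fn_mul_of, mul_smul_comm])⟩

/-- The extension of a contravariant derivative `D_α` to a derivation of the algebra of forms. -/
theorem exists_covariantDerivation (hD : IsContravariantConnection π D) (α : Form 𝕂 E M 1) :
    ∃ δ : Forms 𝕂 E M →ₗ[𝕂] Forms 𝕂 E M, IsDer 0 δ ∧ (∀ f, δ (fn f) = fn (π.anchor α f)) ∧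
      ∀ β, δ (ofForm 1 β) = ofForm 1 (D α β) := by
  -- This `δ` is the Lie derivative along `#α`. It has the required values on functions, so on
  -- one-forms it differs from `D α` by a tensor, whose algebraic derivation is then added.
  obtain ⟨δ, hδ, hδ0, hδ1⟩ := exists_derivation (π.isTensor_pairLeft α)
    (isTensor_zero (𝕂 := 𝕂) (E := E) (M := M) (r := 1))
  have hdeg (β : Form 𝕂 E M 1) : HasDegree 1 (δ (ofForm 1 β)) := by
    refine hδ.hasDegree (n := 0) (fun f ↦ ?_) (fun f ↦ ?_) β
    · rw [hδ0]
      exact hasDegree_of 0 _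
    · rw [hδ1]
      exact ((hasDegree_of 0 _).dForms.smul _).add (hasDegree_of 1 _)
  have hκ : IsTensor (D α - degreePart 1 1 δ) := ⟨fun f β ↦ ofForm_injective 1 (by
    rw [LinearMap.sub_apply, map_sub, ofForm_degreePart (hdeg _), ← fn_mul_of, hD.leibniz,
      map_add, ← fn_mul_of, ← fn_mul_of, LinearMap.sub_apply, ← fn_mul_of, map_sub, mul_sub,
      ofForm_degreePart (hdeg _), hδ.map_fn_mul, hδ0]
    change _ + fn (π.anchor α f) * _ - (fn (π.anchor α f) * _ + _) = _
    abel)⟩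
  obtain ⟨ι, hι, hι0, hι1⟩ := exists_algebraic_derivation hκ
  refine ⟨δ + ι, hδ.add hι.of_add_two, fun f ↦ ?_, fun β ↦ ?_⟩
  · rw [LinearMap.add_apply, hδ0, hι0, add_zero]
    rfl
  · rw [LinearMap.add_apply, hι1, LinearMap.sub_apply, map_sub, ofForm_degreePart (hdeg _),
      add_sub_cancel]

/-- The extension of a contravariant connection to all forms. -/
structure IsConnectionExtension (π : Bivector 𝕂 E M)
    (D : Form 𝕂 E M 1 →ₗ[𝕂] Form 𝕂 E M 1 →ₗ[𝕂] Form 𝕂 E M 1)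
    (N : Form 𝕂 E M 1 →ₗ[𝕂] Forms 𝕂 E M →ₗ[𝕂] Forms 𝕂 E M) : Prop where
  isDer : ∀ α, IsDer 0 (N α)
  map_fn : ∀ α f, N α (fn f) = fn (π.anchor α f)
  map_one : ∀ α β, N α (ofForm 1 β) = ofForm 1 (D α β)
  fun_smul : ∀ (f : SmoothFun 𝕂 E M) α s, N (f • α) s = fn f * N α s

/-- The extensions are chosen separately for each `α`; their linear and tensorial dependence on `α`
follows because derivations are determined on functions and exact forms. -/
theorem exists_connectionExtension (hD : IsContravariantConnection π D) :
    ∃ N, IsConnectionExtension π D N := by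
  choose N hN hN0 hN1 using exists_covariantDerivation hD
  have hd (α : Form 𝕂 E M 1) (f : SmoothFun 𝕂 E M) :
      N α (dForms (fn f)) = ofForm 1 (D α (dFun f)) := by rw [← ofForm_dFun, hN1]
  refine ⟨{ toFun := N, map_add' := fun α β ↦ ?_, map_smul' := fun c α ↦ ?_ }, hN, hN0, hN1,
    fun f α s ↦ ?_⟩
  · refine (hN _).ext ((hN α).add (hN β)) (fun f ↦ ?_) fun f ↦ ?_
    · rw [LinearMap.add_apply, hN0, hN0, hN0]
      exact π.fn_pair_add_left _ _ _
    · rw [LinearMap.add_apply, hd, hd, hd, map_add, LinearMap.add_apply, map_add]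
  · change N (c • α) = c • N α
    refine (hN _).ext ((hN α).smul c) (fun f ↦ ?_) fun f ↦ ?_
    · rw [LinearMap.smul_apply, hN0, hN0]
      exact π.fn_pair_smul_left _ _ _
    · rw [LinearMap.smul_apply, hd, hd, map_smul, LinearMap.smul_apply, map_smul]
  · have h := (hN (f • α)).ext ((hN α).mul_left (ofFun f)) (fun g ↦ ?_) fun g ↦ ?_
    · exact LinearMap.congr_fun h s
    · rw [LinearMap.comp_apply, LinearMap.mulLeft_apply, hN0, hN0]
      change _ = fn f * _
      rw [← fn_mul]
      exact congrArg fn (π.pair_fun_smul_left _ _ _)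
    · rw [LinearMap.comp_apply, LinearMap.mulLeft_apply, hd, hd, hD.smul_left]
      exact (fn_mul_of _ _).symm

/-- The graded bracket of forms defined by (the extension of) a contravariant connection. -/
structure IsBracketOf (N : Form 𝕂 E M 1 →ₗ[𝕂] Forms 𝕂 E M →ₗ[𝕂] Forms 𝕂 E M)
    (br : Forms 𝕂 E M →ₗ[𝕂] Forms 𝕂 E M →ₗ[𝕂] Forms 𝕂 E M) : Prop where
  isDer : ∀ {k} (σ : Form 𝕂 E M k), IsDer k (br (ofForm k σ))
  map_fn : ∀ {k} (σ : Form 𝕂 E M k) f, br (ofForm k σ) (fn f) = -N (dFun f) (ofForm k σ)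
  map_d_fn : ∀ {k} (σ : Form 𝕂 E M k) f, br (ofForm k σ) (dForms (fn f)) =
    -((-1 : 𝕂) ^ k • (dForms (N (dFun f) (ofForm k σ)) - N (dFun f) (dForms (ofForm k σ))))

namespace IsConnectionExtension

variable {N : Form 𝕂 E M 1 →ₗ[𝕂] Forms 𝕂 E M →ₗ[𝕂] Forms 𝕂 E M}

theorem hasDegree (h : IsConnectionExtension π D N) (α : Form 𝕂 E M 1) {k : ℕ} {s : Forms 𝕂 E M}
    (hs : HasDegree k s) : HasDegree k (N α s) := by
  obtain ⟨σ, rfl⟩ := hs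
  refine (h.isDer α).hasDegree (n := 0) (fun f ↦ ?_) (fun f ↦ ?_) σ
  · rw [h.map_fn]
    exact hasDegree_fn _
  · rw [← ofForm_dFun, h.map_one]
    exact hasDegree_of _ _

theorem exists_tensor (h : IsConnectionExtension π D N) {k : ℕ} (σ : Form 𝕂 E M k) :
    ∃ κ : Form 𝕂 E M 1 →ₗ[𝕂] Form 𝕂 E M k,
      IsTensor κ ∧ ∀ α, ofForm k (κ α) = N α (ofForm k σ) := by
  have hdeg α := h.hasDegree α (hasDegree_of k σ)
  let κ : Form 𝕂 E M 1 →ₗ[𝕂] Form 𝕂 E M k :=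
    DirectSum.component 𝕂 ℕ (fun k ↦ Form 𝕂 E M k) k ∘ₗ N.flip (ofForm k σ)
  have hκ (α) : ofForm k (κ α) = N α (ofForm k σ) := (hdeg α).ofForm_apply
  refine ⟨κ, ⟨fun f α ↦ ofForm_injective k ?_⟩, hκ⟩
  rw [hκ, ← fn_mul_of, hκ, h.fun_smul]

/-- The prescribed values are forced. Antisymmetry requires `{σ, f} = -D_{df} σ`, and `d{σ, f} =
{dσ, f} + (-1)^k {σ, df}` then determines `{σ, df}`. Since `D_{df} σ` and `D_{df} dσ` are tensors in
`df`, they can serve as the data of `exists_derivation`. -/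
theorem exists_ad (h : IsConnectionExtension π D N) {k : ℕ} (σ : Form 𝕂 E M k) :
    ∃ δ : Forms 𝕂 E M →ₗ[𝕂] Forms 𝕂 E M, IsDer k δ ∧
      (∀ f, δ (fn f) = -N (dFun f) (ofForm k σ)) ∧
      ∀ f, δ (dForms (fn f)) =
        -((-1 : 𝕂) ^ k • (dForms (N (dFun f) (ofForm k σ)) - N (dFun f) (dForms (ofForm k σ)))) := by
  obtain ⟨κ, hκ, hκ'⟩ := h.exists_tensor σ
  obtain ⟨μ, hμ, hμ'⟩ := h.exists_tensor (extD k σ)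
  obtain ⟨δ, hδ, hδ0, hδ1⟩ := exists_derivation (hκ.smul (-1)) (hμ.smul ((-1) ^ k))
  have e1 (f : SmoothFun 𝕂 E M) : ofForm k (((-1 : 𝕂) • κ) (dFun f)) =
      -N (dFun f) (ofForm k σ) := by
    rw [LinearMap.smul_apply, (ofForm k).map_smul, hκ', neg_one_smul]
  have e2 (f : SmoothFun 𝕂 E M) : ofForm (k + 1) (((-1 : 𝕂) ^ k • μ) (dFun f)) =
      (-1 : 𝕂) ^ k • N (dFun f) (dForms (ofForm k σ)) := by
    rw [LinearMap.smul_apply, (ofForm (k + 1)).map_smul, hμ', dForms_of]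
  refine ⟨δ, hδ, fun f ↦ ?_, fun f ↦ ?_⟩
  · rw [hδ0, e1]
  · rw [hδ1, e1, e2, map_neg, smul_neg, smul_sub]
    abel

theorem exists_bracket (h : IsConnectionExtension π D N) : ∃ br, IsBracketOf N br := by
  choose ad had had0 had1 using fun k (σ : Form 𝕂 E M k) ↦ h.exists_ad σ
  have hadd k (σ τ : Form 𝕂 E M k) : ad k (σ + τ) = ad k σ + ad k τ := by
    refine (had k _).ext ((had k σ).add (had k τ)) (fun f ↦ ?_) fun f ↦ ?_
    · rw [LinearMap.add_apply, had0, had0, had0, map_add, map_add, neg_add]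
    · rw [LinearMap.add_apply, had1, had1, had1]
      simp only [map_add, smul_sub, smul_add]
      abel
  have hsmul k (c : 𝕂) (σ : Form 𝕂 E M k) : ad k (c • σ) = c • ad k σ := by
    refine (had k _).ext ((had k σ).smul c) (fun f ↦ ?_) fun f ↦ ?_
    · rw [LinearMap.smul_apply, had0, had0, (ofForm k).map_smul, map_smul, smul_neg]
    · rw [LinearMap.smul_apply, had1, had1, smul_neg, smul_comm c, (ofForm k).map_smul, map_smul,
        map_smul, map_smul, map_smul, smul_sub c]
  let adL : ∀ k, Form 𝕂 E M k →ₗ[𝕂] Forms 𝕂 E M →ₗ[𝕂] Forms 𝕂 E M := fun k ↦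
    { toFun := ad k
      map_add' := hadd k
      map_smul' := hsmul k }
  have hbr {k : ℕ} (σ : Form 𝕂 E M k) : toModule 𝕂 ℕ _ adL (ofForm k σ) = ad k σ := by
    rw [toModule_lof]
    rfl
  refine ⟨toModule 𝕂 ℕ _ adL, fun σ ↦ ?_, fun σ f ↦ ?_, fun σ f ↦ ?_⟩
  · rw [hbr]
    exact had _ σ
  · rw [hbr, had0]
  · rw [hbr, had1]

end IsConnectionExtension

end Connections

end

end PoissonForms

namespace PoissonForms

noncomputable section

open DirectSum

/-! ### Compatibility with `d`, Leibniz rules and antisymmetry of the constructed bracket -/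

section Brackets

variable {𝕂 : Type*} [RCLike 𝕂] {E : Type*} [NormedAddCommGroup E] [NormedSpace ℝ E]
  [FiniteDimensional ℝ E] {M : Type*} [TopologicalSpace M] [T2Space M] [ChartedSpace E M]
  [IsManifold 𝓘(ℝ, E) ∞ M] {π : Bivector 𝕂 E M}
  {D : Form 𝕂 E M 1 →ₗ[𝕂] Form 𝕂 E M 1 →ₗ[𝕂] Form 𝕂 E M 1}
  {N : Form 𝕂 E M 1 →ₗ[𝕂] Forms 𝕂 E M →ₗ[𝕂] Forms 𝕂 E M}
  {br : Forms 𝕂 E M →ₗ[𝕂] Forms 𝕂 E M →ₗ[𝕂] Forms 𝕂 E M}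

theorem HasDegree.mul_comm {k l : ℕ} {s t : Forms 𝕂 E M} (hs : HasDegree k s)
    (ht : HasDegree l t) : s * t = (-1 : 𝕂) ^ (k * l) • (t * s) := by
  obtain ⟨τ, rfl⟩ := ht
  rw [mul_ofForm_comm, hs.formSign_pow_eq, mul_smul_comm, _root_.mul_comm l k]

theorem extD_dFun (f : SmoothFun 𝕂 E M) : extD 1 (dFun f) = 0 := extD_extD (ofFun f)

theorem Bivector.contract_zero (α : Form 𝕂 E M 1) : π.contract α 0 = 0 := by
  refine Form.ext fun x ↦ ?_
  ext v
  change π.toFun x 0 (α.1 x) = 0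
  rw [map_zero]
  rfl

theorem Bivector.koszul_dFun (f g : SmoothFun 𝕂 E M) :
    π.koszul (dFun f) (dFun g) = dFun (π.bracket f g) := by
  rw [Bivector.koszul, extD_dFun, extD_dFun, Bivector.contract_zero, Bivector.contract_zero,
    sub_self, zero_add]
  rfl

section Signs

variable {A : Type*} [Ring A] [Module 𝕂 A] [IsScalarTower 𝕂 A A] [SMulCommClass 𝕂 A A]

/-- Sign computations separated from the forms. Here and in the next two lemmas, `h` is graded
commutativity for the only pair of factors that has to be exchanged. -/
theorem leibniz_sign_even (k l : ℕ) (a b a' b' : A)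
    (h : b * a' = (-1 : 𝕂) ^ (l * k) • (a' * b)) :
    -(a' * b + a * b') = a * -b' + (-1 : 𝕂) ^ (k * l) • (b * -a') := by
  rw [mul_neg, mul_neg, h, smul_neg, mul_comm l k, neg_one_pow_smul_smul]
  abel

theorem leibniz_sign_odd (k l : ℕ) (a b a' b' : A)
    (h : b * a' = (-1 : 𝕂) ^ (l * (k + 1)) • (a' * b)) :
    -((-1 : 𝕂) ^ (k + l) • (a' * b + (-1 : 𝕂) ^ k • (a * b'))) =
      a * -((-1 : 𝕂) ^ l • b') + (-1 : 𝕂) ^ (k * l) • (b * -((-1 : 𝕂) ^ k • a')) := by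
  have e1 : (-1 : 𝕂) ^ (k * l + k + l * (k + 1)) = (-1) ^ (k + l) := by
    rw [show k * l + k + l * (k + 1) = 2 * (k * l) + (k + l) by ring, pow_add, pow_mul,
      neg_one_sq, one_pow, one_mul]
  have e2 : (-1 : 𝕂) ^ (k + l + k) = (-1) ^ l := by
    rw [show k + l + k = 2 * k + l by ring, pow_add, pow_mul, neg_one_sq, one_pow, one_mul]
  rw [mul_neg, mul_neg, mul_smul_comm, mul_smul_comm, h, smul_neg, smul_smul, smul_smul, smul_add,
    smul_smul, ← pow_add, ← pow_add, ← pow_add, e1, e2]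
  abel

theorem flip_sign_mul (k l m : ℕ) (a b x y : A)
    (h : b * x = (-1 : 𝕂) ^ (m * (k + l)) • (x * b)) :
    -((-1 : 𝕂) ^ (l * (k + m)) • (a * y + (-1 : 𝕂) ^ (k * m) • (b * x))) =
      -((-1 : 𝕂) ^ (l * k) • x) * b + ((-1 : 𝕂) ^ (l * k) • a) * -((-1 : 𝕂) ^ (l * m) • y) := by
  have e1 : (-1 : 𝕂) ^ (l * (k + m) + k * m + m * (k + l)) = (-1) ^ (l * k) := by
    rw [show l * (k + m) + k * m + m * (k + l) = 2 * (k * m + l * m) + l * k by ring, pow_add,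
      pow_mul, neg_one_sq, one_pow, one_mul]
  rw [h, smul_add, smul_smul, smul_smul, ← pow_add, ← pow_add, e1, neg_mul, mul_neg,
    smul_mul_assoc, smul_mul_assoc, mul_smul_comm, smul_smul, ← pow_add, mul_add]
  abel

theorem flip_sign_parity (k l : ℕ) (x : A) : (-1 : 𝕂) ^ k • -((-1 : 𝕂) ^ (l * k) • x) =
    (-1 : 𝕂) ^ l • -((-1 : 𝕂) ^ (l * k) • (-1 : 𝕂) ^ (k + l) • x) := by
  rw [smul_neg, smul_neg, smul_smul, smul_smul, smul_smul, ← pow_add, ← pow_add, ← pow_add,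
    show l + l * k + (k + l) = 2 * l + (k + l * k) by ring, pow_add _ (2 * l), pow_mul,
    neg_one_sq, one_pow, one_mul]

end Signs

namespace IsBracketOf

theorem hasDegree (hb : IsBracketOf N br) (hN : IsConnectionExtension π D N) {k l n : ℕ}
    (h : k + l = n) {s t : Forms 𝕂 E M} (hs : HasDegree k s) (ht : HasDegree l t) :
    HasDegree n (br s t) := by
  subst h
  obtain ⟨σ, rfl⟩ := hs
  obtain ⟨τ, rfl⟩ := ht
  rw [add_comm]
  refine (hb.isDer σ).hasDegree (fun f ↦ ?_) (fun f ↦ ?_) τ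
  · rw [hb.map_fn]
    exact (hN.hasDegree _ (hasDegree_of k σ)).neg
  · rw [hb.map_d_fn]
    exact (((hN.hasDegree _ (hasDegree_of k σ)).dForms.sub
      (hN.hasDegree _ (hasDegree_of k σ).dForms)).smul _).neg

/-- Both sides are derivations in `t` of the same parity. On functions the identity is the
prescription of `{σ, df}`; on exact one-forms it follows from `d² = 0`. -/
theorem map_dForms (hb : IsBracketOf N br) {k : ℕ} (σ : Form 𝕂 E M k) (t : Forms 𝕂 E M) :
    br (dForms (ofForm k σ)) t =
      dForms (br (ofForm k σ) t) - (-1 : 𝕂) ^ k • br (ofForm k σ) (dForms t) := by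
  have h1 := isDer_dForms.commutator (hb.isDer σ)
  have h2 : IsDer (1 + k) (br (ofForm (k + 1) (extD k σ))) :=
    (add_comm k 1) ▸ hb.isDer (extD k σ)
  have h3 := h2.ext h1 (fun f ↦ ?_) fun f ↦ ?_
  · rw [dForms_of, h3, LinearMap.sub_apply, LinearMap.smul_apply, LinearMap.comp_apply,
      LinearMap.comp_apply, one_mul]
  · rw [LinearMap.sub_apply, LinearMap.smul_apply, LinearMap.comp_apply,
      LinearMap.comp_apply, one_mul, hb.map_fn, hb.map_fn, hb.map_d_fn, smul_neg,
      neg_one_pow_smul_smul, map_neg, ← dForms_of]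
    abel
  · rw [LinearMap.sub_apply, LinearMap.smul_apply, LinearMap.comp_apply,
      LinearMap.comp_apply, dForms_dForms, map_zero, smul_zero, sub_zero, hb.map_d_fn, hb.map_d_fn,
      ← dForms_of, dForms_dForms, map_zero, map_neg, map_smul, map_sub, dForms_dForms, pow_succ]
    simp

/-- The commutator of the exterior derivative with a contravariant derivative. -/
theorem _root_.PoissonForms.IsConnectionExtension.commutator_mul
    (hN : IsConnectionExtension π D N) (α : Form 𝕂 E M 1) {k : ℕ} {s : Forms 𝕂 E M}
    (hs : HasDegree k s) (t : Forms 𝕂 E M) :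
    dForms (N α (s * t)) - N α (dForms (s * t)) =
      (dForms (N α s) - N α (dForms s)) * t +
        (-1 : 𝕂) ^ k • (s * (dForms (N α t) - N α (dForms t))) := by
  have h := (isDer_dForms.commutator (hN.isDer α)).map_mul s t
  rw [hs.formSign_pow_eq, smul_mul_assoc] at h
  simpa only [LinearMap.sub_apply, LinearMap.smul_apply, LinearMap.comp_apply, mul_zero, pow_zero,
    one_smul, add_zero, one_mul] using h

theorem isDer_of_hasDegree (hb : IsBracketOf N br) {k : ℕ} {s : Forms 𝕂 E M}
    (hs : HasDegree k s) : IsDer k (br s) := by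
  obtain ⟨σ, rfl⟩ := hs
  exact hb.isDer σ

theorem map_fn_of_hasDegree (hb : IsBracketOf N br) {k : ℕ} {s : Forms 𝕂 E M}
    (hs : HasDegree k s) (f : SmoothFun 𝕂 E M) : br s (fn f) = -N (dFun f) s := by
  obtain ⟨σ, rfl⟩ := hs
  exact hb.map_fn σ f

theorem map_d_fn_of_hasDegree (hb : IsBracketOf N br) {k : ℕ} {s : Forms 𝕂 E M}
    (hs : HasDegree k s) (f : SmoothFun 𝕂 E M) : br s (dForms (fn f)) =
      -((-1 : 𝕂) ^ k • (dForms (N (dFun f) s) - N (dFun f) (dForms s))) := by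
  obtain ⟨σ, rfl⟩ := hs
  exact hb.map_d_fn σ f

/-- Both sides are derivations in `r`. On functions the identity is the product rule for `N`; on
exact one-forms it is the product rule for the commutator of `d` with `N`. -/
theorem map_mul_left (hb : IsBracketOf N br) (hN : IsConnectionExtension π D N) {k l : ℕ}
    {s t : Forms 𝕂 E M} (hs : HasDegree k s) (ht : HasDegree l t) (r : Forms 𝕂 E M) :
    br (s * t) r = s * br t r + (-1 : 𝕂) ^ (k * l) • (t * br s r) := by
  have h1 : IsDer (k + l) (LinearMap.mulLeft 𝕂 s ∘ₗ br t) := by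
    obtain ⟨σ, rfl⟩ := hs
    exact (hb.isDer_of_hasDegree ht).mul_left σ
  have h2 : IsDer (k + l) (LinearMap.mulLeft 𝕂 t ∘ₗ br s) := by
    rw [add_comm]
    obtain ⟨τ, rfl⟩ := ht
    exact (hb.isDer_of_hasDegree hs).mul_left τ
  have h3 := hs.mul rfl ht
  refine LinearMap.congr_fun ((hb.isDer_of_hasDegree h3).ext
    (h1.add (h2.smul ((-1 : 𝕂) ^ (k * l)))) (fun f ↦ ?_) fun f ↦ ?_) r
  · change br (s * t) (fn f) = s * br t (fn f) + (-1 : 𝕂) ^ (k * l) • (t * br s (fn f))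
    rw [hb.map_fn_of_hasDegree h3, hb.map_fn_of_hasDegree hs, hb.map_fn_of_hasDegree ht,
      (hN.isDer _).map_mul, pow_zero]
    exact leibniz_sign_even k l _ _ _ _ (ht.mul_comm (hN.hasDegree _ hs))
  · change br (s * t) (dForms (fn f)) = s * br t (dForms (fn f)) +
      (-1 : 𝕂) ^ (k * l) • (t * br s (dForms (fn f)))
    rw [hb.map_d_fn_of_hasDegree h3, hb.map_d_fn_of_hasDegree hs, hb.map_d_fn_of_hasDegree ht,
      hN.commutator_mul _ hs]
    exact leibniz_sign_odd k l _ _ _ _ (ht.mul_comm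
      ((hN.hasDegree _ hs).dForms.sub (hN.hasDegree _ hs.dForms)))

/-- This is where vanishing torsion enters. On a function the claim is antisymmetry of `π`; on `df`
it reads `D_{dg} df = D_{df} dg - d{f, g}`, which is torsion zero on exact forms. -/
theorem map_fn_left (hb : IsBracketOf N br) (hN : IsConnectionExtension π D N)
    (ht : ∀ α β, torsion π D α β = 0) (g : SmoothFun 𝕂 E M) (t : Forms 𝕂 E M) :
    br (fn g) t = N (dFun g) t := by
  refine LinearMap.congr_fun ((hb.isDer (ofFun g)).ext (hN.isDer (dFun g)) (fun f ↦ ?_)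
    fun f ↦ ?_) t
  · change br (fn g) (fn f) = _
    rw [fn, hb.map_fn]
    change -N (dFun f) (fn g) = _
    rw [hN.map_fn, hN.map_fn]
    exact (π.fn_pair_antisymm _ _).symm
  · rw [hb.map_d_fn]
    change -((-1 : 𝕂) ^ 0 • (dForms (N (dFun f) (fn g)) - N (dFun f) (dForms (fn g)))) = _
    have h := ht (dFun f) (dFun g)
    rw [torsion, π.koszul_dFun, sub_eq_zero] at h
    have h' := congrArg (ofForm 1) h
    rw [map_sub, ofForm_dFun] at h'
    rw [hN.map_fn, ← ofForm_dFun g, ← ofForm_dFun f, hN.map_one, hN.map_one, pow_zero, one_smul]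
    change -(dForms (fn (π.bracket f g)) - _) = _
    rw [← h']
    abel

/-- The map `σ ↦ -(-1)^(k l) {σ, τ}` for a fixed form `τ` of degree `l`. -/
def flipBracket (br : Forms 𝕂 E M →ₗ[𝕂] Forms 𝕂 E M →ₗ[𝕂] Forms 𝕂 E M) {l : ℕ}
    (τ : Form 𝕂 E M l) : Forms 𝕂 E M →ₗ[𝕂] Forms 𝕂 E M :=
  -(br.flip (ofForm l τ) ∘ₗ (formSign ^ l))

theorem flipBracket_of {k l : ℕ} (σ : Form 𝕂 E M k) (τ : Form 𝕂 E M l) :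
    flipBracket br τ (ofForm k σ) = -((-1 : 𝕂) ^ (l * k) • br (ofForm k σ) (ofForm l τ)) := by
  change -(br ((formSign ^ l) (ofForm k σ))) (ofForm l τ) = _
  rw [formSign_pow_of, LinearMap.map_smul₂]

theorem flipBracket_of_hasDegree {k l : ℕ} {s : Forms 𝕂 E M} (hs : HasDegree k s)
    (τ : Form 𝕂 E M l) :
    flipBracket br τ s = -((-1 : 𝕂) ^ (l * k) • br s (ofForm l τ)) := by
  obtain ⟨σ, rfl⟩ := hs
  exact flipBracket_of σ τ

theorem isDer_flipBracket (hb : IsBracketOf N br) (hN : IsConnectionExtension π D N) {l : ℕ}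
    (τ : Form 𝕂 E M l) : IsDer l (flipBracket br τ) where
  map_mul s t := by
    refine Forms.bilin_ext (f := (LinearMap.mul 𝕂 (Forms 𝕂 E M)).compr₂ (flipBracket br τ))
      (g := (LinearMap.mul 𝕂 (Forms 𝕂 E M)) ∘ₗ flipBracket br τ +
        (LinearMap.mul 𝕂 (Forms 𝕂 E M)).compl₁₂ (formSign ^ l) (flipBracket br τ))
      (fun k m σ ρ ↦ ?_) s t
    change flipBracket br τ (ofForm k σ * ofForm m ρ) =
      flipBracket br τ (ofForm k σ) * ofForm m ρ +
        (formSign ^ l) (ofForm k σ) * flipBracket br τ (ofForm m ρ)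
    rw [flipBracket_of_hasDegree ((hasDegree_of k σ).mul rfl (hasDegree_of m ρ)), flipBracket_of,
      flipBracket_of, hb.map_mul_left hN (hasDegree_of k σ) (hasDegree_of m ρ), formSign_pow_of]
    exact flip_sign_mul k l m _ _ _ _ ((hasDegree_of m ρ).mul_comm
      (hb.hasDegree hN rfl (hasDegree_of k σ) (hasDegree_of l τ)))
  map_sign s := by
    refine LinearMap.congr_fun (f := flipBracket br τ ∘ₗ formSign)
      (g := (-1 : 𝕂) ^ l • formSign ∘ₗ flipBracket br τ) (Forms.linearMap_ext fun k σ ↦ ?_) s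
    change flipBracket br τ (formSign (ofForm k σ)) =
      (-1 : 𝕂) ^ l • formSign (flipBracket br τ (ofForm k σ))
    rw [formSign_of, map_smul, flipBracket_of, map_neg, map_smul,
      (hb.hasDegree hN rfl (hasDegree_of k σ) (hasDegree_of l τ)).formSign_eq]
    exact flip_sign_parity k l _

/-- The flipped bracket is a derivation by `map_mul_left`, so it is compared with `{τ, ·}` on
functions, by `map_fn_left`, and on exact one-forms, by compatibility with `d`. -/
theorem antisymm (hb : IsBracketOf N br) (hN : IsConnectionExtension π D N)
    (ht : ∀ α β, torsion π D α β = 0) {k l : ℕ} (σ : Form 𝕂 E M k) (τ : Form 𝕂 E M l) :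
    br (ofForm k σ) (ofForm l τ) = -((-1 : 𝕂) ^ (k * l) • br (ofForm l τ) (ofForm k σ)) := by
  have key : br (ofForm l τ) = flipBracket br τ := by
    refine (hb.isDer τ).ext (hb.isDer_flipBracket hN τ) (fun f ↦ ?_) fun f ↦ ?_
    · rw [hb.map_fn, fn, flipBracket_of, mul_zero, pow_zero, one_smul]
      exact congrArg Neg.neg (hb.map_fn_left hN ht f _).symm
    · have h := hb.map_dForms (ofFun f) (ofForm l τ)
      rw [pow_zero, one_smul] at h
      change br (dForms (fn f)) _ = dForms (br (fn f) _) - br (fn f) _ at h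
      rw [hb.map_fn_left hN ht, hb.map_fn_left hN ht] at h
      rw [hb.map_d_fn, ← ofForm_dFun, flipBracket_of, ofForm_dFun, h, mul_one]
  rw [key, flipBracket_of, smul_neg, mul_comm l k, neg_one_pow_smul_smul, neg_neg]

end IsBracketOf

end Brackets

end

end PoissonForms

namespace PoissonForms

noncomputable section

open DirectSum

/-! ### Permuting and differentiating the Jacobi identity -/

section AbstractJacobi

variable {𝕂 A : Type*} [Field 𝕂] [AddCommGroup A] [Module 𝕂 A] (br : A →ₗ[𝕂] A →ₗ[𝕂] A)

/-- The graded Jacobi identity for elements of degree `k`, `l` and an arbitrary element. -/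
def JacobiAt (k l : ℕ) (s t r : A) : Prop :=
  br (br s t) r = br s (br t r) - (-1 : 𝕂) ^ (k * l) • br t (br s r)

/-- Graded antisymmetry for elements of degree `k` and `l`. -/
def AntisymmAt (k l : ℕ) (s t : A) : Prop := br s t = -((-1 : 𝕂) ^ (k * l) • br t s)

variable {br}

/-- Together with `swap_right` this lets antisymmetry permute the three entries freely, so that any
of them can be brought into the last place, where the derivation property applies. -/
theorem JacobiAt.swap_left {k l : ℕ} {s t r : A} (h : JacobiAt br k l s t r)
    (hst : AntisymmAt br l k t s) : JacobiAt br l k t s r := by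
  unfold JacobiAt AntisymmAt at *
  rw [hst, map_neg, map_smul, LinearMap.neg_apply, LinearMap.smul_apply, h, mul_comm l k]
  rcases neg_one_pow_eq_or 𝕂 (k * l) with e | e <;> rw [e] <;> module

theorem JacobiAt.swap_right {k l m : ℕ} {s t r : A} (h : JacobiAt br k l s t r)
    (htr : AntisymmAt br l m t r) (h1 : AntisymmAt br (k + l) m (br s t) r)
    (h2 : AntisymmAt br (k + m) l (br s r) t) : JacobiAt br k m s r t := by
  unfold JacobiAt AntisymmAt at *
  rw [h1, htr, map_neg, map_smul] at h
  rw [h2]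
  rw [add_mul, pow_add] at h ⊢
  rw [mul_comm m l]
  generalize br r (br s t) = Z at *
  generalize br s (br r t) = X at *
  generalize br t (br s r) = Y at *
  rcases neg_one_pow_eq_or 𝕂 (k * l) with e1 | e1 <;>
  rcases neg_one_pow_eq_or 𝕂 (l * m) with e2 | e2 <;>
  rcases neg_one_pow_eq_or 𝕂 (k * m) with e3 | e3 <;> rw [e1, e2, e3] at h <;>
  rw [e1, e2, e3] <;>
  first
  | linear_combination (norm := module) (-1 : 𝕂) • h
  | linear_combination (norm := module) (1 : 𝕂) • h

/-- Apply `d` to the identity for `(h, s, r)` and remove the identities for `(h, s, dr)` and `(h,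
ds, r)`; what remains is the identity for `(dh, s, r)`. -/
theorem JacobiAt.d_left {d : A →ₗ[𝕂] A} {k : ℕ} {h s : A}
    (hd : ∀ r, br (d h) r = d (br h r) - br h (d r))
    (hds : ∀ r, br (d s) r = d (br s r) - (-1 : 𝕂) ^ k • br s (d r))
    (hdhs : ∀ r, br (d (br h s)) r = d (br (br h s) r) - (-1 : 𝕂) ^ k • br (br h s) (d r))
    (hJ : ∀ r, JacobiAt br 0 k h s r) (hJ' : ∀ r, JacobiAt br 0 (k + 1) h (d s) r) (r : A) :
    JacobiAt br 1 k (d h) s r := by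
  unfold JacobiAt at *
  simp only [zero_mul, pow_zero, one_smul] at hJ hJ'
  rw [one_mul, hd, hd, hd, map_sub, LinearMap.sub_apply, hdhs, hJ', hJ, hJ, hds, hds, map_sub,
    map_sub, map_sub, map_smul]
  module

theorem jacobiAt_of_sub_eq_zero {s t r : A} (h : 0 = br s (br t r) - br (br s t) r - br t (br s r)) :
    JacobiAt br 0 1 s t r := by
  rw [JacobiAt, zero_mul, pow_zero, one_smul]
  rw [eq_comm, sub_eq_zero] at h
  rw [← h]
  abel

end AbstractJacobi

/-! ### The Jacobi identity from Poisson, flatness and zero metacurvature -/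

section Jacobi

variable {𝕂 : Type*} [RCLike 𝕂] {E : Type*} [NormedAddCommGroup E] [NormedSpace ℝ E]
  [FiniteDimensional ℝ E] {M : Type*} [TopologicalSpace M] [T2Space M] [ChartedSpace E M]
  [IsManifold 𝓘(ℝ, E) ∞ M]
  {N : Form 𝕂 E M 1 →ₗ[𝕂] Forms 𝕂 E M →ₗ[𝕂] Forms 𝕂 E M}
  {br : Forms 𝕂 E M →ₗ[𝕂] Forms 𝕂 E M →ₗ[𝕂] Forms 𝕂 E M}

/-- The Jacobi identity holds if it holds for functions and exact one-forms in the last entry. -/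
theorem jacobiAt_of_exact {k l : ℕ} {s t : Forms 𝕂 E M} (hs : IsDer k (br s)) (ht : IsDer l (br t))
    (hst : IsDer (k + l) (br (br s t))) (h0 : ∀ f, JacobiAt br k l s t (fn f))
    (h1 : ∀ f, JacobiAt br k l s t (dForms (fn f))) (r : Forms 𝕂 E M) : JacobiAt br k l s t r :=
  LinearMap.congr_fun (hst.ext (hs.commutator ht) h0 h1) r

theorem fn_sub (f g : SmoothFun 𝕂 E M) : fn (f - g) = fn f - fn g := by
  rw [eq_sub_iff_add_eq, ← fn_add, sub_add_cancel]

theorem ofForm_wedge_one_one (β γ : Form 𝕂 E M 1) :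
    ofForm 2 (wedge 1 1 β γ) = ofForm 1 β * ofForm 1 γ := (ofForm_mul β γ).symm

theorem ofForm_extD_one (β : Form 𝕂 E M 1) : ofForm 2 (extD 1 β) = dForms (ofForm 1 β) :=
  (dForms_of β).symm

/-- The restriction of a connection on forms to two-forms. -/
def twoFormPart (N : Form 𝕂 E M 1 →ₗ[𝕂] Forms 𝕂 E M →ₗ[𝕂] Forms 𝕂 E M) :
    Form 𝕂 E M 1 →ₗ[𝕂] Form 𝕂 E M 2 →ₗ[𝕂] Form 𝕂 E M 2 :=
  (N.compr₂ (DirectSum.component 𝕂 ℕ (fun k ↦ Form 𝕂 E M k) 2)).compl₂ (ofForm 2)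

/-- The restriction of a bracket of forms to one-forms. -/
def oneFormPart (br : Forms 𝕂 E M →ₗ[𝕂] Forms 𝕂 E M →ₗ[𝕂] Forms 𝕂 E M) :
    Form 𝕂 E M 1 →ₗ[𝕂] Form 𝕂 E M 1 →ₗ[𝕂] Form 𝕂 E M 2 :=
  (br.compr₂ (DirectSum.component 𝕂 ℕ (fun k ↦ Form 𝕂 E M k) 2)).compl₁₂ (ofForm 1) (ofForm 1)

section Parts

variable {π : Bivector 𝕂 E M} {D : Form 𝕂 E M 1 →ₗ[𝕂] Form 𝕂 E M 1 →ₗ[𝕂] Form 𝕂 E M 1}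

namespace IsConnectionExtension

theorem ofForm_twoFormPart (hN : IsConnectionExtension π D N) (α : Form 𝕂 E M 1)
    (θ : Form 𝕂 E M 2) : ofForm 2 (twoFormPart N α θ) = N α (ofForm 2 θ) :=
  (hN.hasDegree α (hasDegree_of 2 θ)).ofForm_apply

theorem isTwoFormExtension (hN : IsConnectionExtension π D N) :
    IsTwoFormExtension π D (twoFormPart N) where
  isConnection :=
    { smul_left := fun f α σ ↦ ofForm_injective 2 (by
        rw [hN.ofForm_twoFormPart, hN.fun_smul, ← fn_mul_of, hN.ofForm_twoFormPart])
      leibniz := fun f α σ ↦ ofForm_injective 2 (by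
        rw [hN.ofForm_twoFormPart, ← fn_mul_of, (hN.isDer α).map_fn_mul, hN.map_fn, map_add,
          ← fn_mul_of, ← fn_mul_of, hN.ofForm_twoFormPart, add_comm]) }
  map_wedge α β γ := ofForm_injective 2 (by
    rw [hN.ofForm_twoFormPart, map_add, ofForm_wedge_one_one, ofForm_wedge_one_one,
      ofForm_wedge_one_one, (hN.isDer α).map_mul, hN.map_one, hN.map_one, pow_zero,
      Module.End.one_apply])

end IsConnectionExtension

namespace IsBracketOf

theorem ofForm_oneFormPart (hb : IsBracketOf N br) (hN : IsConnectionExtension π D N)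
    (α β : Form 𝕂 E M 1) : ofForm 2 (oneFormPart br α β) = br (ofForm 1 α) (ofForm 1 β) :=
  (hb.hasDegree hN rfl (hasDegree_of 1 α) (hasDegree_of 1 β)).ofForm_apply

theorem isOneFormBracket (hb : IsBracketOf N br) (hN : IsConnectionExtension π D N)
    (ht : ∀ α β, torsion π D α β = 0) : IsOneFormBracket D (twoFormPart N) (oneFormPart br) where
  product f α β := ofForm_injective 2 (by
    rw [map_add, hb.ofForm_oneFormPart hN, ← fn_mul_of, ← fn_mul_of, hb.ofForm_oneFormPart hN,
      ofForm_wedge_one_one, hb.map_mul_left hN (hasDegree_fn f) (hasDegree_of 1 α),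
      hb.map_fn_left hN ht, hN.map_one, zero_mul, pow_zero, one_smul])
  leibniz f α := ofForm_injective 2 (by
    have h := hb.map_dForms (ofFun f) (ofForm 1 α)
    change br (dForms (fn f)) _ = dForms (br (fn f) _) - (-1 : 𝕂) ^ 0 • br (fn f) _ at h
    rw [pow_zero, one_smul, hb.map_fn_left hN ht, hN.map_one, hb.map_fn_left hN ht] at h
    rw [map_add, ofForm_extD_one, hb.ofForm_oneFormPart hN, hN.ofForm_twoFormPart,
      ofForm_extD_one, ofForm_dFun, h, sub_add_cancel])

end IsBracketOf

end Parts

variable {c : FlatPoissonConnection 𝕂 E M}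

namespace IsBracketOf

theorem antisymmAt (hb : IsBracketOf N br) (hN : IsConnectionExtension c.π c.D N)
    {k l : ℕ} {s t : Forms 𝕂 E M} (hs : HasDegree k s) (ht : HasDegree l t) :
    AntisymmAt br k l s t := by
  obtain ⟨σ, rfl⟩ := hs
  obtain ⟨τ, rfl⟩ := ht
  exact hb.antisymm hN c.torsionFree σ τ

theorem jacobiAt_swap_left (hb : IsBracketOf N br) (hN : IsConnectionExtension c.π c.D N)
    {k l : ℕ} {s t r : Forms 𝕂 E M} (hs : HasDegree k s)
    (ht : HasDegree l t) (h : JacobiAt br k l s t r) : JacobiAt br l k t s r :=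
  h.swap_left (hb.antisymmAt hN ht hs)

theorem jacobiAt_swap_right (hb : IsBracketOf N br) (hN : IsConnectionExtension c.π c.D N)
    {k l m : ℕ} {s t r : Forms 𝕂 E M} (hs : HasDegree k s)
    (ht : HasDegree l t) (hr : HasDegree m r) (h : JacobiAt br k l s t r) :
    JacobiAt br k m s r t :=
  h.swap_right (hb.antisymmAt hN ht hr) (hb.antisymmAt hN (hb.hasDegree hN rfl hs ht) hr)
    (hb.antisymmAt hN (hb.hasDegree hN rfl hs hr) ht)

theorem jacobiAt_of_exact (hb : IsBracketOf N br) (hN : IsConnectionExtension c.π c.D N)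
    {k l : ℕ} {s t : Forms 𝕂 E M} (hs : HasDegree k s) (ht : HasDegree l t)
    (h0 : ∀ f, JacobiAt br k l s t (fn f)) (h1 : ∀ f, JacobiAt br k l s t (dForms (fn f)))
    (r : Forms 𝕂 E M) : JacobiAt br k l s t r :=
  PoissonForms.jacobiAt_of_exact (hb.isDer_of_hasDegree hs) (hb.isDer_of_hasDegree ht)
    (hb.isDer_of_hasDegree (hb.hasDegree hN rfl hs ht)) h0 h1 r

theorem bracket_fn (hb : IsBracketOf N br) (hN : IsConnectionExtension c.π c.D N)
    (f g : SmoothFun 𝕂 E M) : br (fn f) (fn g) = fn (c.π.bracket f g) := by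
  rw [hb.map_fn_left hN c.torsionFree, hN.map_fn]
  rfl

theorem bracket_fn_one (hb : IsBracketOf N br) (hN : IsConnectionExtension c.π c.D N)
    (f : SmoothFun 𝕂 E M) (α : Form 𝕂 E M 1) :
    br (fn f) (ofForm 1 α) = ofForm 1 (c.D (dFun f) α) := by
  rw [hb.map_fn_left hN c.torsionFree, hN.map_one]

/-- With a function in the last entry this is the Jacobi identity of `π`; with an exact one-form it
is flatness, since `[df, dg]_π = d{f, g}`. -/
theorem jacobiAt_fn_fn (hb : IsBracketOf N br) (hN : IsConnectionExtension c.π c.D N)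
    (f g : SmoothFun 𝕂 E M) (r : Forms 𝕂 E M) :
    JacobiAt br 0 0 (fn f) (fn g) r := by
  refine hb.jacobiAt_of_exact hN (hasDegree_fn f) (hasDegree_fn g) (fun h ↦ ?_) (fun h ↦ ?_) r
  · have hp := congrArg fn (c.isPoisson f g h)
    rw [JacobiAt, mul_zero, pow_zero, one_smul, hb.bracket_fn hN, hb.bracket_fn hN,
      hb.bracket_fn hN, hb.bracket_fn hN, hb.bracket_fn hN, hb.bracket_fn hN, hp, fn_sub]
  · have hp := congrArg (ofForm 1) (c.flat (dFun f) (dFun g) (dFun h))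
    rw [curvature, c.π.koszul_dFun, map_zero, map_sub, sub_eq_zero, map_sub] at hp
    rw [JacobiAt, mul_zero, pow_zero, one_smul, hb.bracket_fn hN, ← ofForm_dFun,
      hb.bracket_fn_one hN, hb.bracket_fn_one hN, hb.bracket_fn_one hN, hb.bracket_fn_one hN,
      hb.bracket_fn_one hN, hp]

/-- This is `M = 0`: the bracket of two one-forms is symmetric, so the last term `{{f, γ}, β}` of
the metacurvature is the Jacobi term `{β, {f, γ}}`. -/
theorem jacobiAt_fn_one_one (hb : IsBracketOf N br) (hN : IsConnectionExtension c.π c.D N)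
    (f : SmoothFun 𝕂 E M) (β γ : Form 𝕂 E M 1) :
    JacobiAt br 0 1 (fn f) (ofForm 1 β) (ofForm 1 γ) := by
  have h3 := c.metacurvature_eq_zero.apply_dFun _ _ hN.isTwoFormExtension
    (hb.isOneFormBracket hN c.torsionFree) f β γ
  rw [LinearMap.zero_apply, LinearMap.zero_apply, LinearMap.zero_apply] at h3
  have h4 := congrArg (ofForm 2) h3
  rw [map_zero, map_sub, map_sub, hN.ofForm_twoFormPart, hb.ofForm_oneFormPart hN, hb.ofForm_oneFormPart hN,
    hb.ofForm_oneFormPart hN, ← hb.map_fn_left hN c.torsionFree, ← hb.bracket_fn_one hN,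
    ← hb.bracket_fn_one hN] at h4
  have h5 : br (br (fn f) (ofForm 1 γ)) (ofForm 1 β) = br (ofForm 1 β) (br (fn f) (ofForm 1 γ)) := by
    rw [hb.bracket_fn_one hN]
    have := hb.antisymm hN c.torsionFree (c.D (dFun f) γ) β
    rwa [mul_one, pow_one, neg_one_smul, neg_neg] at this
  rw [h5] at h4
  exact jacobiAt_of_sub_eq_zero h4

/-- A function in the last entry is moved to the second, where `jacobiAt_fn_fn` applies; an exact
one-form is covered by the metacurvature. -/
theorem jacobiAt_fn_d_fn (hb : IsBracketOf N br) (hN : IsConnectionExtension c.π c.D N)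
    (f h : SmoothFun 𝕂 E M) (r : Forms 𝕂 E M) :
    JacobiAt br 0 1 (fn f) (dForms (fn h)) r := by
  refine hb.jacobiAt_of_exact hN (hasDegree_fn f) (hasDegree_fn h).dForms (fun g ↦ ?_)
    (fun g ↦ ?_) r
  · exact hb.jacobiAt_swap_right hN (hasDegree_fn f) (hasDegree_fn g) (hasDegree_fn h).dForms
      (hb.jacobiAt_fn_fn hN f g _)
  · rw [← ofForm_dFun, ← ofForm_dFun]
    exact hb.jacobiAt_fn_one_one hN f _ _

/-- The last entry may be taken to be `g` or `dg`. Exchanging it with `t` leaves the arbitrary form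
last, where the two preceding results allow anything. -/
theorem jacobiAt_fn (hb : IsBracketOf N br) (hN : IsConnectionExtension c.π c.D N)
    (f : SmoothFun 𝕂 E M) {l : ℕ} {t : Forms 𝕂 E M} (ht : HasDegree l t)
    (r : Forms 𝕂 E M) : JacobiAt br 0 l (fn f) t r := by
  refine hb.jacobiAt_of_exact hN (hasDegree_fn f) ht (fun g ↦ ?_) (fun g ↦ ?_) r
  · exact hb.jacobiAt_swap_right hN (hasDegree_fn f) (hasDegree_fn g) ht
      (hb.jacobiAt_fn_fn hN f g t)
  · exact hb.jacobiAt_swap_right hN (hasDegree_fn f) (hasDegree_fn g).dForms ht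
      (hb.jacobiAt_fn_d_fn hN f g t)

theorem map_dForms_of_hasDegree (hb : IsBracketOf N br)
    {k : ℕ} {s : Forms 𝕂 E M} (hs : HasDegree k s)
    (t : Forms 𝕂 E M) : br (dForms s) t = dForms (br s t) - (-1 : 𝕂) ^ k • br s (dForms t) := by
  obtain ⟨σ, rfl⟩ := hs
  exact hb.map_dForms σ t

/-- Obtained from `jacobiAt_fn` by applying `d`, so the case of three exact one-forms requires no
further hypothesis. -/
theorem jacobiAt_d_fn (hb : IsBracketOf N br) (hN : IsConnectionExtension c.π c.D N)
    (f : SmoothFun 𝕂 E M) {k : ℕ} {s : Forms 𝕂 E M} (hs : HasDegree k s)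
    (r : Forms 𝕂 E M) : JacobiAt br 1 k (dForms (fn f)) s r := by
  have hd (r : Forms 𝕂 E M) : br (dForms (fn f)) r = dForms (br (fn f) r) - br (fn f) (dForms r) := by
    rw [hb.map_dForms_of_hasDegree (hasDegree_fn f), pow_zero, one_smul]
  exact JacobiAt.d_left hd (hb.map_dForms_of_hasDegree hs)
    (hb.map_dForms_of_hasDegree (hb.hasDegree hN (zero_add k) (hasDegree_fn f) hs))
    (hb.jacobiAt_fn hN f hs) (hb.jacobiAt_fn hN f hs.dForms) r

/-- Two exchanges bring the last entry `g` or `dg` to the front, where the identity is known for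
arbitrary second and third entries. -/
theorem jacobiAt (hb : IsBracketOf N br) (hN : IsConnectionExtension c.π c.D N)
    {k l : ℕ} {s t : Forms 𝕂 E M} (hs : HasDegree k s) (ht : HasDegree l t)
    (r : Forms 𝕂 E M) : JacobiAt br k l s t r := by
  refine hb.jacobiAt_of_exact hN hs ht (fun g ↦ ?_) (fun g ↦ ?_) r
  · exact hb.jacobiAt_swap_right hN hs (hasDegree_fn g) ht
      (hb.jacobiAt_swap_left hN (hasDegree_fn g) hs (hb.jacobiAt_fn hN g hs t))
  · exact hb.jacobiAt_swap_right hN hs (hasDegree_fn g).dForms ht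
      (hb.jacobiAt_swap_left hN (hasDegree_fn g).dForms hs (hb.jacobiAt_d_fn hN g hs t))

end IsBracketOf

theorem dgPoisson_of_bracket
    (h_degree : ∀ k l (σ : Form 𝕂 E M k) (ρ : Form 𝕂 E M l),
      HasDegree (k + l) (br (ofForm k σ) (ofForm l ρ)))
    (h_antisymm : ∀ k l (σ : Form 𝕂 E M k) (ρ : Form 𝕂 E M l),
      AntisymmAt br k l (ofForm k σ) (ofForm l ρ))
    (h_jacobi : ∀ k l (σ : Form 𝕂 E M k) (ρ : Form 𝕂 E M l) t,
      JacobiAt br k l (ofForm k σ) (ofForm l ρ) t)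
    (h_d : ∀ k (σ : Form 𝕂 E M k) t, br (dForms (ofForm k σ)) t =
      dForms (br (ofForm k σ) t) - (-1 : 𝕂) ^ k • br (ofForm k σ) (dForms t))
    (h_der : ∀ k (σ : Form 𝕂 E M k), IsDer k (br (ofForm k σ))) :
    IsDGPoissonAlgebra (R := 𝕂) (Ω := fun k ↦ Form 𝕂 E M k) dForms wedgeForms br where
  d_degree k σ := (hasDegree_of k σ).dForms
  d_d := dForms_dForms
  mul_degree k l σ ρ := (hasDegree_of k σ).mul rfl (hasDegree_of l ρ)
  mul_assoc s r t := mul_assoc s r t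
  mul_comm k l σ ρ := (hasDegree_of k σ).mul_comm (hasDegree_of l ρ)
  br_degree := h_degree
  br_antisymm := h_antisymm
  br_jacobi := h_jacobi
  d_mul k σ r := by
    have h := dForms_mul (ofForm k σ) r
    rw [formSign_of, smul_mul_assoc] at h
    exact h
  d_br k σ r := by
    have h := h_d k σ r
    rw [eq_sub_iff_add_eq] at h
    exact h.symm
  br_mul k l σ ρ t := by
    have h := (h_der k σ).map_mul (ofForm l ρ) t
    rw [formSign_pow_of, smul_mul_assoc] at h
    exact h

theorem FlatPoissonConnection.exists_bracket (c : FlatPoissonConnection 𝕂 E M) :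
    ∃ b : GeneralizedPoissonBracket 𝕂 E M,
      (∀ f g, b.1 (fn f) (fn g) = fn (c.π.bracket f g)) ∧
      ∀ f α, b.1 (fn f) (ofForm 1 α) = ofForm 1 (c.D (dFun f) α) := by
  obtain ⟨N, hN⟩ := exists_connectionExtension c.isConnection
  obtain ⟨br, hb⟩ := hN.exists_bracket
  exact ⟨⟨br, dgPoisson_of_bracket
    (fun k l σ ρ ↦ hb.hasDegree hN rfl (hasDegree_of k σ) (hasDegree_of l ρ))
    (fun k l σ ρ ↦ hb.antisymm hN c.torsionFree σ ρ)
    (fun k l σ ρ t ↦ hb.jacobiAt hN (hasDegree_of k σ) (hasDegree_of l ρ) t)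
    (fun k σ t ↦ hb.map_dForms σ t) fun k σ ↦ hb.isDer σ⟩, hb.bracket_fn hN, hb.bracket_fn_one hN⟩

end Jacobi

end

end PoissonForms

namespace PoissonForms

noncomputable section

open DirectSum

/-! ### Bivectors from tensors, and the tensorial behaviour of the Koszul bracket -/

section Tensorial

variable {𝕂 : Type*} [RCLike 𝕂] {E : Type*} [NormedAddCommGroup E] [NormedSpace ℝ E]
  [FiniteDimensional ℝ E] {M : Type*} [TopologicalSpace M] [T2Space M] [ChartedSpace E M]
  [IsManifold 𝓘(ℝ, E) ∞ M]

/-- Additive maps from one-forms to forms that are linear over functions. -/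
structure IsTensorial (F : Form 𝕂 E M 1 → Forms 𝕂 E M) : Prop where
  map_add : ∀ α β, F (α + β) = F α + F β
  map_smul : ∀ (f : SmoothFun 𝕂 E M) α, F (f • α) = fn f * F α

namespace IsTensorial

variable {F : Form 𝕂 E M 1 → Forms 𝕂 E M}

theorem map_sum (h : IsTensorial F) {n : ℕ} (v g : Fin n → SmoothFun 𝕂 E M) :
    F (∑ i, v i • dFun (g i)) = ∑ i, fn (v i) * F (dFun (g i)) := by
  have h0 : F 0 = 0 := by
    have := h.map_add 0 0
    rwa [add_zero, left_eq_add] at this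
  let F' : Form 𝕂 E M 1 →+ Forms 𝕂 E M := ⟨⟨F, h0⟩, h.map_add⟩
  have h1 : F (∑ i, v i • dFun (g i)) = ∑ i, F (v i • dFun (g i)) := _root_.map_sum F' _ _
  rw [h1]
  exact Finset.sum_congr rfl fun i _ ↦ h.map_smul _ _

theorem eq_zero (h : IsTensorial F) (hd : ∀ g, F (dFun g) = 0) (α : Form 𝕂 E M 1) : F α = 0 := by
  refine eq_zero_of_local fun p ↦ ?_
  obtain ⟨χ, v, g, hχ, h1, -⟩ := exists_one_form_decomposition α p
  refine ⟨χ, hχ.self_of_nhds, ?_⟩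
  rw [← h.map_smul, h1, h.map_sum]
  exact Finset.sum_eq_zero fun i _ ↦ by rw [hd, mul_zero]

theorem isReal (h : IsTensorial F) (hd : ∀ g, IsRealElt (fn g) → IsRealElt (F (dFun g)))
    {α : Form 𝕂 E M 1} (hα : IsRealForm α) : IsRealElt (F α) := by
  refine isRealElt_of_local fun p ↦ ?_
  obtain ⟨χ, v, g, hχ, h1, -, hg, hv, -⟩ := exists_one_form_decomposition α p
  refine ⟨χ, hχ.self_of_nhds, ?_⟩
  rw [← h.map_smul, h1, h.map_sum]
  exact IsRealElt.sum _ fun i _ ↦ (hv hα i).mul (hd _ (hg i))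

end IsTensorial

namespace Bivector

theorem ext {π π' : Bivector 𝕂 E M} (h : ∀ f g, π.bracket f g = π'.bracket f g) : π = π' := by
  have h1 : π.toFun = π'.toFun := by
    funext x
    refine LinearMap.ext fun ξ ↦ LinearMap.ext fun η ↦ ?_
    obtain ⟨f, hf⟩ := exists_dFun_at (𝕂 := 𝕂) (E := E) x ξ
    obtain ⟨g, hg⟩ := exists_dFun_at (𝕂 := 𝕂) (E := E) x η
    have h2 : π.toFun x (Form.at (E := E) x (dFun f)) (Form.at (E := E) x (dFun g)) =
        π'.toFun x (Form.at (E := E) x (dFun f)) (Form.at (E := E) x (dFun g)) := congrArg (fun k ↦ k x) (h f g)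
    rw [hf, hg] at h2
    exact h2
  cases π
  cases π'
  cases h1
  rfl

/-- An alternating bilinear map on one-forms that is linear over functions is given by a bivector
field. -/
theorem exists_of_tensor (T : Form 𝕂 E M 1 →ₗ[𝕂] Form 𝕂 E M 1 →ₗ[𝕂] Form 𝕂 E M 0)
    (h1 : ∀ α, IsTensor (T α)) (h2 : ∀ β, IsTensor (T.flip β))
    (halt : ∀ f, T (dFun f) (dFun f) = 0) :
    ∃ π : Bivector 𝕂 E M, ∀ α β, ofFun (π.pair α β) = T α β := by
  have hs (x : M) := LinearMap.exists_rightInverse_of_surjective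
    (Form.at x : Form 𝕂 E M 1 →ₗ[𝕂] (E [⋀^Fin 1]→L[ℝ] 𝕂))
    (LinearMap.range_eq_top.2 fun ξ ↦ (exists_dFun_at x ξ).imp' dFun fun _ h ↦ h)
  choose s hs using hs
  let ev : (E [⋀^Fin 0]→L[ℝ] 𝕂) →ₗ[𝕂] 𝕂 :=
    { toFun := fun a ↦ a ![]
      map_add' := fun _ _ ↦ rfl
      map_smul' := fun _ _ ↦ rfl }
  let P : ∀ x : M, (E [⋀^Fin 1]→L[ℝ] 𝕂) →ₗ[𝕂] (E [⋀^Fin 1]→L[ℝ] 𝕂) →ₗ[𝕂] 𝕂 := fun x ↦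
    (T.compr₂ (ev ∘ₗ Form.at x)).compl₁₂ (s x) (s x)
  have hP (x : M) (α β : Form 𝕂 E M 1) :
      P x (Form.at x α) (Form.at x β) = ev (Form.at x (T α β)) := by
    change ev (Form.at x (T (s x (Form.at x α)) (s x (Form.at x β)))) = _
    have e (α : Form 𝕂 E M 1) : Form.at x (s x (Form.at x α)) = Form.at x α :=
      LinearMap.congr_fun (hs x) (Form.at x α)
    rw [(h1 _).at_congr (e β)]
    exact congrArg ev ((h2 β).at_congr (e α))
  refine ⟨⟨P, fun x ξ ↦ ?_, fun p ξ η y hy ↦ ?_⟩, fun α β ↦ ?_⟩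
  · obtain ⟨f, hf⟩ := exists_dFun_at (𝕂 := 𝕂) (E := E) x ξ
    have h3 := hP x (dFun f) (dFun f)
    rw [halt, _root_.map_zero, _root_.map_zero, hf] at h3
    exact h3
  -- Constant covectors in the chart are locally the differentials of functions `f` and `g`, so the
  -- component is locally the smooth function `T(df, dg)`.
  · have hx := (extChartAt 𝓘(ℝ, E) p).map_target hy
    obtain ⟨f, hf, -⟩ := exists_dFun_eq_pull (M := M) ξ hx
    obtain ⟨g, hg, -⟩ := exists_dFun_eq_pull (M := M) η hx
    obtain ⟨F, hF⟩ := exists_eq_ofFun (T (dFun f) (dFun g))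
    refine ContDiffAt.contDiffWithinAt ?_
    refine ((SmoothFun.contDiffOn F p).contDiffAt
      ((isOpen_target p).mem_nhds hy)).congr_of_eventuallyEq ?_
    have hc : ContinuousAt (extChartAt 𝓘(ℝ, E) p).symm y := continuousAt_extChartAt_symm'' hy
    filter_upwards [hc.eventually hf, hc.eventually hg] with z h3 h4
    change P ((extChartAt 𝓘(ℝ, E) p).symm z)
      (pullAlt (chartD p ((extChartAt 𝓘(ℝ, E) p).symm z)) ξ)
      (pullAlt (chartD p ((extChartAt 𝓘(ℝ, E) p).symm z)) η) = _
    rw [← h3, ← h4, hP, hF]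
    rfl
  · refine Form.ext fun x ↦ ?_
    ext v
    change P x (Form.at x α) (Form.at x β) = Form.at x (T α β) v
    rw [hP]
    exact congrArg (Form.at x (T α β)) (Subsingleton.elim (α := Fin 0 → E) _ _)

variable (π : Bivector 𝕂 E M)

theorem contract_add_right (α : Form 𝕂 E M 1) (θ θ' : Form 𝕂 E M 2) :
    π.contract α (θ + θ') = π.contract α θ + π.contract α θ' := by
  refine Form.ext fun x ↦ ContinuousAlternatingMap.ext fun v ↦ ?_
  exact LinearMap.map_add₂ (π.toFun x) ((Form.at (E := E) x θ).curryLeft (v 0))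
    ((Form.at (E := E) x θ').curryLeft (v 0)) (Form.at (E := E) x α)

theorem contract_fun_smul_right (f : SmoothFun 𝕂 E M) (α : Form 𝕂 E M 1) (θ : Form 𝕂 E M 2) :
    π.contract α (f • θ) = f • π.contract α θ := by
  refine Form.ext fun x ↦ ContinuousAlternatingMap.ext fun v ↦ ?_
  exact LinearMap.map_smul₂ (π.toFun x) (f x) ((Form.at (E := E) x θ).curryLeft (v 0)) (Form.at (E := E) x α)

theorem contract_add_left (α β : Form 𝕂 E M 1) (θ : Form 𝕂 E M 2) :
    π.contract (α + β) θ = π.contract α θ + π.contract β θ := by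
  refine Form.ext fun x ↦ ContinuousAlternatingMap.ext fun v ↦ ?_
  exact _root_.map_add (π.toFun x ((Form.at (E := E) x θ).curryLeft (v 0))) (Form.at (E := E) x α) (Form.at (E := E) x β)

theorem contract_fun_smul_left (f : SmoothFun 𝕂 E M) (α : Form 𝕂 E M 1) (θ : Form 𝕂 E M 2) :
    π.contract (f • α) θ = f • π.contract α θ := by
  refine Form.ext fun x ↦ ContinuousAlternatingMap.ext fun v ↦ ?_
  exact _root_.map_smul (π.toFun x ((Form.at (E := E) x θ).curryLeft (v 0))) (f x) (Form.at (E := E) x α)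

theorem curryLeft_altWedge_one_one (a b : E [⋀^Fin 1]→L[ℝ] 𝕂) (v : E) :
    (altWedge a b).curryLeft v = a ![v] • b - b ![v] • a := by
  have h := ins_mul v (altOf 1 a) (altOf 1 b)
  rw [AltAlg.mul_of, ins_succ, ins_one, ins_one, altSign_of, pow_one, neg_one_smul,
    smul_mul_assoc, one_mul, neg_mul, mul_smul_comm, mul_one, ← sub_eq_add_neg, ← map_smul,
    ← map_smul, ← map_sub] at h
  exact altOf_injective 1 h

theorem contract_altWedge_apply (P : (E [⋀^Fin 1]→L[ℝ] 𝕂) →ₗ[𝕂] (E [⋀^Fin 1]→L[ℝ] 𝕂) →ₗ[𝕂] 𝕂)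
    (a c b : E [⋀^Fin 1]→L[ℝ] 𝕂) (v : Fin 1 → E) :
    P ((altWedge a c).curryLeft (v 0)) b = P c b * a v - P a b * c v := by
  have hv : ![v 0] = v := by
    funext i
    rw [Subsingleton.elim i 0]
    rfl
  rw [curryLeft_altWedge_one_one, LinearMap.map_sub₂, LinearMap.map_smul₂, LinearMap.map_smul₂, hv,
    smul_eq_mul, smul_eq_mul, mul_comm, mul_comm (c v)]

theorem contract_wedge (β α γ : Form 𝕂 E M 1) :
    π.contract β (wedge 1 1 α γ) = π.pair γ β • α - π.pair α β • γ := by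
  refine Form.ext fun x ↦ ContinuousAlternatingMap.ext fun v ↦ ?_
  exact contract_altWedge_apply (E := E) (π.toFun x) (Form.at (E := E) x α) (Form.at (E := E) x γ)
    (Form.at (E := E) x β) v

theorem ofForm_koszul_antisymm (α β : Form 𝕂 E M 1) :
    ofForm 1 (π.koszul α β) = -ofForm 1 (π.koszul β α) := by
  rw [koszul, koszul, map_add, map_add, ofForm_dFun, ofForm_dFun, π.fn_pair_antisymm α β, map_sub,
    map_sub, _root_.map_neg]
  abel

theorem ofForm_koszul_add_left (α β γ : Form 𝕂 E M 1) :
    ofForm 1 (π.koszul (α + β) γ) = ofForm 1 (π.koszul α γ) + ofForm 1 (π.koszul β γ) := by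
  rw [koszul, koszul, koszul, contract_add_left, _root_.map_add (extD 1), contract_add_right]
  simp only [_root_.map_add, map_sub, ofForm_dFun, fn_pair_add_left]
  abel

theorem extD_fun_smul (f : SmoothFun 𝕂 E M) (α : Form 𝕂 E M 1) :
    extD 1 (f • α) = wedge 1 1 (dFun f) α + f • extD 1 α := by
  refine ofForm_injective 2 ?_
  rw [ofForm_extD_one, ← fn_mul_of, dForms_mul, formSign_fn, _root_.map_add, ofForm_wedge_one_one,
    ofForm_dFun, ← fn_mul_of, ofForm_extD_one]

/-- The term `π(α, β) df` from `d(f π(α, β))` cancels the one from `ι_{#β}(df ∧ α)`; only the term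
with the anchor survives. -/
theorem ofForm_koszul_fun_smul_left (f : SmoothFun 𝕂 E M) (α β : Form 𝕂 E M 1) :
    ofForm 1 (π.koszul (f • α) β) =
      fn f * ofForm 1 (π.koszul α β) - fn (π.anchor β f) * ofForm 1 α := by
  rw [koszul, koszul, contract_fun_smul_left, extD_fun_smul, contract_add_right,
    contract_wedge, contract_fun_smul_right, pair_fun_smul_left]
  simp only [_root_.map_add, map_sub, ofForm_dFun, fn_mul, dForms_mul, ← fn_mul_of, formSign_fn,
    mul_add, mul_sub]
  have h : fn (π.anchor β f) = -fn (π.pair (dFun f) β) := π.fn_pair_antisymm _ _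
  rw [h, mul_fn_comm, neg_mul]
  abel

end Bivector

end Tensorial

end

end PoissonForms

namespace PoissonForms

noncomputable section

open DirectSum

/-! ### Comparing tensorial maps on exact forms -/

section TensorialMaps

variable {𝕂 : Type*} [RCLike 𝕂] {E : Type*} [NormedAddCommGroup E] [NormedSpace ℝ E]
  [FiniteDimensional ℝ E] {M : Type*} [TopologicalSpace M] [T2Space M] [ChartedSpace E M]
  [IsManifold 𝓘(ℝ, E) ∞ M]

namespace IsTensorial

variable {F G : Form 𝕂 E M 1 → Forms 𝕂 E M}

theorem add (hF : IsTensorial F) (hG : IsTensorial G) : IsTensorial fun α ↦ F α + G α where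
  map_add α β := by
    rw [hF.map_add, hG.map_add]
    abel
  map_smul f α := by rw [hF.map_smul, hG.map_smul, mul_add]

theorem sub (hF : IsTensorial F) (hG : IsTensorial G) : IsTensorial fun α ↦ F α - G α where
  map_add α β := by
    rw [hF.map_add, hG.map_add]
    abel
  map_smul f α := by rw [hF.map_smul, hG.map_smul, mul_sub]

theorem mul_right (hF : IsTensorial F) (t : Forms 𝕂 E M) : IsTensorial fun α ↦ F α * t where
  map_add α β := by rw [hF.map_add, add_mul]
  map_smul f α := by rw [hF.map_smul, mul_assoc]

theorem const_smul (hF : IsTensorial F) (c : 𝕂) : IsTensorial fun α ↦ c • F α where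
  map_add α β := by rw [hF.map_add, smul_add]
  map_smul f α := by rw [hF.map_smul, mul_smul_comm]

theorem ext (hF : IsTensorial F) (hG : IsTensorial G) (hd : ∀ g, F (dFun g) = G (dFun g))
    (α : Form 𝕂 E M 1) : F α = G α :=
  sub_eq_zero.1 ((hF.sub hG).eq_zero (fun g ↦ sub_eq_zero.2 (hd g)) α)

/-- Tensoriality is needed in one argument only, since antisymmetry transfers it to the other. This
is applied to torsion and curvature. -/
theorem eq_zero_of_antisymm {F : Form 𝕂 E M 1 → Form 𝕂 E M 1 → Forms 𝕂 E M}
    (h : ∀ β, IsTensorial (F · β)) (ha : ∀ α β, F α β = -F β α)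
    (hd : ∀ f g, F (dFun f) (dFun g) = 0) (α β : Form 𝕂 E M 1) : F α β = 0 := by
  refine (h β).eq_zero (fun g ↦ ?_) α
  rw [ha, neg_eq_zero]
  exact (h (dFun g)).eq_zero (fun f ↦ hd f g) β

end IsTensorial

theorem IsTensor.isTensorial {r : ℕ} {κ : Form 𝕂 E M 1 →ₗ[𝕂] Form 𝕂 E M r} (h : IsTensor κ) :
    IsTensorial fun α ↦ ofForm r (κ α) where
  map_add α β := by rw [map_add, map_add]
  map_smul f α := by rw [h.map_fun_smul, ← fn_mul_of]

theorem Bivector.isTensorial_pair (π : Bivector 𝕂 E M) (β : Form 𝕂 E M 1) :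
    IsTensorial fun α ↦ fn (π.pair α β) where
  map_add α γ := π.fn_pair_add_left α γ β
  map_smul f α := by rw [π.pair_fun_smul_left, fn_mul]

/-- A family of derivations of functions, depending linearly on a parameter, defines a family of
tensors. -/
theorem exists_tensor_family {V : Type*} [AddCommGroup V] [Module 𝕂 V] {r : ℕ}
    (δ : V →ₗ[𝕂] Form 𝕂 E M 0 →ₗ[𝕂] Form 𝕂 E M r)
    (hδ : ∀ v (f g : SmoothFun 𝕂 E M),
      δ v (ofFun (f * g)) = f • δ v (ofFun g) + g • δ v (ofFun f)) :
    ∃ κ : V →ₗ[𝕂] Form 𝕂 E M 1 →ₗ[𝕂] Form 𝕂 E M r,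
      (∀ v, IsTensor (κ v)) ∧ ∀ v f, κ v (dFun f) = δ v (ofFun f) := by
  choose κ hκ hκd using fun v ↦ exists_tensor_of_derivation (hδ v)
  refine ⟨{ toFun := κ, map_add' := fun v w ↦ ?_, map_smul' := fun c v ↦ ?_ }, hκ, hκd⟩
  · refine LinearMap.ext fun α ↦ ofForm_injective r ?_
    rw [LinearMap.add_apply, map_add]
    exact (hκ (v + w)).isTensorial.ext ((hκ v).isTensorial.add (hκ w).isTensorial)
      (fun g ↦ by rw [hκd, hκd, hκd, map_add, LinearMap.add_apply, map_add]) α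
  · refine LinearMap.ext fun α ↦ ofForm_injective r ?_
    rw [RingHom.id_apply, LinearMap.smul_apply, (ofForm r).map_smul]
    exact (hκ (c • v)).isTensorial.ext ((hκ v).isTensorial.const_smul c)
      (fun g ↦ by rw [hκd, hκd, map_smul, LinearMap.smul_apply, (ofForm r).map_smul]) α

end TensorialMaps

/-! ### The bivector and the connection extracted from a bracket -/

section GradedBracket

variable {𝕂 : Type*} [RCLike 𝕂] {E : Type*} [NormedAddCommGroup E] [NormedSpace ℝ E]
  [FiniteDimensional ℝ E] {M : Type*} [TopologicalSpace M] [ChartedSpace E M]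
  [IsManifold 𝓘(ℝ, E) ∞ M]

/-- The properties of a generalized Poisson bracket in terms of graded derivations. -/
structure IsGradedBracket (br : Forms 𝕂 E M →ₗ[𝕂] Forms 𝕂 E M →ₗ[𝕂] Forms 𝕂 E M) : Prop where
  hasDegree : ∀ {k l : ℕ} {s t : Forms 𝕂 E M}, HasDegree k s → HasDegree l t →
    HasDegree (k + l) (br s t)
  isDer : ∀ {k : ℕ} {s : Forms 𝕂 E M}, HasDegree k s → IsDer k (br s)
  antisymm : ∀ {k l : ℕ} {s t : Forms 𝕂 E M}, HasDegree k s → HasDegree l t →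
    AntisymmAt br k l s t
  jacobi : ∀ {k l : ℕ} {s t : Forms 𝕂 E M} (r : Forms 𝕂 E M), HasDegree k s → HasDegree l t →
    JacobiAt br k l s t r
  map_dForms : ∀ {k : ℕ} {s : Forms 𝕂 E M} (r : Forms 𝕂 E M), HasDegree k s →
    dForms (br s r) = br (dForms s) r + (-1 : 𝕂) ^ k • br s (dForms r)

theorem GeneralizedPoissonBracket.isGradedBracket (b : GeneralizedPoissonBracket 𝕂 E M) :
    IsGradedBracket b.1 := by
  have hdeg {k l : ℕ} {s t : Forms 𝕂 E M} (hs : HasDegree k s) (ht : HasDegree l t) :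
      HasDegree (k + l) (b.1 s t) := by
    obtain ⟨σ, rfl⟩ := hs
    obtain ⟨τ, rfl⟩ := ht
    exact b.2.br_degree k l σ τ
  refine ⟨hdeg, fun {k s} hs ↦ ⟨fun u t ↦ ?_, fun u ↦ ?_⟩, ?_, ?_, ?_⟩
  · obtain ⟨σ, rfl⟩ := hs
    refine LinearMap.congr_fun (f := b.1 (ofForm k σ) ∘ₗ LinearMap.mulRight 𝕂 t)
      (g := LinearMap.mulRight 𝕂 t ∘ₗ b.1 (ofForm k σ) +
        LinearMap.mulRight 𝕂 (b.1 (ofForm k σ) t) ∘ₗ (formSign ^ k))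
      (Forms.linearMap_ext fun l ρ ↦ ?_) u
    have h := b.2.br_mul k l σ ρ t
    change b.1 (ofForm k σ) (ofForm l ρ * t) = b.1 (ofForm k σ) (ofForm l ρ) * t +
      (formSign ^ k) (ofForm l ρ) * b.1 (ofForm k σ) t
    rw [formSign_pow_of, smul_mul_assoc]
    exact h
  · refine LinearMap.congr_fun (f := b.1 s ∘ₗ formSign) (g := (-1 : 𝕂) ^ k • formSign ∘ₗ b.1 s)
      (Forms.linearMap_ext fun l ρ ↦ ?_) u
    change b.1 s (formSign (ofForm l ρ)) = (-1 : 𝕂) ^ k • formSign (b.1 s (ofForm l ρ))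
    rw [formSign_of, map_smul, (hdeg hs (hasDegree_of l ρ)).formSign_eq, pow_add, mul_smul,
      neg_one_pow_smul_smul]
  · rintro k l _ _ ⟨σ, rfl⟩ ⟨τ, rfl⟩
    exact b.2.br_antisymm k l σ τ
  · rintro k l _ _ r ⟨σ, rfl⟩ ⟨τ, rfl⟩
    exact b.2.br_jacobi k l σ τ r
  · rintro k _ r ⟨σ, rfl⟩
    exact b.2.d_br k σ r

namespace IsGradedBracket

variable {br : Forms 𝕂 E M →ₗ[𝕂] Forms 𝕂 E M →ₗ[𝕂] Forms 𝕂 E M}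

theorem fn_left (hb : IsGradedBracket br) (f : SmoothFun 𝕂 E M) {k : ℕ} {s : Forms 𝕂 E M}
    (hs : HasDegree k s) : br (fn f) s = -br s (fn f) := by
  have h := hb.antisymm (hasDegree_fn f) hs
  rwa [AntisymmAt, zero_mul, pow_zero, one_smul] at h

theorem antisymm_one (hb : IsGradedBracket br) {s t : Forms 𝕂 E M} (hs : HasDegree 1 s)
    (ht : HasDegree 1 t) : br s t = br t s := by
  have h := hb.antisymm hs ht
  rwa [AntisymmAt, mul_one, pow_one, neg_one_smul, neg_neg] at h

theorem map_dForms_fn (hb : IsGradedBracket br) (f : SmoothFun 𝕂 E M) (r : Forms 𝕂 E M) :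
    dForms (br (fn f) r) = br (dForms (fn f)) r + br (fn f) (dForms r) := by
  have h := hb.map_dForms r (hasDegree_fn f)
  rwa [pow_zero, one_smul] at h

theorem fn_mul_fn_left (hb : IsGradedBracket br) (f g : SmoothFun 𝕂 E M) {k : ℕ}
    {s : Forms 𝕂 E M} (hs : HasDegree k s) :
    br (fn (f * g)) s = fn f * br (fn g) s + fn g * br (fn f) s := by
  rw [hb.fn_left _ hs, hb.fn_left _ hs, hb.fn_left _ hs, fn_mul, (hb.isDer hs).map_fn_mul,
    mul_fn_comm, mul_neg, mul_neg]
  abel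

variable [T2Space M]

theorem fn_mul_one_left (hb : IsGradedBracket br) (f : SmoothFun 𝕂 E M) {s t : Forms 𝕂 E M}
    (hs : HasDegree 1 s) (ht : HasDegree 1 t) :
    br (fn f * s) t = fn f * br s t + s * br (fn f) t := by
  have h := hs.mul_comm (hb.hasDegree (hasDegree_fn f) ht)
  rw [zero_add, mul_one, pow_one, neg_one_smul] at h
  rw [hb.antisymm_one ((hasDegree_fn f).mul (zero_add 1) hs) ht, (hb.isDer ht).map_fn_mul,
    hb.antisymm_one ht hs, h, hb.fn_left f ht, neg_mul, neg_neg, add_comm]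

/-- For fixed `β` the map `f ↦ {f, β}` is a derivation on functions, so it factors through `df`; the
resulting tensor is `α ↦ D_α β`. -/
theorem exists_connection (hb : IsGradedBracket br) :
    ∃ D : Form 𝕂 E M 1 →ₗ[𝕂] Form 𝕂 E M 1 →ₗ[𝕂] Form 𝕂 E M 1,
      (∀ β, IsTensor (D.flip β)) ∧
      ∀ f β, br (fn f) (ofForm 1 β) = ofForm 1 (D (dFun f) β) := by
  let δ : Form 𝕂 E M 1 →ₗ[𝕂] Form 𝕂 E M 0 →ₗ[𝕂] Form 𝕂 E M 1 :=
    ((br.flip.compl₁₂ (ofForm 1) (ofForm 0)).compr₂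
      (DirectSum.component 𝕂 ℕ (fun k ↦ Form 𝕂 E M k) 1))
  have hδ (β : Form 𝕂 E M 1) (f : SmoothFun 𝕂 E M) :
      ofForm 1 (δ β (ofFun f)) = br (fn f) (ofForm 1 β) :=
    (hb.hasDegree (hasDegree_fn f) (hasDegree_of 1 β)).ofForm_apply
  obtain ⟨κ, hκ, hκd⟩ := exists_tensor_family δ fun β f g ↦ ofForm_injective 1 (by
    rw [map_add, hδ, hb.fn_mul_fn_left f g (hasDegree_of 1 β), ← fn_mul_of, ← fn_mul_of, hδ, hδ])
  refine ⟨κ.flip, fun β ↦ hκ β, fun f β ↦ ?_⟩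
  rw [← hδ, ← hκd]
  rfl

theorem exists_bivector (hb : IsGradedBracket br) :
    ∃ π : Bivector 𝕂 E M, ∀ f g, br (fn f) (fn g) = fn (π.bracket f g) := by
  let δ : Form 𝕂 E M 0 →ₗ[𝕂] Form 𝕂 E M 0 →ₗ[𝕂] Form 𝕂 E M 0 :=
    ((br.flip.compl₁₂ (ofForm 0) (ofForm 0)).compr₂
      (DirectSum.component 𝕂 ℕ (fun k ↦ Form 𝕂 E M k) 0))
  have hδ (f g : SmoothFun 𝕂 E M) :
      ofForm 0 (δ (ofFun g) (ofFun f)) = br (fn f) (fn g) :=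
    (hb.hasDegree (hasDegree_fn f) (hasDegree_fn g)).ofForm_apply
  obtain ⟨κ, hκ, hκd⟩ := exists_tensor_family δ fun σ f g ↦ ofForm_injective 0 (by
    obtain ⟨h, rfl⟩ := exists_eq_ofFun σ
    rw [map_add, hδ, hb.fn_mul_fn_left f g (hasDegree_fn h), ← fn_mul_of, ← fn_mul_of, hδ, hδ])
  have hκd' (f g : SmoothFun 𝕂 E M) : ofForm 0 (κ (ofFun g) (dFun f)) = br (fn f) (fn g) := by
    rw [hκd, hδ]
  -- The bracket now depends on the first function only through its differential. The same
  -- factorization in the second argument yields a bilinear map of one-forms.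
  obtain ⟨T, hT, hTd⟩ := exists_tensor_family κ.flip fun α f g ↦ ofForm_injective 0 (by
    rw [map_add, ← fn_mul_of, ← fn_mul_of, ← mul_fn_comm f, ← mul_fn_comm g]
    refine (hκ (ofFun (f * g))).isTensorial.ext
      (((hκ (ofFun g)).isTensorial.mul_right (fn f)).add
        ((hκ (ofFun f)).isTensorial.mul_right (fn g))) (fun h ↦ ?_) α
    rw [hκd', hκd', hκd', fn_mul, (hb.isDer (hasDegree_fn h)).map_fn_mul, ← mul_fn_comm, mul_fn_comm g]
    abel)
  have hTd' (f g : SmoothFun 𝕂 E M) : ofForm 0 (T (dFun f) (dFun g)) = br (fn f) (fn g) := by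
    rw [hTd, ← hκd']
    rfl
  have hT' (β : Form 𝕂 E M 1) : IsTensor (T.flip β) := ⟨fun f α ↦ ofForm_injective 0 (by
    rw [← fn_mul_of, ← mul_fn_comm]
    refine (hT (f • α)).isTensorial.ext ((hT α).isTensorial.mul_right (fn f)) (fun g ↦ ?_) β
    rw [hTd, hTd, mul_fn_comm, fn_mul_of]
    exact congrArg (ofForm 0) ((hκ (ofFun g)).map_fun_smul f α))⟩
  obtain ⟨π, hπ⟩ := Bivector.exists_of_tensor T hT hT' fun f ↦ ofForm_injective 0 (by
    rw [hTd', map_zero]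
    have h := hb.fn_left f (hasDegree_fn f)
    rwa [eq_neg_iff_add_eq_zero, ← two_smul 𝕂, smul_eq_zero, or_iff_right two_ne_zero] at h)
  refine ⟨π, fun f g ↦ ?_⟩
  rw [← hTd', ← hπ]
  rfl

end IsGradedBracket

end GradedBracket

end

end PoissonForms

namespace PoissonForms

noncomputable section

open DirectSum

/-! ### The bracket axioms give a flat, torsion-free connection with zero metacurvature -/

section ConnectionOfBracket

variable {𝕂 : Type*} [RCLike 𝕂] {E : Type*} [NormedAddCommGroup E] [NormedSpace ℝ E]
  [FiniteDimensional ℝ E] {M : Type*} [TopologicalSpace M] [T2Space M] [ChartedSpace E M]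
  [IsManifold 𝓘(ℝ, E) ∞ M]

namespace Bivector

variable (π : Bivector 𝕂 E M)

theorem koszul_antisymm (α β : Form 𝕂 E M 1) : π.koszul α β = -π.koszul β α :=
  ofForm_injective 1 (by rw [map_neg, ofForm_koszul_antisymm])

theorem koszul_add_left (α β γ : Form 𝕂 E M 1) :
    π.koszul (α + β) γ = π.koszul α γ + π.koszul β γ :=
  ofForm_injective 1 (by rw [map_add, ofForm_koszul_add_left])

theorem koszul_fun_smul_left (f : SmoothFun 𝕂 E M) (α β : Form 𝕂 E M 1) :
    π.koszul (f • α) β = f • π.koszul α β - π.anchor β f • α :=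
  ofForm_injective 1 (by rw [map_sub, ← fn_mul_of, ← fn_mul_of, ofForm_koszul_fun_smul_left])

end Bivector

/-- The bracket `br` restricts to the bracket of `π` on functions and to the connection `D` on pairs
of a function and a one-form. -/
structure IsRestriction (br : Forms 𝕂 E M →ₗ[𝕂] Forms 𝕂 E M →ₗ[𝕂] Forms 𝕂 E M)
    (π : Bivector 𝕂 E M) (D : Form 𝕂 E M 1 →ₗ[𝕂] Form 𝕂 E M 1 →ₗ[𝕂] Form 𝕂 E M 1) : Prop where
  isTensor : ∀ β, IsTensor (D.flip β)
  bracket_fn : ∀ f g, br (fn f) (fn g) = fn (π.bracket f g)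
  bracket_one : ∀ f β, br (fn f) (ofForm 1 β) = ofForm 1 (D (dFun f) β)

namespace IsRestriction

variable {br : Forms 𝕂 E M →ₗ[𝕂] Forms 𝕂 E M →ₗ[𝕂] Forms 𝕂 E M} {π : Bivector 𝕂 E M}
  {D : Form 𝕂 E M 1 →ₗ[𝕂] Form 𝕂 E M 1 →ₗ[𝕂] Form 𝕂 E M 1}

theorem isTensorial (h : IsRestriction br π D) (β : Form 𝕂 E M 1) :
    IsTensorial fun α ↦ ofForm 1 (D α β) := (h.isTensor β).isTensorial

theorem isPoisson (h : IsRestriction br π D) (hb : IsGradedBracket br) : π.IsPoisson := by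
  intro f g k
  refine fn_injective ?_
  rw [fn_sub, ← h.bracket_fn, ← h.bracket_fn, ← h.bracket_fn, ← h.bracket_fn, ← h.bracket_fn,
    ← h.bracket_fn]
  have hJ := hb.jacobi (fn k) (hasDegree_fn f) (hasDegree_fn g)
  rwa [JacobiAt, mul_zero, pow_zero, one_smul] at hJ

/-- Both sides of the Leibniz rule are tensors in `α`. On `α = dg` the rule is the derivation
property of `{g, ·}`. -/
theorem isConnection (h : IsRestriction br π D) (hb : IsGradedBracket br) :
    IsContravariantConnection π D where
  smul_left f α β := (h.isTensor β).map_fun_smul f α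
  leibniz f α β := ofForm_injective 1 (by
    rw [map_add, ← fn_mul_of, ← fn_mul_of, ← mul_fn_comm]
    refine (h.isTensorial (f • β)).ext (((h.isTensorial β).mul_right (fn f)).add
      ((π.isTensorial_pair (dFun f)).mul_right (ofForm 1 β))) (fun g ↦ ?_) α
    rw [← h.bracket_one, ← h.bracket_one, ← fn_mul_of, (hb.isDer (hasDegree_fn g)).map_fn_mul,
      h.bracket_fn, mul_fn_comm, add_comm]
    rfl)

/-- The torsion is tensorial and antisymmetric, and on `df`, `dg` its vanishing is `d{f, g} = {df,
g} + {f, dg}`. -/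
theorem torsionFree (h : IsRestriction br π D) (hb : IsGradedBracket br) (α β : Form 𝕂 E M 1) :
    torsion π D α β = 0 := by
  have hD := h.isConnection hb
  refine ofForm_injective 1 ((IsTensorial.eq_zero_of_antisymm
    (F := fun α β ↦ ofForm 1 (torsion π D α β)) (fun β ↦ ⟨fun α γ ↦ ?_, fun f α ↦ ?_⟩)
    (fun α β ↦ ?_) (fun f g ↦ ?_) α β).trans (map_zero _).symm)
  · simp only [torsion, map_add, map_sub, LinearMap.add_apply, π.koszul_add_left]
    abel
  · simp only [torsion, hD.smul_left, hD.leibniz, π.koszul_fun_smul_left, map_add, map_sub,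
      ← fn_mul_of, mul_sub]
    abel
  · simp only [torsion, map_sub, map_neg, π.koszul_antisymm α β]
    abel
  · have h1 := hb.map_dForms_fn f (fn g)
    rw [h.bracket_fn, ← neg_neg (br (dForms (fn f)) (fn g)),
      ← hb.fn_left g (hasDegree_fn f).dForms, ← ofForm_dFun f, ← ofForm_dFun g, h.bracket_one,
      h.bracket_one, ← ofForm_dFun] at h1
    simp only [torsion, map_sub, π.koszul_dFun]
    rw [h1]
    abel

/-- The curvature is tensorial and antisymmetric in `α`, `β`; on exact forms its vanishing is the
Jacobi identity for two functions and `γ`. Tensoriality in `γ` is not needed. -/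
theorem flat (h : IsRestriction br π D) (hb : IsGradedBracket br) (α β γ : Form 𝕂 E M 1) :
    curvature π D α β γ = 0 := by
  have hD := h.isConnection hb
  refine ofForm_injective 1 ((IsTensorial.eq_zero_of_antisymm
    (F := fun α β ↦ ofForm 1 (curvature π D α β γ)) (fun β ↦ ⟨fun α α' ↦ ?_, fun f α ↦ ?_⟩)
    (fun α β ↦ ?_) (fun f g ↦ ?_) α β).trans (map_zero _).symm)
  · simp only [curvature, map_add, map_sub, LinearMap.add_apply, π.koszul_add_left]
    abel
  · simp only [curvature, hD.smul_left, hD.leibniz, π.koszul_fun_smul_left, map_add, map_sub,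
      LinearMap.sub_apply, ← fn_mul_of, mul_sub]
    abel
  · simp only [curvature, map_sub, map_neg, LinearMap.neg_apply, π.koszul_antisymm α β]
    abel
  · have hJ := hb.jacobi (ofForm 1 γ) (hasDegree_fn f) (hasDegree_fn g)
    rw [JacobiAt, mul_zero, pow_zero, one_smul, h.bracket_fn, h.bracket_one, h.bracket_one,
      h.bracket_one, h.bracket_one, h.bracket_one] at hJ
    simp only [curvature, map_sub, π.koszul_dFun, hJ, sub_self]

variable {D₂ : Form 𝕂 E M 1 →ₗ[𝕂] Form 𝕂 E M 2 →ₗ[𝕂] Form 𝕂 E M 2}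
  {B : Form 𝕂 E M 1 →ₗ[𝕂] Form 𝕂 E M 1 →ₗ[𝕂] Form 𝕂 E M 2}

/-- Both sides obey the same Leibniz rule, so their difference is linear over functions; it vanishes
on products of one-forms, which span the two-forms locally. -/
theorem bracket_two (h : IsRestriction br π D) (hb : IsGradedBracket br)
    (hD₂ : IsTwoFormExtension π D D₂) (f : SmoothFun 𝕂 E M) (θ : Form 𝕂 E M 2) :
    br (fn f) (ofForm 2 θ) = ofForm 2 (D₂ (dFun f) θ) := by
  have hf := hb.isDer (hasDegree_fn f)
  let Δ : Form 𝕂 E M 2 →ₗ[𝕂] Forms 𝕂 E M := br (fn f) ∘ₗ ofForm 2 - ofForm 2 ∘ₗ D₂ (dFun f)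
  have hΔ (χ : SmoothFun 𝕂 E M) (θ : Form 𝕂 E M 2) : Δ (χ • θ) = fn χ * Δ θ := by
    change br (fn f) (ofForm 2 (χ • θ)) - ofForm 2 (D₂ (dFun f) (χ • θ)) =
      fn χ * (br (fn f) (ofForm 2 θ) - ofForm 2 (D₂ (dFun f) θ))
    rw [hD₂.isConnection.leibniz, map_add, ← fn_mul_of, ← fn_mul_of, ← fn_mul_of, hf.map_fn_mul,
      h.bracket_fn, mul_sub]
    change fn (π.bracket f χ) * _ + _ - (_ + fn (π.bracket f χ) * _) = _
    abel
  have hw (β γ : Form 𝕂 E M 1) : Δ (wedge 1 1 β γ) = 0 := by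
    change br (fn f) (ofForm 2 (wedge 1 1 β γ)) - ofForm 2 (D₂ (dFun f) (wedge 1 1 β γ)) = 0
    rw [hD₂.map_wedge, map_add, ofForm_wedge_one_one, ofForm_wedge_one_one, ofForm_wedge_one_one,
      hf.map_mul, pow_zero, h.bracket_one, h.bracket_one]
    exact sub_self _
  refine sub_eq_zero.1 (eq_zero_of_local (s := Δ θ) fun p ↦ ?_)
  obtain ⟨χ, g, u, hχ, hθ, -⟩ := exists_local_decomposition θ p
  refine ⟨χ, hχ.self_of_nhds, ?_⟩
  have hθ' : χ • θ = ∑ i, wedge 1 1 (dFun (g i)) (u i) := ofForm_injective 2 (by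
    rw [← fn_mul_of, hθ, map_sum]
    exact Finset.sum_congr rfl fun i _ ↦ by rw [ofForm_wedge_one_one, ofForm_dFun])
  rw [← hΔ, hθ', map_sum]
  exact Finset.sum_eq_zero fun i _ ↦ hw _ _

/-- The difference of the two sides is tensorial in `α` by the product identities, and on `df` it
vanishes by the Leibniz identity for `d`. -/
theorem bracket_one_one (h : IsRestriction br π D) (hb : IsGradedBracket br)
    (hD₂ : IsTwoFormExtension π D D₂) (hB : IsOneFormBracket D D₂ B) (α β : Form 𝕂 E M 1) :
    br (ofForm 1 α) (ofForm 1 β) = ofForm 2 (B α β) := by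
  refine sub_eq_zero.1 (IsTensorial.eq_zero
    (F := fun α ↦ br (ofForm 1 α) (ofForm 1 β) - ofForm 2 (B α β))
    ⟨fun α γ ↦ ?_, fun f α ↦ ?_⟩ (fun f ↦ ?_) α)
  · simp only [map_add, LinearMap.add_apply]
    abel
  · rw [hB.product, map_add, ofForm_wedge_one_one, ← fn_mul_of, ← fn_mul_of,
      hb.fn_mul_one_left f (hasDegree_of 1 α) (hasDegree_of 1 β), h.bracket_one, mul_sub]
    abel
  · have h1 := congrArg (ofForm 2) (hB.leibniz f β)
    rw [map_add, ofForm_extD_one, ← h.bracket_one, ← h.bracket_two hb hD₂, ofForm_extD_one,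
      hb.map_dForms_fn, add_left_inj] at h1
    rw [ofForm_dFun, h1, sub_self]

/-- Any admissible `D₂` and `B` are restrictions of the bracket, so the defining expression of the
metacurvature is the Jacobi identity for `f`, `β`, `γ`. -/
theorem metacurvature_eq_zero (h : IsRestriction br π D) (hb : IsGradedBracket br) :
    IsMetacurvature π D 0 := by
  have hs (f : SmoothFun 𝕂 E M) : (0 : Form 𝕂 E M 2) = f • (0 : Form 𝕂 E M 2) :=
    ofForm_injective 2 (by rw [← fn_mul_of, map_zero, mul_zero])
  refine ⟨fun f _ _ _ ↦ hs f, fun f _ _ _ ↦ hs f, fun f _ _ _ ↦ hs f,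
    fun D₂ B hD₂ hB f β γ ↦ ofForm_injective 2 ?_⟩
  have hJ := hb.jacobi (ofForm 1 γ) (hasDegree_fn f) (hasDegree_of 1 β)
  rw [JacobiAt, zero_mul, pow_zero, one_smul] at hJ
  rw [LinearMap.zero_apply, LinearMap.zero_apply, LinearMap.zero_apply, map_zero, map_sub, map_sub,
    ← h.bracket_two hb hD₂, ← h.bracket_one_one hb hD₂ hB, ← h.bracket_one_one hb hD₂ hB,
    ← h.bracket_one_one hb hD₂ hB, hb.antisymm_one (hasDegree_of 1 (D (dFun f) γ)) (hasDegree_of 1 β),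
    ← h.bracket_one, ← h.bracket_one, hJ]
  abel

end IsRestriction

theorem GeneralizedPoissonBracket.exists_connection (b : GeneralizedPoissonBracket 𝕂 E M) :
    ∃ c : FlatPoissonConnection 𝕂 E M, IsRestriction b.1 c.π c.D := by
  have hb := b.isGradedBracket
  obtain ⟨π, hπ⟩ := hb.exists_bivector
  obtain ⟨D, hD, hD'⟩ := hb.exists_connection
  have h : IsRestriction b.1 π D := ⟨hD, hπ, hD'⟩
  exact ⟨⟨π, D, h.isPoisson hb, h.isConnection hb, h.flat hb, h.torsionFree hb,
    h.metacurvature_eq_zero hb⟩, h⟩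

end ConnectionOfBracket

end

end PoissonForms

namespace PoissonForms

noncomputable section

open DirectSum

/-! ### Uniqueness, reality and the bijection -/

section Correspondence

variable {𝕂 : Type*} [RCLike 𝕂] {E : Type*} [NormedAddCommGroup E] [NormedSpace ℝ E]
  [FiniteDimensional ℝ E] {M : Type*} [TopologicalSpace M] [T2Space M] [ChartedSpace E M]
  [IsManifold 𝓘(ℝ, E) ∞ M]

theorem IsGradedBracket.map_dForms_fn_right {br : Forms 𝕂 E M →ₗ[𝕂] Forms 𝕂 E M →ₗ[𝕂] Forms 𝕂 E M}
    (hb : IsGradedBracket br) {k : ℕ} {s : Forms 𝕂 E M} (hs : HasDegree k s)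
    (f : SmoothFun 𝕂 E M) : br s (dForms (fn f)) =
      -((-1 : 𝕂) ^ k • (dForms (br (fn f) s) - br (fn f) (dForms s))) := by
  have h := hb.map_dForms (fn f) hs
  rw [← neg_neg (br s (fn f)), ← neg_neg (br (dForms s) (fn f)), ← hb.fn_left f hs,
    ← hb.fn_left f hs.dForms, map_neg] at h
  rw [← smul_neg, neg_sub, sub_eq_add_neg, h, add_neg_cancel_left,
    neg_one_pow_smul_smul]

/-- The hypotheses fix the derivation `{f, ·}` on functions and exact one-forms, hence everywhere.
Antisymmetry and `map_dForms_fn_right` then fix `{σ, ·}` on functions and exact one-forms. -/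
theorem GeneralizedPoissonBracket.ext {b b' : GeneralizedPoissonBracket 𝕂 E M}
    (h0 : ∀ f g, b.1 (fn f) (fn g) = b'.1 (fn f) (fn g))
    (h1 : ∀ f α, b.1 (fn f) (ofForm 1 α) = b'.1 (fn f) (ofForm 1 α)) : b = b' := by
  have hb := b.isGradedBracket
  have hb' := b'.isGradedBracket
  have hf (f : SmoothFun 𝕂 E M) : b.1 (fn f) = b'.1 (fn f) :=
    (hb.isDer (hasDegree_fn f)).ext (hb'.isDer (hasDegree_fn f)) (h0 f) fun g ↦ by
      rw [← ofForm_dFun, h1]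
  refine Subtype.ext (Forms.linearMap_ext fun k σ ↦ ?_)
  have hσ := hasDegree_of k σ
  refine (hb.isDer hσ).ext (hb'.isDer hσ) (fun f ↦ ?_) fun f ↦ ?_
  · rw [← neg_inj, ← hb.fn_left f hσ, ← hb'.fn_left f hσ, hf]
  · rw [hb.map_dForms_fn_right hσ, hb'.map_dForms_fn_right hσ, hf]

theorem FlatPoissonConnection.ext {c c' : FlatPoissonConnection 𝕂 E M}
    (h0 : ∀ f g, c.π.bracket f g = c'.π.bracket f g)
    (h1 : ∀ f α, c.D (dFun f) α = c'.D (dFun f) α) : c = c' := by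
  have hπ : c.π = c'.π := Bivector.ext h0
  have hD : c.D = c'.D := LinearMap.ext₂ fun α β ↦ LinearMap.congr_fun (IsTensor.ext
    (κ := c.D.flip β) (κ' := c'.D.flip β) ⟨fun f α ↦ c.isConnection.smul_left f α β⟩
    ⟨fun f α ↦ c'.isConnection.smul_left f α β⟩ fun f ↦ h1 f β) α
  cases c
  cases c'
  cases hπ
  cases hD
  rfl

section Real

/-- In the chart the imaginary part of `f` is identically zero, and taking imaginary parts commutes
with differentiation. -/
theorem isRealElt_dForms_fn {f : SmoothFun 𝕂 E M} (hf : IsRealElt (fn f)) :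
    IsRealElt (dForms (fn f)) := by
  rw [← ofForm_dFun]
  refine isRealElt_of.2 fun x v ↦ ?_
  have hv : v = ![v 0] := by
    funext i
    rw [Subsingleton.elim i 0]
    rfl
  rw [hv]
  have hx := mem_extChartAt_source (I := 𝓘(ℝ, E)) x
  have h := at_dFun f hx (v 0)
  change RCLike.im (Form.at (E := E) x (dFun f) ![v 0]) = 0
  rw [h]
  have hd : DifferentiableAt ℝ (fun y ↦ f ((extChartAt 𝓘(ℝ, E) x).symm y))
      (extChartAt 𝓘(ℝ, E) x x) :=
    ((SmoothFun.contDiffOn f x).contDiffAt ((isOpen_target x).mem_nhds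
      (mem_extChartAt_target x))).differentiableAt (by simp)
  have h2 := (RCLike.imCLM (K := 𝕂)).hasFDerivAt.comp _ hd.hasFDerivAt
  have h3 : (RCLike.imCLM (K := 𝕂)) ∘ (fun y ↦ f ((extChartAt 𝓘(ℝ, E) x).symm y)) =
      fun _ ↦ (0 : ℝ) := funext fun y ↦ isRealElt_fn.1 hf _
  rw [h3] at h2
  exact DFunLike.congr_fun (h2.unique (hasFDerivAt_const _ _)) (chartD (E := E) x x (v 0))

theorem isRealElt_dForms {s : Forms 𝕂 E M} (hs : IsRealElt s) : IsRealElt (dForms s) :=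
  isDer_dForms.isReal (fun _ ↦ isRealElt_dForms_fn)
    (fun f _ ↦ by rw [dForms_dForms]; exact isRealElt_zero) (fun _ ↦ isRealElt_dForms_fn) hs

/-- Real one-forms are locally combinations of differentials of real functions with real
coefficients, so by tensoriality a real bracket gives real `π` and `D`. Conversely, reality spreads
along the determination of the bracket: from `π` and `D` to `{f, ·}`, then to `{σ, ·}`. -/
theorem IsRestriction.isReal_iff {b : GeneralizedPoissonBracket 𝕂 E M}
    {c : FlatPoissonConnection 𝕂 E M} (h : IsRestriction b.1 c.π c.D) :
    b.IsReal ↔ c.IsReal := by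
  have hb := b.isGradedBracket
  constructor
  · intro hr α β hα hβ
    have hr' {s t : Forms 𝕂 E M} (hs : IsRealElt s) (ht : IsRealElt t) : IsRealElt (b.1 s t) :=
      hr s t hs ht
    have hp {γ : Form 𝕂 E M 1} (hγ : IsRealForm γ) {g : SmoothFun 𝕂 E M} (hg : IsRealElt (fn g)) :
        IsRealElt (fn (c.π.pair γ (dFun g))) := by
      refine (c.π.isTensorial_pair (dFun g)).isReal (fun f hf ↦ ?_) hγ
      exact h.bracket_fn f g ▸ hr' hf hg
    constructor
    · refine isRealElt_of.1 ((c.π.isTensorial_pair β).isReal (fun f hf ↦ ?_) hα)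
      rw [c.π.fn_pair_antisymm]
      exact (hp hβ hf).neg
    · refine isRealElt_of.1 ((h.isTensorial β).isReal (fun f hf ↦ ?_) hα)
      rw [← h.bracket_one]
      exact hr' hf (isRealElt_of.2 hβ)
  · intro hr s t hs ht
    have hd {f : SmoothFun 𝕂 E M} (hf : IsRealElt (fn f)) : IsRealForm (dFun f) :=
      isRealElt_of.1 (by rw [ofForm_dFun]; exact isRealElt_dForms_fn hf)
    have hfn {f : SmoothFun 𝕂 E M} (hf : IsRealElt (fn f)) {t : Forms 𝕂 E M} (ht : IsRealElt t) :
        IsRealElt (b.1 (fn f) t) := by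
      refine (hb.isDer (hasDegree_fn f)).isReal (fun g hg ↦ ?_) (fun g hg ↦ ?_)
        (fun _ ↦ isRealElt_dForms_fn) ht
      · rw [h.bracket_fn]
        exact isRealElt_of.2 (hr _ _ (hd hf) (hd hg)).1
      · rw [← ofForm_dFun, h.bracket_one]
        exact isRealElt_of.2 (hr _ _ (hd hf) (hd hg)).2
    refine IsRealElt.of_linear (δ := b.1.flip t) (fun k σ hσ ↦ ?_) hs
    have hdeg := hasDegree_of k σ
    have hσ' := isRealElt_of.2 hσ
    refine (hb.isDer hdeg).isReal (fun f hf ↦ ?_) (fun f hf ↦ ?_)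
      (fun _ ↦ isRealElt_dForms_fn) ht
    · rw [← neg_neg (b.1 (ofForm k σ) (fn f)), ← hb.fn_left f hdeg]
      exact (hfn hf hσ').neg
    · rw [hb.map_dForms_fn_right hdeg]
      refine (IsRealElt.neg ?_)
      have h2 := (isRealElt_dForms (hfn hf hσ')).sub (hfn hf (isRealElt_dForms hσ'))
      rcases neg_one_pow_eq_or 𝕂 k with e | e <;> rw [e]
      · rwa [one_smul]
      · rw [neg_one_smul]
        exact h2.neg

end Real

/-- Generalized Poisson brackets correspond to Poisson structures with a flat, torsion-free
contravariant connection of zero metacurvature. -/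
theorem exists_equiv : ∃ Φ : GeneralizedPoissonBracket 𝕂 E M ≃ FlatPoissonConnection 𝕂 E M,
    ∀ b, IsRestriction b.1 (Φ b).π (Φ b).D := by
  choose φ hφ using GeneralizedPoissonBracket.exists_connection (𝕂 := 𝕂) (E := E) (M := M)
  -- Injectivity is the uniqueness of the bracket. For surjectivity, the bracket built from `c` is
  -- sent back to `c`, because a connection is determined by its values on functions and exact
  -- forms.
  refine ⟨Equiv.ofBijective φ ⟨fun b b' e ↦ ?_, fun c ↦ ?_⟩, hφ⟩
  · refine GeneralizedPoissonBracket.ext (fun f g ↦ ?_) fun f α ↦ ?_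
    · rw [(hφ b).bracket_fn, (hφ b').bracket_fn, e]
    · rw [(hφ b).bracket_one, (hφ b').bracket_one, e]
  · obtain ⟨b, hb0, hb1⟩ := c.exists_bracket
    refine ⟨b, FlatPoissonConnection.ext (fun f g ↦ fn_injective ?_)
      fun f α ↦ ofForm_injective 1 ?_⟩
    · rw [← (hφ b).bracket_fn, hb0]
    · rw [← (hφ b).bracket_one, hb1]

end Correspondence

end

end PoissonForms

theorem mainTheorem5 {𝕂 : Type*} [RCLike 𝕂]
    {E : Type*} [NormedAddCommGroup E] [NormedSpace ℝ E] [FiniteDimensional ℝ E]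
    {M : Type*} [TopologicalSpace M] [T2Space M] [SecondCountableTopology M] [ChartedSpace E M]
    [IsManifold 𝓘(ℝ, E) ∞ M] :
    ∃ Φ : GeneralizedPoissonBracket 𝕂 E M ≃ FlatPoissonConnection 𝕂 E M,
      ∀ b : GeneralizedPoissonBracket 𝕂 E M,
        (∀ f g : SmoothFun 𝕂 E M, b.1 (ofForm 0 (ofFun f)) (ofForm 0 (ofFun g)) =
          ofForm 0 (ofFun ((Φ b).π.bracket f g))) ∧
        (∀ (f : SmoothFun 𝕂 E M) (α : Form 𝕂 E M 1),
          b.1 (ofForm 0 (ofFun f)) (ofForm 1 α) = ofForm 1 ((Φ b).D (dFun f) α)) ∧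
        (b.IsReal ↔ (Φ b).IsReal) := by
  obtain ⟨Φ, hΦ⟩ := exists_equiv (𝕂 := 𝕂) (E := E) (M := M)
  exact ⟨Φ, fun b ↦ ⟨(hΦ b).bracket_fn, (hΦ b).bracket_one, (hΦ b).isReal_iff⟩⟩
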